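/- **Theorem (Normal form for Frobenius 3-structures).** *Setting.* In a monoidal category, let $A$ and $A^*$ be two-sided duals: there are $\eta\colon I\to A^*\otimes A$, $\varepsilon\colon A\otimes A^*\to I$, $\eta'\colon I\to A\otimes A^*$, $\varepsilon'\colon A^*\otimes A\to I$ such that $(\eta,\varepsilon)$ and $(\eta',\varepsilon')$ each satisfy the snake equations. A *Frobenius 3-structure* is a morphism $\mu\colon A\otimes A^*\otimes A\to A$ that satisfies associativity, $\mu\circ(\mu\otimes \mathrm{id}\otimes\mathrm{id})=\mu\circ(\mathrm{id}\otimes\mathrm{id}\otimes\mu)$, and symmetry: bending the last two inputs of $\mu$ around the right (with $\eta$ and $\eta'$) gives the same morphism $\delta\colon A\to A\otimes A^*\otimes A$ as bending its first two inputs around the left. Its *left loop* is $L=\mu\circ(\eta'\otimes\mathrm{id}_A)$ and its *right loop* is $R=\mu\circ(\mathrm{id}_A\otimes\eta)$. It satisfies *sliding* when $\mu\circ(R\otimes\mathrm{id}\otimes\mathrm{id})=R\circ\mu$ and $\mu\circ(\mathrm{id}\otimes\mathrm{id}\otimes L)=L\circ\mu$. In a symmetric monoidal category it is *commutative* when $\mu$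 is unchanged by exchanging its first and third inputs, and $\varepsilon=\varepsilon'\circ\sigma_{A,A^*}$ for the symmetry $\sigma$. A *Frobenius 3-structure diagram* is a finite connected diagram built from $\mu,\delta,\eta,\eta',\varepsilon,\varepsilon'$ by identities, composition and tensor products; a *commutative* one may also use the symmetry maps exchanging any two wires labelled $A$ or $A^*$ (a symmetry map does not connect the two wires). Its inputs and outputs are finite lists of copies of $A$ and $A^*$. *Bending* an input (output) turns it into an output (input) of the dual type, by means of the corresponding cup (cap): the leftmost leg around the left side or the rightmost leg around the right side. Two diagrams are *equal* when they denote the same morphism. Two commutative diagrams are *equivalent* when one can be obtained from the other, up to equality, by bending any number of inputs and outputs and applying symmetry maps to the inputs and to the outputs. For $p,q,m,n\ge 0$ the *normal form* $N_{p,q}^{m,n}\colon (A\otimes A^*)^{\otimes p}\otimes A\to (A\otimes A^*)^{\otimes q}\otimes A$ is $$N_{p,q}^{m,n}=\delta_q\circ R^n\circ L^m\circ \mu_p ,$$ where $\mu_0=\mathrm{id}_A$, $\mu_{p+1}=\mu_p\circ(\mu\otimes\mathrm{id})$ is the chain of $p+1$ multiplications, and $\delta_0=\mathrm{id}_A$,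 $\delta_{q+1}=(\delta\otimes\mathrm{id})\circ\delta_q$. *Claim.* Let $(A,A^*,\mu)$ be a Frobenius 3-structure that satisfies sliding. 1. For any Frobenius 3-structure diagram with at least one input there are $p,q,m,n$ such that, after bending at most one input and at most one output, the diagram is equal to $N_{p,q}^{m,n}$. 2. Suppose that the monoidal category is symmetric and the structure is commutative. Any commutative Frobenius 3-structure diagram with at least one input or output is equivalent to $N_{p,q}^{n,0}$ for some $p,q,n$. A commutative Frobenius 3-structure diagram without inputs and outputs is equal to the closure $\varepsilon\circ(N_{0,0}^{n,0}\otimes\mathrm{id}_{A^*})\circ\eta'$ of a normal form, for some $n$. -/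

import Mathlib

open CategoryTheory MonoidalCategory

universe v u

/-- The two kinds of wires: `up` stands for the object `A`, `down` for its dual `A*`. -/
inductive Strand : Type
  | up
  | down

/-- Passing to the dual kind of wire. -/
def Strand.flip : Strand → Strand
  | .up => .down
  | .down => .up

/-- Two-sided dual objects `A` and `A*` in a monoidal category: cups `I ⟶ A* ⊗ A` and `I ⟶ A ⊗ A*`
and caps `A ⊗ A* ⟶ I` and `A* ⊗ A ⟶ I` satisfying all four snake equations. -/
structure DualObjects (C : Type u) [Category.{v} C] [MonoidalCategory C] where
  /-- The object `A`. -/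
  A : C
  /-- The dual object `A*`. -/
  Ad : C
  /-- `A*` is a left dual of `A`: `η : I ⟶ A* ⊗ A` and `ε : A ⊗ A* ⟶ I`. -/
  leftDual : ExactPairing Ad A
  /-- `A` is a left dual of `A*`: `η' : I ⟶ A ⊗ A*` and `ε' : A* ⊗ A ⟶ I`. -/
  rightDual : ExactPairing A Ad

namespace DualObjects

variable {C : Type u} [Category.{v} C] [MonoidalCategory C] (P : DualObjects C)

/-- `η : I ⟶ A* ⊗ A`. -/
def cup : 𝟙_ C ⟶ P.Ad ⊗ P.A := P.leftDual.coevaluation'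

/-- `ε : A ⊗ A* ⟶ I`. -/
def cap : P.A ⊗ P.Ad ⟶ 𝟙_ C := P.leftDual.evaluation'

/-- `η' : I ⟶ A ⊗ A*`. -/
def cupSwap : 𝟙_ C ⟶ P.A ⊗ P.Ad := P.rightDual.coevaluation'

/-- `ε' : A* ⊗ A ⟶ I`. -/
def capSwap : P.Ad ⊗ P.A ⟶ 𝟙_ C := P.rightDual.evaluation'

/-- The object carried by a wire. -/
def ob : Strand → C
  | .up => P.A
  | .down => P.Ad

/-- The cup `I ⟶ s ⊗ s*`. -/
def cupAt : (s : Strand) → (𝟙_ C ⟶ P.ob s ⊗ P.ob s.flip)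
  | .up => P.cupSwap
  | .down => P.cup

/-- The cup `I ⟶ s* ⊗ s`. -/
def cupAtFlip : (s : Strand) → (𝟙_ C ⟶ P.ob s.flip ⊗ P.ob s)
  | .up => P.cup
  | .down => P.cupSwap

/-- The cap `s ⊗ s* ⟶ I`. -/
def capAt : (s : Strand) → (P.ob s ⊗ P.ob s.flip ⟶ 𝟙_ C)
  | .up => P.cap
  | .down => P.capSwap

/-- The cap `s* ⊗ s ⟶ I`. -/
def capAtFlip : (s : Strand) → (P.ob s.flip ⊗ P.ob s ⟶ 𝟙_ C)
  | .up => P.capSwap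
  | .down => P.cap

/-- The tensor product of a list of wires, bracketed to the right and ending in the unit. -/
def word : List Strand → C
  | [] => 𝟙_ C
  | s :: w => P.ob s ⊗ word w

/-- The coherence isomorphism between the tensor product of a concatenation and the tensor product
of the two tensor products. -/
def wordAppend : (w w' : List Strand) → (P.word (w ++ w') ≅ P.word w ⊗ P.word w')
  | [], w' => (λ_ (P.word w')).symm
  | s :: w, w' =>
      whiskerLeftIso (P.ob s) (wordAppend w w') ≪≫ (α_ (P.ob s) (P.word w) (P.word w')).symm

/-- The coherence isomorphism splitting off the last wire. -/
def wordSnoc (w : List Strand) (s : Strand) : P.word (w ++ [s]) ≅ P.word w ⊗ P.ob s :=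
  P.wordAppend w [s] ≪≫ whiskerLeftIso (P.word w) (ρ_ (P.ob s))

/-- A morphism between tensor products of copies of `A` and `A*`, with its type. -/
structure Mor where
  /-- The list of inputs. -/
  src : List Strand
  /-- The list of outputs. -/
  tgt : List Strand
  /-- The morphism. -/
  hom : P.word src ⟶ P.word tgt

/-- Bending the first input around the left side; it becomes the first output. -/
def bendInLeft (s : Strand) (w w' : List Strand) (f : P.word (s :: w) ⟶ P.word w') :
    P.word w ⟶ P.word (s.flip :: w') :=
  (λ_ (P.word w)).inv ≫ P.cupAtFlip s ▷ P.word w ≫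
    (α_ (P.ob s.flip) (P.ob s) (P.word w)).hom ≫ P.ob s.flip ◁ f

/-- Bending the last input around the right side; it becomes the last output. -/
def bendInRight (s : Strand) (w w' : List Strand) (f : P.word (w ++ [s]) ⟶ P.word w') :
    P.word w ⟶ P.word (w' ++ [s.flip]) :=
  (ρ_ (P.word w)).inv ≫ P.word w ◁ P.cupAt s ≫
    (α_ (P.word w) (P.ob s) (P.ob s.flip)).inv ≫
    ((P.wordSnoc w s).inv ≫ f) ▷ P.ob s.flip ≫ (P.wordSnoc w' s.flip).inv

/-- Bending the first output around the left side; it becomes the first input. -/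
def bendOutLeft (s : Strand) (w w' : List Strand) (f : P.word w ⟶ P.word (s :: w')) :
    P.word (s.flip :: w) ⟶ P.word w' :=
  P.ob s.flip ◁ f ≫ (α_ (P.ob s.flip) (P.ob s) (P.word w')).inv ≫
    P.capAtFlip s ▷ P.word w' ≫ (λ_ (P.word w')).hom

/-- Bending the last output around the right side; it becomes the last input. -/
def bendOutRight (s : Strand) (w w' : List Strand) (f : P.word w ⟶ P.word (w' ++ [s])) :
    P.word (w ++ [s.flip]) ⟶ P.word w' :=
  (P.wordSnoc w s.flip).hom ≫ (f ≫ (P.wordSnoc w' s).hom) ▷ P.ob s.flip ≫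
    (α_ (P.word w') (P.ob s) (P.ob s.flip)).hom ≫ P.word w' ◁ P.capAt s ≫ (ρ_ (P.word w')).hom

/-- `BendIn f g`: the morphism `g` is obtained from `f` by bending one input. -/
inductive BendIn : P.Mor → P.Mor → Prop
  | left (s : Strand) (w w' : List Strand) (f : P.word (s :: w) ⟶ P.word w') :
      BendIn ⟨s :: w, w', f⟩ ⟨w, s.flip :: w', P.bendInLeft s w w' f⟩
  | right (s : Strand) (w w' : List Strand) (f : P.word (w ++ [s]) ⟶ P.word w') :
      BendIn ⟨w ++ [s], w', f⟩ ⟨w, w' ++ [s.flip], P.bendInRight s w w' f⟩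

/-- `BendOut f g`: the morphism `g` is obtained from `f` by bending one output. -/
inductive BendOut : P.Mor → P.Mor → Prop
  | left (s : Strand) (w w' : List Strand) (f : P.word w ⟶ P.word (s :: w')) :
      BendOut ⟨w, s :: w', f⟩ ⟨s.flip :: w, w', P.bendOutLeft s w w' f⟩
  | right (s : Strand) (w w' : List Strand) (f : P.word w ⟶ P.word (w' ++ [s])) :
      BendOut ⟨w, w' ++ [s], f⟩ ⟨w ++ [s.flip], w', P.bendOutRight s w w' f⟩

/-- The morphism `g` is obtained from `f` by bending at most one input and at most one output. -/
def BendAtMostOne (f g : P.Mor) : Prop :=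
  ∃ h : P.Mor, Relation.ReflGen P.BendIn f h ∧ Relation.ReflGen P.BendOut h g

/-- The symmetry map exchanging two neighbouring wires in a word. -/
def swapAt [SymmetricCategory C] (a b : Strand) (y : List Strand) :
    (x : List Strand) → (P.word (x ++ a :: b :: y) ⟶ P.word (x ++ b :: a :: y))
  | [] => (α_ (P.ob a) (P.ob b) (P.word y)).inv ≫ (β_ (P.ob a) (P.ob b)).hom ▷ P.word y ≫
      (α_ (P.ob b) (P.ob a) (P.word y)).hom
  | s :: x => P.ob s ◁ swapAt a b y x

/-- One step of the equivalence of commutative diagrams: bend an input or an output, or apply a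
symmetry map to the inputs or to the outputs. -/
inductive EquivStep [SymmetricCategory C] : P.Mor → P.Mor → Prop
  | bendIn (f g : P.Mor) : P.BendIn f g → EquivStep f g
  | bendOut (f g : P.Mor) : P.BendOut f g → EquivStep f g
  | swapIn (a b : Strand) (x y w' : List Strand) (f : P.word (x ++ a :: b :: y) ⟶ P.word w') :
      EquivStep ⟨x ++ a :: b :: y, w', f⟩ ⟨x ++ b :: a :: y, w', P.swapAt b a y x ≫ f⟩
  | swapOut (a b : Strand) (x y w : List Strand) (f : P.word w ⟶ P.word (x ++ a :: b :: y)) :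
      EquivStep ⟨w, x ++ a :: b :: y, f⟩ ⟨w, x ++ b :: a :: y, f ≫ P.swapAt a b y x⟩

/-- Two morphisms are equivalent when they can be obtained from one another by bending any number
of inputs and outputs and applying symmetry maps. -/
def Equivalent [SymmetricCategory C] : P.Mor → P.Mor → Prop := Relation.EqvGen P.EquivStep

/-- For a morphism `m : A ⊗ A* ⊗ A ⟶ A`, the morphism `A ⟶ A ⊗ A* ⊗ A` obtained by bending the
second and the third input around the right side. -/
def bendMulRight (m : P.A ⊗ P.Ad ⊗ P.A ⟶ P.A) : P.A ⟶ P.A ⊗ P.Ad ⊗ P.A :=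
  (ρ_ P.A).inv ≫
  P.A ◁ (P.cup ≫ P.Ad ◁ ((λ_ P.A).inv ≫ P.cupSwap ▷ P.A ≫ (α_ P.A P.Ad P.A).hom) ≫
    (α_ P.Ad P.A (P.Ad ⊗ P.A)).inv) ≫
  (α_ P.A (P.Ad ⊗ P.A) (P.Ad ⊗ P.A)).inv ≫ m ▷ (P.Ad ⊗ P.A)

/-- For a morphism `m : A ⊗ A* ⊗ A ⟶ A`, the morphism `A ⟶ A ⊗ A* ⊗ A` obtained by bending the
first and the second input around the left side. -/
def bendMulLeft (m : P.A ⊗ P.Ad ⊗ P.A ⟶ P.A) : P.A ⟶ P.A ⊗ P.Ad ⊗ P.A :=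
  (λ_ P.A).inv ≫
  (P.cupSwap ≫ P.A ◁ ((λ_ P.Ad).inv ≫ P.cup ▷ P.Ad ≫ (α_ P.Ad P.A P.Ad).hom) ≫
    (α_ P.A P.Ad (P.A ⊗ P.Ad)).inv) ▷ P.A ≫
  (α_ (P.A ⊗ P.Ad) (P.A ⊗ P.Ad) P.A).hom ≫
  (P.A ⊗ P.Ad) ◁ ((α_ P.A P.Ad P.A).hom ≫ m) ≫ (α_ P.A P.Ad P.A).hom

end DualObjects

/-- A Frobenius 3-structure: two-sided dual objects `A`, `A*` with a ternary multiplication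
`A ⊗ A* ⊗ A ⟶ A` satisfying associativity and symmetry. -/
structure FrobeniusThreeStructure (C : Type u) [Category.{v} C] [MonoidalCategory C]
    extends DualObjects C where
  /-- The multiplication. -/
  mul : A ⊗ Ad ⊗ A ⟶ A
  /-- Associativity: `[a, b, [c, d, e]] = [[a, b, c], d, e]`. -/
  associativity : A ◁ Ad ◁ mul ≫ mul =
    A ◁ (α_ Ad A (Ad ⊗ A)).inv ≫ (α_ A (Ad ⊗ A) (Ad ⊗ A)).inv ≫ mul ▷ (Ad ⊗ A) ≫ mul
  /-- Symmetry. -/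
  symmetry : toDualObjects.bendMulRight mul = toDualObjects.bendMulLeft mul

namespace FrobeniusThreeStructure

variable {C : Type u} [Category.{v} C] [MonoidalCategory C] (S : FrobeniusThreeStructure C)

/-- The comultiplication: the common value of the two sides of the symmetry equation. -/
def comul : S.A ⟶ S.A ⊗ S.Ad ⊗ S.A := S.bendMulRight S.mul

/-- The left loop: the first two inputs of the multiplication are connected by a cup. -/
def leftLoop : S.A ⟶ S.A :=
  (λ_ S.A).inv ≫ S.cupSwap ▷ S.A ≫ (α_ S.A S.Ad S.A).hom ≫ S.mul

/-- The right loop: the last two inputs of the multiplication are connected by a cup. -/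
def rightLoop : S.A ⟶ S.A :=
  (ρ_ S.A).inv ≫ S.A ◁ S.cup ≫ S.mul

/-- Sliding: a right loop on the first input, and a left loop on the third input, can be moved to
the output of the multiplication. -/
def Sliding : Prop :=
  S.rightLoop ▷ (S.Ad ⊗ S.A) ≫ S.mul = S.mul ≫ S.rightLoop ∧
  S.A ◁ S.Ad ◁ S.leftLoop ≫ S.mul = S.mul ≫ S.leftLoop

/-- The opposite multiplication: the first and the third input are exchanged. -/
def mulOpposite [SymmetricCategory C] : S.A ⊗ S.Ad ⊗ S.A ⟶ S.A :=
  (β_ S.A (S.Ad ⊗ S.A)).hom ≫ (β_ S.Ad S.A).hom ▷ S.A ≫ (α_ S.A S.Ad S.A).hom ≫ S.mul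

/-- A Frobenius 3-structure in a symmetric monoidal category is commutative when it equals its
opposite and `A`, `A*` are symmetric duals. -/
def Commutative [SymmetricCategory C] : Prop :=
  S.mulOpposite = S.mul ∧ S.cap = (β_ S.A S.Ad).hom ≫ S.capSwap

/-- The word `A* A A* A ⋯ A* A` of length `2p`. -/
def tailWord : ℕ → List Strand
  | 0 => []
  | p + 1 => .down :: .up :: tailWord p

/-- The word `A A* A ⋯ A* A` of length `2p + 1`. -/
def oddWord (p : ℕ) : List Strand := .up :: tailWord p

/-- The chain of `p` multiplications `[⋯ [[a₀, b₁, a₁], b₂, a₂] ⋯, b_p, a_p]`. -/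
def mulChain : (p : ℕ) → (S.A ⊗ S.word (tailWord p) ⟶ S.A)
  | 0 => (ρ_ S.A).hom
  | p + 1 => S.A ◁ (α_ S.Ad S.A (S.word (tailWord p))).inv ≫
      (α_ S.A (S.Ad ⊗ S.A) (S.word (tailWord p))).inv ≫
      S.mul ▷ S.word (tailWord p) ≫ mulChain p

/-- The chain of `q` comultiplications, the vertical reflection of the chain of multiplications. -/
def comulChain : (q : ℕ) → (S.A ⟶ S.A ⊗ S.word (tailWord q))
  | 0 => (ρ_ S.A).inv
  | q + 1 => comulChain q ≫ S.comul ▷ S.word (tailWord q) ≫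
      (α_ S.A (S.Ad ⊗ S.A) (S.word (tailWord q))).hom ≫
      S.A ◁ (α_ S.Ad S.A (S.word (tailWord q))).hom

/-- The `n`-fold composite of an endomorphism. -/
def iter {X : C} (f : X ⟶ X) : ℕ → (X ⟶ X)
  | 0 => 𝟙 X
  | n + 1 => iter f n ≫ f

/-- The morphism in normal form with `2p + 1` inputs, `2q + 1` outputs, `m` left loops and
`n` right loops. -/
def normalForm (p q m n : ℕ) : S.Mor where
  src := oddWord p
  tgt := oddWord q
  hom := S.mulChain p ≫ iter S.leftLoop m ≫ iter S.rightLoop n ≫ S.comulChain q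

/-- The closure of an endomorphism of `A`: its output is connected to its input. -/
def closure (f : S.A ⟶ S.A) : 𝟙_ C ⟶ 𝟙_ C := S.cupSwap ≫ f ▷ S.Ad ≫ S.cap

end FrobeniusThreeStructure

/-- The two kinds of diagrams: without swaps, and with swaps. -/
inductive Flavour : Type
  | planar
  | commutative

/-- The pieces from which diagrams are built, with their lists of inputs and outputs. -/
inductive Piece : Flavour → List Strand → List Strand → Type
  | mul {k : Flavour} : Piece k [.up, .down, .up] [.up]
  | comul {k : Flavour} : Piece k [.up] [.up, .down, .up]
  | cup {k : Flavour} : Piece k [] [.down, .up]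
  | cupSwap {k : Flavour} : Piece k [] [.up, .down]
  | cap {k : Flavour} : Piece k [.up, .down] []
  | capSwap {k : Flavour} : Piece k [.down, .up] []
  | swap (a b : Strand) : Piece .commutative [a, b] [b, a]

/-- Diagrams: built from the pieces using identities, composition and tensor products. -/
inductive Diagram (k : Flavour) : List Strand → List Strand → Type
  | piece {w w' : List Strand} (x : Piece k w w') : Diagram k w w'
  | ident (w : List Strand) : Diagram k w w
  | comp {w w' w'' : List Strand} (d : Diagram k w w') (e : Diagram k w' w'') : Diagram k w w''
  | tensor {w₁ w₁' w₂ w₂' : List Strand} (d : Diagram k w₁ w₁') (e : Diagram k w₂ w₂') :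
      Diagram k (w₁ ++ w₂) (w₁' ++ w₂')

/-- The connected components of a single piece: a swap consists of two separate wires, every other
piece is connected. -/
def Piece.Node {k : Flavour} : {w w' : List Strand} → Piece k w w' → Type
  | _, _, .mul => Unit
  | _, _, .comul => Unit
  | _, _, .cup => Unit
  | _, _, .cupSwap => Unit
  | _, _, .cap => Unit
  | _, _, .capSwap => Unit
  | _, _, .swap _ _ => Fin 2

/-- The component of a piece to which an input is attached. -/
def Piece.inNode {k : Flavour} :
    {w w' : List Strand} → (x : Piece k w w') → Fin w.length → x.Node
  | _, _, .mul => fun _ => ()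
  | _, _, .comul => fun _ => ()
  | _, _, .cup => fun _ => ()
  | _, _, .cupSwap => fun _ => ()
  | _, _, .cap => fun _ => ()
  | _, _, .capSwap => fun _ => ()
  | _, _, .swap _ _ => fun (i : Fin 2) => i

/-- The component of a piece to which an output is attached. -/
def Piece.outNode {k : Flavour} :
    {w w' : List Strand} → (x : Piece k w w') → Fin w'.length → x.Node
  | _, _, .mul => fun _ => ()
  | _, _, .comul => fun _ => ()
  | _, _, .cup => fun _ => ()
  | _, _, .cupSwap => fun _ => ()
  | _, _, .cap => fun _ => ()
  | _, _, .capSwap => fun _ => ()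
  | _, _, .swap _ _ => fun (i : Fin 2) => i.rev

namespace Diagram

variable {k : Flavour}

/-- The nodes of a diagram: the components of the pieces and the identity wires it is built
from. -/
def Node : {w w' : List Strand} → Diagram k w w' → Type
  | _, _, .piece x => x.Node
  | _, _, .ident w => Fin w.length
  | _, _, .comp d e => d.Node ⊕ e.Node
  | _, _, .tensor d e => d.Node ⊕ e.Node

/-- The node to which an input is attached. -/
def inNode : {w w' : List Strand} → (d : Diagram k w w') → Fin w.length → d.Node
  | _, _, .piece x => x.inNode
  | _, _, .ident _ => fun i => i
  | _, _, .comp d _ => fun i => Sum.inl (d.inNode i)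
  | _, _, .tensor d e => fun i =>
      Fin.addCases (fun j => Sum.inl (d.inNode j)) (fun j => Sum.inr (e.inNode j))
        (Fin.cast List.length_append i)

/-- The node to which an output is attached. -/
def outNode : {w w' : List Strand} → (d : Diagram k w w') → Fin w'.length → d.Node
  | _, _, .piece x => x.outNode
  | _, _, .ident _ => fun i => i
  | _, _, .comp _ e => fun i => Sum.inr (e.outNode i)
  | _, _, .tensor d e => fun i =>
      Fin.addCases (fun j => Sum.inl (d.outNode j)) (fun j => Sum.inr (e.outNode j))
        (Fin.cast List.length_append i)

/-- Two nodes are linked when they are glued along a wire in some composition. -/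
def Link : {w w' : List Strand} → (d : Diagram k w w') → d.Node → d.Node → Prop
  | _, _, .piece _ => fun _ _ => False
  | _, _, .ident _ => fun _ _ => False
  | _, _, .comp d e => fun (x y : d.Node ⊕ e.Node) =>
      match x, y with
      | .inl x, .inl y => d.Link x y
      | .inr x, .inr y => e.Link x y
      | .inl x, .inr y => ∃ i, d.outNode i = x ∧ e.inNode i = y
      | .inr _, .inl _ => False
  | _, _, .tensor d e => fun (x y : d.Node ⊕ e.Node) =>
      match x, y with
      | .inl x, .inl y => d.Link x y
      | .inr x, .inr y => e.Link x y
      | .inl _, .inr _ => False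
      | .inr _, .inl _ => False

/-- A diagram is connected when it is non-empty and any two of its nodes are joined by a chain of
links. -/
def Connected {w w' : List Strand} (d : Diagram k w w') : Prop :=
  Nonempty d.Node ∧ ∀ x y : d.Node, Relation.EqvGen d.Link x y

end Diagram

namespace FrobeniusThreeStructure

variable {C : Type u} [Category.{v} C] [MonoidalCategory C] (S : FrobeniusThreeStructure C)

/-- The morphism denoted by a piece, given the morphisms denoted by the swaps (if swaps are
allowed). -/
def evalPiece {k : Flavour}
    (σ : k = .commutative → (a b : Strand) → (S.ob a ⊗ S.ob b ⟶ S.ob b ⊗ S.ob a)) :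
    {w w' : List Strand} → Piece k w w' → (S.word w ⟶ S.word w')
  | _, _, .mul => S.A ◁ S.Ad ◁ (ρ_ S.A).hom ≫ S.mul ≫ (ρ_ S.A).inv
  | _, _, .comul => (ρ_ S.A).hom ≫ S.comul ≫ S.A ◁ S.Ad ◁ (ρ_ S.A).inv
  | _, _, .cup => S.cup ≫ S.Ad ◁ (ρ_ S.A).inv
  | _, _, .cupSwap => S.cupSwap ≫ S.A ◁ (ρ_ S.Ad).inv
  | _, _, .cap => S.A ◁ (ρ_ S.Ad).hom ≫ S.cap
  | _, _, .capSwap => S.Ad ◁ (ρ_ S.A).hom ≫ S.capSwap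
  | _, _, .swap a b => S.ob a ◁ (ρ_ (S.ob b)).hom ≫ σ rfl a b ≫ S.ob b ◁ (ρ_ (S.ob a)).inv

/-- The morphism denoted by a diagram, given the morphisms denoted by the swaps (if swaps are
allowed). -/
def evalWith {k : Flavour}
    (σ : k = .commutative → (a b : Strand) → (S.ob a ⊗ S.ob b ⟶ S.ob b ⊗ S.ob a)) :
    {w w' : List Strand} → Diagram k w w' → (S.word w ⟶ S.word w')
  | _, _, .piece x => S.evalPiece σ x
  | _, _, .ident w => 𝟙 (S.word w)
  | _, _, .comp d e => evalWith σ d ≫ evalWith σ e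
  | _, _, .tensor (w₁ := w₁) (w₁' := w₁') (w₂ := w₂) (w₂' := w₂') d e =>
      (S.wordAppend w₁ w₂).hom ≫ (evalWith σ d ⊗ₘ evalWith σ e) ≫ (S.wordAppend w₁' w₂').inv

/-- The morphism denoted by a Frobenius 3-structure diagram (without swaps). -/
def eval {w w' : List Strand} (d : Diagram .planar w w') : S.word w ⟶ S.word w' :=
  S.evalWith (fun h => Flavour.noConfusion h) d

/-- The morphism denoted by a commutative Frobenius 3-structure diagram: the swaps denote the
symmetry of the category. -/
def evalComm [SymmetricCategory C] {w w' : List Strand} (d : Diagram .commutative w w') :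
    S.word w ⟶ S.word w' :=
  S.evalWith (fun _ a b => (β_ (S.ob a) (S.ob b)).hom) d

end FrobeniusThreeStructure

/-!
Diagrams are evaluated as partial operations on words of wires (`DualObjects.Tr`). An operation acts
at the front of a word and carries along all wires further to the right, so that composition in the
monoid of operations and the shift `sh` (leave the first wire alone) replace tensor products and
their associators. The operation of a diagram represents the morphism it denotes (`DualObjects.Rep`,
`FrobeniusThreeStructure.rep_act`), and operations are compared by extension, since a cap is
undefined on two wires of the same kind.

The multiplication, rotated in all possible ways, is a four-legged vertex: a comultiplication on `A`
together with its dual on `A*`. Associativity and symmetry say that a tree of vertices is determined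
by its number of legs and the kind of its first leg. With all its inputs bent around the left side,
such a tree is a *spider*: a cup followed by loops and comultiplications on its left end. A spider
absorbs further comultiplications and, owing to sliding, loops on any of its legs; hence it absorbs
a cap on two neighbouring legs, which produces a loop, and two spiders connected along a leg form a
single one (`spider_mul_gr`, `spider_mul_ca`, `sh_spider_mul_ca_le`, `spider_mul_ca_le`).

A diagram is followed piece by piece, starting from the cups that bend its inputs. At each stage the
operation is a product of spiders, inserted between each other's legs, one for each connected
component of what has been drawn so far (`NestedVertex.Tidy`). Every piece preserves this form: cups
are new spiders, comultiplications are absorbed, and caps connect two neighbouring legs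
(`Tidy.joined`, `traced`). A connected diagram therefore ends as a single spider
(`exists_tidy_state`, `Tidy.eq_spider`). The normal forms, with their inputs bent, are spiders as
well, and every spider whose first leg is `A*` arises in this way (`state_normalForm_le`), so that a
morphism whose legs are arranged as those of a normal form equals one (`eq_normalForm`). The legs of
a spider alternate between `A` and `A*`, and bending at most one input and one output achieves this
arrangement (`bendAtMostOne_of_connected`).

In the commutative case the legs of the spiders may have been permuted. A wire can be pulled across
any operation, and exchanging the first and the third leg of a vertex has no effect, whence the left
and the right loop agree (`Braiding.gr_exchange`, `Braiding.rt_eq_lf`). Two distant legs can thus be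
moved next to each other before they are connected, at the price of exchanging outputs
(`Braiding.joined_far`). A connected diagram with legs is a single spider followed by symmetry maps
on its outputs, which the equivalence allows to be undone (`hasNormalForm_of_tidy`); without legs it
is a spider whose last two legs have been connected, that is, the closure of a normal form
(`eq_closure_of_connected`).
-/

/-! ### Duals and ternary operations acting on all wires to their right -/

section NestedCalculus

variable {C : Type u} [Category.{v} C] [MonoidalCategory C]

/-- Two-sided duals in nested form: cups and caps are given together with the identity on an
arbitrary object `Z` to their right, naturally in `Z`. With all tensor products bracketed to the
right, the snake equations and all later calculations are free of associators and unitors. -/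
structure NestedDuals (A D : C) where
  /-- The cup creating `A ⊗ D`. -/
  u : ∀ Z, Z ⟶ A ⊗ D ⊗ Z
  /-- The cup creating `D ⊗ A`. -/
  u' : ∀ Z, Z ⟶ D ⊗ A ⊗ Z
  /-- The cap closing `A ⊗ D`. -/
  n : ∀ Z, A ⊗ D ⊗ Z ⟶ Z
  /-- The cap closing `D ⊗ A`. -/
  n' : ∀ Z, D ⊗ A ⊗ Z ⟶ Z
  u_nat : ∀ {Y Z : C} (h : Y ⟶ Z), h ≫ u Z = u Y ≫ A ◁ D ◁ h
  u'_nat : ∀ {Y Z : C} (h : Y ⟶ Z), h ≫ u' Z = u' Y ≫ D ◁ A ◁ h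
  n_nat : ∀ {Y Z : C} (h : Y ⟶ Z), A ◁ D ◁ h ≫ n Z = n Y ≫ h
  n'_nat : ∀ {Y Z : C} (h : Y ⟶ Z), D ◁ A ◁ h ≫ n' Z = n' Y ≫ h
  snake₁ : ∀ Z, A ◁ u' Z ≫ n (A ⊗ Z) = 𝟙 _
  snake₂ : ∀ Z, u' (D ⊗ Z) ≫ D ◁ n Z = 𝟙 _
  snake₃ : ∀ Z, D ◁ u Z ≫ n' (D ⊗ Z) = 𝟙 _
  snake₄ : ∀ Z, u (A ⊗ Z) ≫ A ◁ n' Z = 𝟙 _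

namespace NestedDuals
variable {A D : C}

/-- Exchanging the roles of the two dual objects. -/
@[simps] def flip (p : NestedDuals A D) : NestedDuals D A where
  u := p.u'
  u' := p.u
  n := p.n'
  n' := p.n
  u_nat := p.u'_nat
  u'_nat := p.u_nat
  n_nat := p.n'_nat
  n'_nat := p.n_nat
  snake₁ := p.snake₃
  snake₂ := p.snake₄
  snake₃ := p.snake₁
  snake₄ := p.snake₂

end NestedDuals

namespace NestedDuals
variable {A D : C} (p : NestedDuals A D)
theorem u_cancel {Z Y : C} {x y : D ⊗ Z ⟶ Y} (h : p.u Z ≫ A ◁ x = p.u Z ≫ A ◁ y) : x = y := by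
  have key : ∀ x : D ⊗ Z ⟶ Y, D ◁ (p.u Z ≫ A ◁ x) ≫ p.n' Y = x := fun x => by
    rw [whiskerLeft_comp, Category.assoc, p.n'_nat, reassoc_of% p.snake₃]
  rw [← key x, h, key]
end NestedDuals

/-- A ternary comultiplication on `A` and the dual one on `D`, in nested form. `rot` and `rot'` say
that the two arise from each other by rotating the four-legged vertex; `mid`, `mid'`, `last` and
`last'` are coassociativity: a comultiplication can be moved from the second or the third output of
another one to the first. The axioms are invariant under exchanging `A` and `D`, so that every
consequence comes with its mirror image. -/
structure NestedVertex (A D : C) extends NestedDuals A D where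
  /-- The comultiplication on `A`. -/
  g : ∀ Z, A ⊗ Z ⟶ A ⊗ D ⊗ A ⊗ Z
  /-- The comultiplication on `D`. -/
  g' : ∀ Z, D ⊗ Z ⟶ D ⊗ A ⊗ D ⊗ Z
  g_nat : ∀ {Y Z : C} (h : Y ⟶ Z), A ◁ h ≫ g Z = g Y ≫ A ◁ D ◁ A ◁ h
  g'_nat : ∀ {Y Z : C} (h : Y ⟶ Z), D ◁ h ≫ g' Z = g' Y ≫ D ◁ A ◁ D ◁ h
  rot : ∀ Z, u Z ≫ A ◁ g' Z = u Z ≫ g (D ⊗ Z)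
  rot' : ∀ Z, u' Z ≫ D ◁ g Z = u' Z ≫ g' (A ⊗ Z)
  mid : ∀ Z, g Z ≫ A ◁ g' (A ⊗ Z) = g Z ≫ g (D ⊗ A ⊗ Z)
  mid' : ∀ Z, g' Z ≫ D ◁ g (D ⊗ Z) = g' Z ≫ g' (A ⊗ D ⊗ Z)
  last : ∀ Z, g Z ≫ A ◁ D ◁ g Z = g Z ≫ g (D ⊗ A ⊗ Z)
  last' : ∀ Z, g' Z ≫ D ◁ A ◁ g' Z = g' Z ≫ g' (A ⊗ D ⊗ Z)

namespace NestedVertex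
variable {A D : C}

/-- Exchanging the roles of the two dual objects. -/
@[simps!] def flip (p : NestedVertex A D) : NestedVertex D A where
  toNestedDuals := p.toNestedDuals.flip
  g := p.g'
  g' := p.g
  g_nat := p.g'_nat
  g'_nat := p.g_nat
  rot := p.rot'
  rot' := p.rot
  mid := p.mid'
  mid' := p.mid
  last := p.last'
  last' := p.last

variable (p : NestedVertex A D)

/-- The loop on `A` with white inner face. The faces of a diagram are two-coloured: the face to the
right of a strand `A` and to the left of a strand `D` is white, the other one is black. Sliding
moves a loop along the legs of a vertex while preserving the colour of its inner face. -/
def wA (Z : C) : A ⊗ Z ⟶ A ⊗ Z := p.g Z ≫ p.n (A ⊗ Z)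

/-- The loop on `A` with black inner face. -/
def bA (Z : C) : A ⊗ Z ⟶ A ⊗ Z := p.g Z ≫ A ◁ p.n' Z

/-- The loop on `D` with white inner face. -/
def wD (Z : C) : D ⊗ Z ⟶ D ⊗ Z := p.g' Z ≫ D ◁ p.n Z

/-- The loop on `D` with black inner face. -/
def bD (Z : C) : D ⊗ Z ⟶ D ⊗ Z := p.g' Z ≫ p.n' (D ⊗ Z)

theorem bA_nat {Y Z : C} (h : Y ⟶ Z) : A ◁ h ≫ p.bA Z = p.bA Y ≫ A ◁ h := by
  simp [bA, reassoc_of% p.g_nat, ← p.n'_nat, ← whiskerLeft_comp]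

theorem wA_g (Z : C) : p.wA Z ≫ p.g Z = p.g Z ≫ p.wA (D ⊗ A ⊗ Z) := by
  simp only [wA, Category.assoc, ← p.n_nat]
  rw [reassoc_of% p.last]

theorem bA_g (Z : C) : p.bA Z ≫ p.g Z = p.g Z ≫ A ◁ D ◁ p.bA Z := by
  simp only [bA, Category.assoc, p.g_nat, whiskerLeft_comp]
  rw [reassoc_of% p.last]

theorem g'_eq (Z : C) :
    p.g' Z = p.u' (D ⊗ Z) ≫ D ◁ p.g (D ⊗ Z) ≫ D ◁ A ◁ D ◁ p.n Z := by
  rw [reassoc_of% p.rot', ← p.g'_nat, reassoc_of% p.snake₂]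

theorem wA_rot (Z : C) : p.u Z ≫ p.wA (D ⊗ Z) = p.u Z ≫ A ◁ p.wD Z := by
  simp only [wA, wD, whiskerLeft_comp, reassoc_of% p.rot]
  rw [← reassoc_of% p.rot, p.g'_eq]
  simp only [whiskerLeft_comp, Category.assoc]
  rw [p.n_nat, reassoc_of% p.n_nat, reassoc_of% p.snake₁]

theorem bA_rot (Z : C) : p.u Z ≫ p.bA (D ⊗ Z) = p.u Z ≫ A ◁ p.bD Z := by
  simp only [bA, bD, whiskerLeft_comp, reassoc_of% p.rot]

/-- A loop with white inner face lies in a black face, and moves across it from the second to the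
third output of the vertex. -/
theorem wD_mid (Z : C) : p.g Z ≫ A ◁ p.wD (A ⊗ Z) = p.g Z ≫ A ◁ D ◁ p.wA Z := by
  simp only [wA, wD, whiskerLeft_comp, reassoc_of% p.mid, reassoc_of% p.last]

/-- A loop with black inner face lies in a white face, and moves across it from the second to the
first output of the vertex. -/
theorem bD_mid (Z : C) : p.g Z ≫ A ◁ p.bD (A ⊗ Z) = p.g Z ≫ p.bA (D ⊗ A ⊗ Z) := by
  simp only [bA, bD, whiskerLeft_comp, reassoc_of% p.mid]

end NestedVertex

/-- Sliding: a loop of either colour moves from the third to the first output of the vertex. -/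
structure NestedSliding {A D : C} (p : NestedVertex A D) : Prop where
  slide_w : ∀ Z, p.g Z ≫ A ◁ D ◁ p.wA Z = p.g Z ≫ p.wA (D ⊗ A ⊗ Z)
  slide_b : ∀ Z, p.g Z ≫ p.bA (D ⊗ A ⊗ Z) = p.g Z ≫ A ◁ D ◁ p.bA Z

namespace NestedSliding
variable {A D : C} {p : NestedVertex A D} (h : NestedSliding p)
include h
theorem flip : NestedSliding p.flip where
  slide_w Z := by
    apply p.u_cancel
    change p.u _ ≫ A ◁ (p.g' Z ≫ D ◁ A ◁ p.bD Z) = p.u _ ≫ A ◁ (p.g' Z ≫ p.bD (A ⊗ D ⊗ Z))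
    simp only [whiskerLeft_comp, reassoc_of% p.rot, p.bD_mid, h.slide_b]
    rw [← p.g_nat, ← reassoc_of% p.bA_rot, p.bA_g]
  slide_b Z := by
    apply p.u_cancel
    change p.u _ ≫ A ◁ (p.g' Z ≫ p.wD (A ⊗ D ⊗ Z)) = p.u _ ≫ A ◁ (p.g' Z ≫ D ◁ A ◁ p.wD Z)
    simp only [whiskerLeft_comp, reassoc_of% p.rot, p.wD_mid, h.slide_w]
    rw [← p.g_nat, ← reassoc_of% p.wA_rot, p.wA_g]
end NestedSliding

/-- A ternary multiplication in nested form, with associativity and symmetry. -/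
structure NestedMul (A D : C) extends NestedDuals A D where
  /-- The multiplication. -/
  m : ∀ Z, A ⊗ D ⊗ A ⊗ Z ⟶ A ⊗ Z
  m_nat : ∀ {Y Z : C} (h : Y ⟶ Z), A ◁ D ◁ A ◁ h ≫ m Z = m Y ≫ A ◁ h
  assoc : ∀ Z, A ◁ D ◁ m Z ≫ m Z = m (D ⊗ A ⊗ Z) ≫ m Z
  symm : ∀ Z, A ◁ u' Z ≫ A ◁ D ◁ u (A ⊗ Z) ≫ m (D ⊗ A ⊗ Z) =
    u (A ⊗ Z) ≫ A ◁ u' (D ⊗ A ⊗ Z) ≫ A ◁ D ◁ m Z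

namespace NestedMul
variable {A D : C} (q : NestedMul A D)

/-- The comultiplication: the second and the third input of the multiplication are bent. -/
def g (Z : C) : A ⊗ Z ⟶ A ⊗ D ⊗ A ⊗ Z := A ◁ q.u' Z ≫ A ◁ D ◁ q.u (A ⊗ Z) ≫ q.m (D ⊗ A ⊗ Z)

theorem g_eq (Z : C) : q.g Z = q.u (A ⊗ Z) ≫ A ◁ q.u' (D ⊗ A ⊗ Z) ≫ A ◁ D ◁ q.m Z := q.symm Z

/-- The comultiplication on the dual object: the input of the comultiplication is bent around the
left side and its last output around the right side. -/
def g' (Z : C) : D ⊗ Z ⟶ D ⊗ A ⊗ D ⊗ Z :=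
  q.u' (D ⊗ Z) ≫ D ◁ q.g (D ⊗ Z) ≫ D ◁ A ◁ D ◁ q.n Z

theorem g_nat {Y Z : C} (h : Y ⟶ Z) : A ◁ h ≫ q.g Z = q.g Y ≫ A ◁ D ◁ A ◁ h := by
  have h₁ : A ◁ h ≫ A ◁ q.u' Z = A ◁ q.u' Y ≫ A ◁ D ◁ A ◁ h := by
    simp only [← whiskerLeft_comp, q.u'_nat]
  have h₂ : A ◁ D ◁ A ◁ h ≫ A ◁ D ◁ q.u (A ⊗ Z) =
      A ◁ D ◁ q.u (A ⊗ Y) ≫ A ◁ D ◁ A ◁ D ◁ A ◁ h := by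
    simp only [← whiskerLeft_comp, q.u_nat]
  simp only [g, Category.assoc, ← q.m_nat, reassoc_of% h₁, reassoc_of% h₂]

theorem g'_nat {Y Z : C} (h : Y ⟶ Z) : D ◁ h ≫ q.g' Z = q.g' Y ≫ D ◁ A ◁ D ◁ h := by
  simp only [g', Category.assoc]
  rw [reassoc_of% q.u'_nat, ← whiskerLeft_comp_assoc, q.g_nat, whiskerLeft_comp_assoc]
  simp only [← whiskerLeft_comp, q.n_nat]

theorem rot' (Z : C) : q.u' Z ≫ D ◁ q.g Z = q.u' Z ≫ q.g' (A ⊗ Z) := by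
  simp only [g']
  rw [reassoc_of% q.u'_nat]
  simp only [← whiskerLeft_comp]
  rw [reassoc_of% q.g_nat]
  simp only [← whiskerLeft_comp, q.snake₁, whiskerLeft_id,
    Category.comp_id]

theorem g_n (Z : C) : q.g (D ⊗ Z) ≫ A ◁ D ◁ q.n Z = A ◁ D ◁ q.u Z ≫ q.m (D ⊗ Z) := by
  have h₁ : A ◁ q.u' (D ⊗ Z) ≫ A ◁ D ◁ q.n Z = 𝟙 _ := by
    rw [← whiskerLeft_comp, q.snake₂, whiskerLeft_id]
  have h₂ : A ◁ D ◁ q.u (A ⊗ D ⊗ Z) ≫ A ◁ D ◁ A ◁ D ◁ q.n Z = A ◁ D ◁ q.n Z ≫ A ◁ D ◁ q.u Z := by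
    simp only [← whiskerLeft_comp, q.u_nat]
  simp only [g, Category.assoc]
  rw [← q.m_nat (D ◁ q.n Z), reassoc_of% h₂, reassoc_of% h₁]

theorem rot (Z : C) : q.u Z ≫ A ◁ q.g' Z = q.u Z ≫ q.g (D ⊗ Z) := by
  rw [g_eq, g', reassoc_of% q.u_nat (q.u Z)]
  simp only [← whiskerLeft_comp, g_n]
  rw [reassoc_of% q.u'_nat (D ◁ q.u Z)]
  simp only [whiskerLeft_comp]

theorem frobenius (Z : C) : A ◁ D ◁ q.g Z ≫ q.m (D ⊗ A ⊗ Z) = q.m Z ≫ q.g Z := by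
  simp only [g, whiskerLeft_comp, Category.assoc, q.assoc]
  rw [reassoc_of% q.m_nat, reassoc_of% q.m_nat]

theorem mid (Z : C) : q.g Z ≫ A ◁ q.g' (A ⊗ Z) = q.g Z ≫ q.g (D ⊗ A ⊗ Z) := by
  conv_lhs => rw [g]
  conv_rhs => rw [g]
  simp only [Category.assoc, ← q.frobenius, ← q.m_nat]
  simp only [← whiskerLeft_comp_assoc, ← whiskerLeft_comp, q.rot]

/-- Bending the input and the last output of `mid` around the two sides gives coassociativity of the
dual comultiplication for its second and third output. -/
theorem mid'_aux (Z : C) : q.g' Z ≫ D ◁ q.g (D ⊗ Z) = q.g' Z ≫ D ◁ A ◁ q.g' Z := by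
  have h : ∀ Z, q.u' Z ≫ q.g' (A ⊗ Z) ≫ D ◁ q.g (D ⊗ A ⊗ Z) =
      q.u' Z ≫ q.g' (A ⊗ Z) ≫ D ◁ A ◁ q.g' (A ⊗ Z) := fun Z => by
    rw [← reassoc_of% q.rot', ← reassoc_of% q.rot', ← whiskerLeft_comp, ← whiskerLeft_comp, q.mid]
  have e₁ : q.g' Z ≫ D ◁ q.g (D ⊗ Z) = q.u' (D ⊗ Z) ≫
      (q.g' (A ⊗ D ⊗ Z) ≫ D ◁ q.g (D ⊗ A ⊗ D ⊗ Z)) ≫ D ◁ A ◁ D ◁ A ◁ D ◁ q.n Z := by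
    rw [Category.assoc, ← whiskerLeft_comp, ← q.g_nat, whiskerLeft_comp, ← reassoc_of% q.g'_nat,
      reassoc_of% q.snake₂]
  have e₂ : q.g' Z ≫ D ◁ A ◁ q.g' Z = q.u' (D ⊗ Z) ≫
      (q.g' (A ⊗ D ⊗ Z) ≫ D ◁ A ◁ q.g' (A ⊗ D ⊗ Z)) ≫ D ◁ A ◁ D ◁ A ◁ D ◁ q.n Z := by
    rw [Category.assoc, ← whiskerLeft_comp, ← whiskerLeft_comp, ← q.g'_nat, whiskerLeft_comp,
      whiskerLeft_comp, ← reassoc_of% q.g'_nat, reassoc_of% q.snake₂]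
  rw [e₁, e₂, Category.assoc, reassoc_of% h]
  simp only [Category.assoc]

/-- Bending the input and the last output of `mid'_aux` around the two sides gives coassociativity
for the first and the third output. -/
theorem last (Z : C) : q.g Z ≫ A ◁ D ◁ q.g Z = q.g Z ≫ q.g (D ⊗ A ⊗ Z) := by
  have h : ∀ Z, q.u Z ≫ q.g (D ⊗ Z) ≫ A ◁ D ◁ q.g (D ⊗ Z) =
      q.u Z ≫ q.g (D ⊗ Z) ≫ q.g (D ⊗ A ⊗ D ⊗ Z) := fun Z => by
    rw [← reassoc_of% q.rot, ← whiskerLeft_comp, q.mid'_aux, whiskerLeft_comp, reassoc_of% q.rot,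
      ← q.g_nat, reassoc_of% q.rot]
  have e₁ : q.g Z ≫ A ◁ D ◁ q.g Z = q.u (A ⊗ Z) ≫
      (q.g (D ⊗ A ⊗ Z) ≫ A ◁ D ◁ q.g (D ⊗ A ⊗ Z)) ≫ A ◁ D ◁ A ◁ D ◁ A ◁ q.n' Z := by
    rw [Category.assoc, ← whiskerLeft_comp, ← whiskerLeft_comp, ← q.g_nat, whiskerLeft_comp,
      whiskerLeft_comp, ← reassoc_of% q.g_nat, reassoc_of% q.snake₄]
  have e₂ : q.g Z ≫ q.g (D ⊗ A ⊗ Z) = q.u (A ⊗ Z) ≫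
      (q.g (D ⊗ A ⊗ Z) ≫ q.g (D ⊗ A ⊗ D ⊗ A ⊗ Z)) ≫ A ◁ D ◁ A ◁ D ◁ A ◁ q.n' Z := by
    rw [Category.assoc, ← q.g_nat, ← reassoc_of% q.g_nat, reassoc_of% q.snake₄]
  rw [e₁, e₂, Category.assoc, reassoc_of% h]
  simp only [Category.assoc]

/-- Bending the input and the last output of `last` around the two sides gives coassociativity of
the dual comultiplication for its first and second output. -/
theorem mid' (Z : C) : q.g' Z ≫ D ◁ q.g (D ⊗ Z) = q.g' Z ≫ q.g' (A ⊗ D ⊗ Z) := by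
  have h : ∀ Z, q.u' Z ≫ q.g' (A ⊗ Z) ≫ D ◁ q.g (D ⊗ A ⊗ Z) =
      q.u' Z ≫ q.g' (A ⊗ Z) ≫ q.g' (A ⊗ D ⊗ A ⊗ Z) := fun Z => by
    conv_rhs => rw [← reassoc_of% q.rot', q.g'_nat, ← reassoc_of% q.rot']
    rw [← reassoc_of% q.rot']
    simp only [← whiskerLeft_comp, q.last]
  have e₁ : q.g' Z ≫ D ◁ q.g (D ⊗ Z) = q.u' (D ⊗ Z) ≫
      (q.g' (A ⊗ D ⊗ Z) ≫ D ◁ q.g (D ⊗ A ⊗ D ⊗ Z)) ≫ D ◁ A ◁ D ◁ A ◁ D ◁ q.n Z := by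
    rw [Category.assoc, ← whiskerLeft_comp, ← q.g_nat, whiskerLeft_comp, ← reassoc_of% q.g'_nat,
      reassoc_of% q.snake₂]
  have e₂ : q.g' Z ≫ q.g' (A ⊗ D ⊗ Z) = q.u' (D ⊗ Z) ≫
      (q.g' (A ⊗ D ⊗ Z) ≫ q.g' (A ⊗ D ⊗ A ⊗ D ⊗ Z)) ≫ D ◁ A ◁ D ◁ A ◁ D ◁ q.n Z := by
    rw [Category.assoc, ← q.g'_nat, ← reassoc_of% q.g'_nat, reassoc_of% q.snake₂]
  rw [e₁, e₂, Category.assoc, reassoc_of% h]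
  simp only [Category.assoc]

/-- The multiplication together with the two cups and caps determines a four-legged vertex. -/
@[simps toNestedDuals g g'] def toNestedVertex : NestedVertex A D where
  toNestedDuals := q.toNestedDuals
  g := q.g
  g' := q.g'
  g_nat := q.g_nat
  g'_nat := q.g'_nat
  rot := q.rot
  rot' := q.rot'
  mid := q.mid
  mid' := q.mid'
  last := q.last
  last' Z := (q.mid'_aux Z).symm.trans (q.mid' Z)

theorem m_eq (Z : C) : q.m Z = q.g (D ⊗ A ⊗ Z) ≫ A ◁ D ◁ q.n (A ⊗ Z) ≫ A ◁ q.n' Z := by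
  rw [reassoc_of% q.g_n, ← q.m_nat, ← whiskerLeft_comp_assoc, ← whiskerLeft_comp, q.snake₄]
  simp

theorem wA_eq (Z : C) : q.toNestedVertex.wA Z = q.u (A ⊗ Z) ≫ q.m Z := by
  simp only [NestedVertex.wA, toNestedVertex_g, toNestedVertex_toNestedDuals, g_eq, Category.assoc,
    q.n_nat]
  rw [reassoc_of% q.snake₁]

theorem bA_eq (Z : C) : q.toNestedVertex.bA Z = A ◁ q.u' Z ≫ q.m Z := by
  have h : A ◁ D ◁ q.u (A ⊗ Z) ≫ A ◁ D ◁ A ◁ q.n' Z = 𝟙 _ := by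
    simp only [← whiskerLeft_comp, q.snake₄, whiskerLeft_id]
  simp only [NestedVertex.bA, toNestedVertex_g, toNestedVertex_toNestedDuals, g, Category.assoc,
    ← q.m_nat, reassoc_of% h]

theorem sliding (h₁ : ∀ Z, (A ◁ q.u' _ ≫ q.m _) ≫ q.m Z = q.m Z ≫ A ◁ q.u' Z ≫ q.m Z)
    (h₂ : ∀ Z, A ◁ D ◁ (q.u (A ⊗ Z) ≫ q.m Z) ≫ q.m Z = q.m Z ≫ q.u (A ⊗ Z) ≫ q.m Z) :
    NestedSliding q.toNestedVertex := by
  have h₁' : ∀ Z, q.toNestedVertex.bA _ ≫ q.m Z = q.m Z ≫ q.toNestedVertex.bA Z := by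
    simpa only [bA_eq] using h₁
  have h₂' : ∀ Z, A ◁ D ◁ q.toNestedVertex.wA Z ≫ q.m Z = q.m Z ≫ q.toNestedVertex.wA Z := by
    simpa only [wA_eq] using h₂
  constructor
  · intro Z
    have h₃ := q.toNestedVertex.wA_g Z
    rw [toNestedVertex_g] at h₃
    rw [toNestedVertex_g, ← h₃, g_eq, reassoc_of% q.u_nat (q.toNestedVertex.wA Z)]
    simp only [← whiskerLeft_comp, Category.assoc, ← h₂']
    rw [reassoc_of% q.u'_nat (D ◁ q.toNestedVertex.wA Z)]
    simp only [whiskerLeft_comp]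
  · intro Z
    have h₃ := q.toNestedVertex.bA_g Z
    rw [toNestedVertex_g] at h₃
    rw [toNestedVertex_g, ← h₃, g, Category.assoc, Category.assoc, ← h₁',
      reassoc_of% q.toNestedVertex.bA_nat, reassoc_of% q.toNestedVertex.bA_nat]

end NestedMul

end NestedCalculus

/-! ### The nested form of a Frobenius 3-structure -/

section
variable {C : Type u} [Category.{v} C] [MonoidalCategory C]

namespace DualObjects
variable (P : DualObjects C)

/-- The nested form of two-sided duals: cups and caps tensored with `Z` on the right. -/
@[simps] def nested : NestedDuals P.A P.Ad where
  u Z := (λ_ Z).inv ≫ P.cupSwap ▷ Z ≫ (α_ _ _ _).hom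
  u' Z := (λ_ Z).inv ≫ P.cup ▷ Z ≫ (α_ _ _ _).hom
  n Z := (α_ _ _ _).inv ≫ P.cap ▷ Z ≫ (λ_ Z).hom
  n' Z := (α_ _ _ _).inv ≫ P.capSwap ▷ Z ≫ (λ_ Z).hom
  u_nat h := by
    simp only [leftUnitor_inv_naturality_assoc, whisker_exchange_assoc, Category.assoc,
      associator_naturality_right]
  u'_nat h := by
    simp only [leftUnitor_inv_naturality_assoc, whisker_exchange_assoc, Category.assoc,
      associator_naturality_right]
  n_nat h := by
    simp only [associator_inv_naturality_right_assoc, whisker_exchange_assoc, Category.assoc,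
      leftUnitor_naturality]
  n'_nat h := by
    simp only [associator_inv_naturality_right_assoc, whisker_exchange_assoc, Category.assoc,
      leftUnitor_naturality]
  snake₁ Z := by
    calc _ = ((ρ_ P.A).inv ≫ (P.A ◁ P.cup ≫ (α_ _ _ _).inv ≫ P.cap ▷ P.A) ≫ (λ_ P.A).hom) ▷ Z := by
          monoidal
      _ = _ := by
          have := P.leftDual.coevaluation_evaluation'
          rw [cup, cap, this]; simp
  snake₂ Z := by
    calc _ = ((λ_ P.Ad).inv ≫ (P.cup ▷ P.Ad ≫ (α_ _ _ _).hom ≫ P.Ad ◁ P.cap) ≫ (ρ_ P.Ad).hom) ▷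
          Z := by
          monoidal
      _ = _ := by
          have := P.leftDual.evaluation_coevaluation'
          rw [cup, cap, this]; simp
  snake₃ Z := by
    calc _ = ((ρ_ P.Ad).inv ≫ (P.Ad ◁ P.cupSwap ≫ (α_ _ _ _).inv ≫ P.capSwap ▷ P.Ad) ≫
        (λ_ P.Ad).hom) ▷ Z := by
          monoidal
      _ = _ := by
          have := P.rightDual.coevaluation_evaluation'
          rw [cupSwap, capSwap, this]; simp
  snake₄ Z := by
    calc _ = ((λ_ P.A).inv ≫ (P.cupSwap ▷ P.A ≫ (α_ _ _ _).hom ≫ P.A ◁ P.capSwap) ≫ (ρ_ P.A).hom) ▷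
          Z := by
          monoidal
      _ = _ := by
          have := P.rightDual.evaluation_coevaluation'
          rw [cupSwap, capSwap, this]; simp
end DualObjects

namespace FrobeniusThreeStructure
variable (S : FrobeniusThreeStructure C)

/-- The multiplication tensored with `Z` on the right. -/
def mulAct (Z : C) : S.A ⊗ S.Ad ⊗ S.A ⊗ Z ⟶ S.A ⊗ Z :=
  S.A ◁ (α_ S.Ad S.A Z).inv ≫ (α_ S.A (S.Ad ⊗ S.A) Z).inv ≫ S.mul ▷ Z

/-- The comultiplication tensored with `Z` on the right. -/
def comulAct (Z : C) : S.A ⊗ Z ⟶ S.A ⊗ S.Ad ⊗ S.A ⊗ Z :=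
  S.comul ▷ Z ≫ (α_ S.A (S.Ad ⊗ S.A) Z).hom ≫ S.A ◁ (α_ S.Ad S.A Z).hom

/-- The nested form of a Frobenius 3-structure. -/
@[simps toNestedDuals m] def nestedMul : NestedMul S.A S.Ad where
  toNestedDuals := S.nested
  m := S.mulAct
  m_nat h := by
    simp only [mulAct, Category.assoc, ← whisker_exchange, ← whiskerLeft_comp_assoc]
    simp only [whiskerLeft_comp_assoc, ← associator_inv_naturality_right_assoc,
      associator_inv_naturality_right]
  assoc Z := by
    have h := congrArg (fun f => (𝟙 _ ⊗≫ f ▷ Z : S.A ⊗ S.Ad ⊗ S.A ⊗ S.Ad ⊗ S.A ⊗ Z ⟶ S.A ⊗ Z))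
      S.associativity
    calc _ = _ := ?_
      _ = _ := h
      _ = _ := ?_
    · simp only [mulAct]; monoidal
    · simp only [mulAct]; monoidal
  symm Z := by
    have h := congrArg (fun f => (f ▷ Z ⊗≫ 𝟙 _ : S.A ⊗ Z ⟶ S.A ⊗ S.Ad ⊗ S.A ⊗ Z))
      S.symmetry
    calc _ = _ := ?_
      _ = _ := h
      _ = _ := ?_
    · simp only [mulAct, DualObjects.bendMulRight, DualObjects.nested]; monoidal
    · simp only [mulAct, DualObjects.bendMulLeft, DualObjects.nested]; monoidal

theorem nestedMul_g (Z : C) : S.nestedMul.g Z = S.comulAct Z := by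
  simp only [NestedMul.g, nestedMul_toNestedDuals, nestedMul_m, mulAct, DualObjects.nested,
    comulAct, comul, DualObjects.bendMulRight]
  monoidal

theorem nestedMul_left (Z : C) : S.nestedMul.u (S.A ⊗ Z) ≫ S.nestedMul.m Z = S.leftLoop ▷ Z := by
  simp only [nestedMul_toNestedDuals, nestedMul_m, mulAct, DualObjects.nested, leftLoop]
  monoidal

theorem nestedMul_right (Z : C) : S.A ◁ S.nestedMul.u' Z ≫ S.nestedMul.m Z = S.rightLoop ▷ Z := by
  simp only [nestedMul_toNestedDuals, nestedMul_m, mulAct, DualObjects.nested, rightLoop]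
  monoidal

theorem nestedMul_sliding (hS : S.Sliding) : NestedSliding S.nestedMul.toNestedVertex := by
  apply NestedMul.sliding
  · intro Z
    rw [nestedMul_right, nestedMul_right, nestedMul_m]
    have h := congrArg (fun f => (𝟙 _ ⊗≫ f ▷ Z : S.A ⊗ S.Ad ⊗ S.A ⊗ Z ⟶ S.A ⊗ Z)) hS.1
    calc _ = _ := ?_
      _ = _ := h
      _ = _ := ?_
    · simp only [mulAct]; monoidal
    · simp only [mulAct]; monoidal
  · intro Z
    rw [nestedMul_left, nestedMul_m]
    have h := congrArg (fun f => (𝟙 _ ⊗≫ f ▷ Z : S.A ⊗ S.Ad ⊗ S.A ⊗ Z ⟶ S.A ⊗ Z)) hS.2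
    calc _ = _ := ?_
      _ = _ := h
      _ = _ := ?_
    · simp only [mulAct]; monoidal
    · simp only [mulAct]; monoidal

end FrobeniusThreeStructure
end

/-! ### Partial operations on words -/

section
variable {C : Type u} [Category.{v} C] [MonoidalCategory C]

namespace DualObjects
variable (P : DualObjects C)

/-- Partial operations on words: an operation sends a word of wires to another word together with a
morphism between their tensor products, or is undefined on it. An operation acts at the front of
arbitrarily long words, so that one symbol, such as `gr` below, stands for a piece of a diagram with
any number of wires to its right. -/
def Tr : Type v := ∀ w : List Strand, Option (Σ w' : List Strand, P.word w ⟶ P.word w')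

namespace Tr
variable {P}

@[ext] theorem ext {T K : P.Tr} (h : ∀ w, T w = K w) : T = K := funext h

/-- Composition of operations, in diagrammatic order. -/
instance : Monoid P.Tr where
  mul T K := fun w => (T w).bind fun L => (K L.1).map fun M => ⟨M.1, L.2 ≫ M.2⟩
  one := fun w => some ⟨w, 𝟙 _⟩
  mul_assoc T K J := by
    ext1 w
    change Option.bind (Option.bind _ _) _ = Option.bind _ _
    cases hT : T w with
    | none => rfl
    | some L =>
      change Option.bind (Option.map _ _) _ = Option.map _ (Option.bind _ _)
      cases hK : K L.1 with
      | none => rfl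
      | some M =>
        change Option.map _ _ = Option.map _ (Option.map _ _)
        simp only [Option.map_map]
        congr 1
        funext N
        simp [Category.assoc]
  one_mul T := by
    ext1 w
    change Option.map _ _ = _
    simp
  mul_one T := by
    ext1 w
    change Option.bind _ _ = _
    cases hT : T w with
    | none => rfl
    | some L =>
      change some _ = some _
      simp

theorem mul_apply (T K : P.Tr) (w : List Strand) :
    (T * K) w = (T w).bind fun L => (K L.1).map fun M => ⟨M.1, L.2 ≫ M.2⟩ := rfl

theorem one_apply (w : List Strand) : (1 : P.Tr) w = some ⟨w, 𝟙 _⟩ := rfl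

theorem mul_apply_of_some {T : P.Tr} (K : P.Tr) {w w' : List Strand} {f : P.word w ⟶ P.word w'}
    (h : T w = some ⟨w', f⟩) : (T * K) w = (K w').map fun M => ⟨M.1, f ≫ M.2⟩ := by
  rw [mul_apply, h]; rfl

theorem mul_apply_of_some_some {T K : P.Tr} {w w' w'' : List Strand} {f : P.word w ⟶ P.word w'}
    {f' : P.word w' ⟶ P.word w''}
    (h : T w = some ⟨w', f⟩) (h' : K w' = some ⟨w'', f'⟩) : (T * K) w = some ⟨w'', f ≫ f'⟩ := by
  rw [mul_apply_of_some K h, h']; rfl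

theorem mul_apply_of_none {T : P.Tr} (K : P.Tr) {w : List Strand}
    (h : T w = none) : (T * K) w = none := by
  rw [mul_apply, h]; rfl

theorem mul_apply_of_some_none {T K : P.Tr} {w w' : List Strand} {f : P.word w ⟶ P.word w'}
    (h : T w = some ⟨w', f⟩) (h' : K w' = none) : (T * K) w = none := by
  rw [mul_apply_of_some K h, h']; rfl

/-- `T ≤ K` when `K` extends `T`. -/
instance : PartialOrder P.Tr where
  le T K := ∀ w L, T w = some L → K w = some L
  le_refl T w L h := h
  le_trans T K J h h' w L hL := h' w L (h w L hL)
  le_antisymm T K h h' := by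
    ext1 w
    ext1 L
    exact ⟨h w L, h' w L⟩

theorem mul_le_mul {T T' K K' : P.Tr} (h : T ≤ T') (h' : K ≤ K') : T * K ≤ T' * K' := by
  intro w L hL
  rw [mul_apply] at hL ⊢
  cases hT : T w with
  | none => simp [hT] at hL
  | some M =>
    rw [h w M hT]
    rw [hT] at hL
    simp only [Option.bind_some, Option.map_eq_some_iff] at hL ⊢
    obtain ⟨N, hN, rfl⟩ := hL
    exact ⟨N, h' _ _ hN, rfl⟩

end Tr

/-- The shift of an operation leaves the first wire alone and acts on the remaining wires; it fixes
the empty word, which makes it a monoid homomorphism. -/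
def sh : P.Tr →* P.Tr where
  toFun T := fun
    | [] => some ⟨[], 𝟙 _⟩
    | s :: w => (T w).map fun L => ⟨s :: L.1, P.ob s ◁ L.2⟩
  map_one' := by
    ext1 w
    cases w with
    | nil => rfl
    | cons s w =>
      change some _ = some _
      simp; rfl
  map_mul' T K := by
    ext1 w
    cases w with
    | nil =>
      change some _ = some _
      simp
    | cons s w =>
      change Option.map _ (Option.bind _ _) = Option.bind (Option.map _ _) _
      cases hT : T w with
      | none => rfl
      | some L =>
        change Option.map _ (Option.map _ _) = Option.map _ (Option.map _ _)
        cases hK : K L.1 with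
        | none => rfl
        | some M =>
          exact congrArg (fun f => some (Sigma.mk (s :: M.1) f))
            (MonoidalCategory.whiskerLeft_comp _ _ _)

variable {P}

theorem sh_cons (T : P.Tr) (s : Strand) (w : List Strand) :
    P.sh T (s :: w) = (T w).map fun L => ⟨s :: L.1, P.ob s ◁ L.2⟩ := rfl

theorem sh_cons_some {T : P.Tr} (s : Strand) {w w' : List Strand} {f : P.word w ⟶ P.word w'}
    (h : T w = some ⟨w', f⟩) : P.sh T (s :: w) = some ⟨s :: w', P.ob s ◁ f⟩ := by
  rw [sh_cons, h]; rfl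

theorem sh_cons_none {T : P.Tr} (s : Strand) {w : List Strand}
    (h : T w = none) : P.sh T (s :: w) = none := by
  rw [sh_cons, h]; rfl

theorem sh_mono {T K : P.Tr} (h : T ≤ K) : P.sh T ≤ P.sh K := by
  intro w L hL
  cases w with
  | nil => exact hL
  | cons s w =>
    rw [sh_cons] at hL ⊢
    simp only [Option.map_eq_some_iff] at hL ⊢
    obtain ⟨N, hN, rfl⟩ := hL
    exact ⟨N, h _ _ hN, rfl⟩

theorem some_congr {w w' : List Strand} {f f' : P.word w ⟶ P.word w'} (h : f = f') :
    (some ⟨w', f⟩ : Option (Σ w' : List Strand, P.word w ⟶ P.word w')) = some ⟨w', f'⟩ := by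
  rw [h]

variable (P)
/-- The `n`-fold shift: an operation acts behind the first `n` wires. -/
def sft : ℕ → (P.Tr →* P.Tr)
  | 0 => MonoidHom.id _
  | n + 1 => P.sh.comp (sft n)
variable {P}

@[simp] theorem sft_zero (T : P.Tr) : P.sft 0 T = T := rfl
theorem sft_succ (n : ℕ) (T : P.Tr) : P.sft (n + 1) T = P.sh (P.sft n T) := rfl
theorem sft_add (m n : ℕ) (T : P.Tr) : P.sft (m + n) T = P.sft m (P.sft n T) := by
  induction m with
  | zero => simp
  | succ m ih => rw [Nat.succ_add, sft_succ, ih, sft_succ]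
theorem sft_succ' (n : ℕ) (T : P.Tr) : P.sft (n + 1) T = P.sft n (P.sh T) := sft_add n 1 T

theorem sft_mono (n : ℕ) {T K : P.Tr} (h : T ≤ K) : P.sft n T ≤ P.sft n K := by
  induction n with
  | zero => exact h
  | succ n ih => exact sh_mono ih

end DualObjects

namespace NestedVertex
variable {P : DualObjects C} (V : NestedVertex P.A P.Ad)

/-- A cup with left end `s` is created at the front of a word. -/
def cu : Strand → P.Tr
  | .up => fun w => some ⟨.up :: .down :: w, V.u (P.word w)⟩
  | .down => fun w => some ⟨.down :: .up :: w, V.u' (P.word w)⟩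

/-- The first two wires, provided that they are of opposite kinds, are closed by a cap. -/
def ca : P.Tr
  | .up :: .down :: w => some ⟨w, V.n (P.word w)⟩
  | .down :: .up :: w => some ⟨w, V.n' (P.word w)⟩
  | _ => none

/-- A comultiplication is applied to the first wire, so that a word grows by two wires. -/
def gr : P.Tr
  | .up :: w => some ⟨.up :: .down :: .up :: w, V.g (P.word w)⟩
  | .down :: w => some ⟨.down :: .up :: .down :: w, V.g' (P.word w)⟩
  | [] => none

/-- The left loop on the first wire: a comultiplication with its first two outputs connected. -/
def lf : P.Tr
  | .up :: w => some ⟨.up :: w, V.wA (P.word w)⟩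
  | .down :: w => some ⟨.down :: w, V.bD (P.word w)⟩
  | [] => none

/-- The right loop on the first wire: a comultiplication with its last two outputs connected. -/
def rt : P.Tr
  | .up :: w => some ⟨.up :: w, V.bA (P.word w)⟩
  | .down :: w => some ⟨.down :: w, V.wD (P.word w)⟩
  | [] => none

open DualObjects DualObjects.Tr

theorem mul_cu (T : P.Tr) (s : Strand) : T * V.cu s = V.cu s * P.sh (P.sh T) := by
  ext1 w
  cases h : T w with
  | none =>
    rw [mul_apply_of_none _ h]
    cases s <;>
    exact (mul_apply_of_some_none rfl (sh_cons_none _ (sh_cons_none _ h))).symm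
  | some L =>
    cases s
    · rw [mul_apply_of_some_some h rfl]
      refine Eq.trans ?_ (mul_apply_of_some_some rfl (sh_cons_some _ (sh_cons_some _ h))).symm
      exact some_congr (V.u_nat _)
    · rw [mul_apply_of_some_some h rfl]
      refine Eq.trans ?_ (mul_apply_of_some_some rfl (sh_cons_some _ (sh_cons_some _ h))).symm
      exact some_congr (V.u'_nat _)

theorem mul_ca (T : P.Tr) : P.sh (P.sh T) * V.ca = V.ca * T := by
  ext1 w
  match w with
  | [] => rfl
  | [s] => cases s <;> rfl
  | .up :: .up :: w =>
    rw [mul_apply_of_none (T := V.ca) _ rfl]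
    cases h : T w with
    | none => exact mul_apply_of_none _ (sh_cons_none _ (sh_cons_none _ h))
    | some L => exact mul_apply_of_some_none (sh_cons_some _ (sh_cons_some _ h)) rfl
  | .down :: .down :: w =>
    rw [mul_apply_of_none (T := V.ca) _ rfl]
    cases h : T w with
    | none => exact mul_apply_of_none _ (sh_cons_none _ (sh_cons_none _ h))
    | some L => exact mul_apply_of_some_none (sh_cons_some _ (sh_cons_some _ h)) rfl
  | .up :: .down :: w =>
    cases h : T w with
    | none =>
      rw [mul_apply_of_none _ (sh_cons_none _ (sh_cons_none _ h))]
      exact (mul_apply_of_some_none rfl h).symm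
    | some L =>
      refine (mul_apply_of_some_some (sh_cons_some _ (sh_cons_some _ h)) rfl).trans ?_
      refine Eq.trans ?_ (mul_apply_of_some_some rfl h).symm
      exact some_congr (V.n_nat _)
  | .down :: .up :: w =>
    cases h : T w with
    | none =>
      rw [mul_apply_of_none _ (sh_cons_none _ (sh_cons_none _ h))]
      exact (mul_apply_of_some_none rfl h).symm
    | some L =>
      refine (mul_apply_of_some_some (sh_cons_some _ (sh_cons_some _ h)) rfl).trans ?_
      refine Eq.trans ?_ (mul_apply_of_some_some rfl h).symm
      exact some_congr (V.n'_nat _)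

theorem mul_gr (T : P.Tr) : P.sh T * V.gr = V.gr * P.sh (P.sh (P.sh T)) := by
  ext1 w
  match w with
  | [] => rfl
  | s :: w =>
    cases h : T w with
    | none =>
      rw [mul_apply_of_none _ (sh_cons_none _ h)]
      cases s <;>
      exact (mul_apply_of_some_none rfl (sh_cons_none _ (sh_cons_none _ (sh_cons_none _ h)))).symm
    | some L =>
      cases s
      · refine (mul_apply_of_some_some (sh_cons_some _ h) rfl).trans ?_
        refine Eq.trans ?_ (mul_apply_of_some_some rfl
            (sh_cons_some _ (sh_cons_some _ (sh_cons_some _ h)))).symm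
        exact some_congr (V.g_nat _)
      · refine (mul_apply_of_some_some (sh_cons_some _ h) rfl).trans ?_
        refine Eq.trans ?_ (mul_apply_of_some_some rfl
            (sh_cons_some _ (sh_cons_some _ (sh_cons_some _ h)))).symm
        exact some_congr (V.g'_nat _)

theorem gr_mul_ca : V.gr * V.ca = V.lf := by
  ext1 w
  match w with
  | [] => rfl
  | .up :: w => rfl
  | .down :: w => rfl

theorem gr_mul_sh_ca : V.gr * P.sh V.ca = V.rt := by
  ext1 w
  match w with
  | [] => rfl
  | .up :: w => rfl
  | .down :: w => rfl

theorem mul_lf (T : P.Tr) : P.sh T * V.lf = V.lf * P.sh T := by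
  rw [← gr_mul_ca, ← mul_assoc, mul_gr, mul_assoc, mul_ca, mul_assoc]

theorem mul_rt (T : P.Tr) : P.sh T * V.rt = V.rt * P.sh T := by
  rw [← gr_mul_sh_ca, ← mul_assoc, mul_gr, mul_assoc, ← map_mul, mul_ca, mul_assoc, map_mul]

theorem snake_left (s : Strand) : P.sh (V.cu s) * V.ca ≤ 1 := by
  intro w L hL
  match s, w with
  | .up, [] => cases hL
  | .down, [] => cases hL
  | .up, .up :: w => cases hL
  | .down, .down :: w => cases hL
  | .up, .down :: w =>
    rw [← hL, one_apply]
    refine Eq.trans ?_ (mul_apply_of_some_some rfl rfl).symm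
    exact some_congr (V.snake₃ _).symm
  | .down, .up :: w =>
    rw [← hL, one_apply]
    refine Eq.trans ?_ (mul_apply_of_some_some rfl rfl).symm
    exact some_congr (V.snake₁ _).symm

theorem snake_right (s : Strand) : V.cu s * P.sh V.ca ≤ 1 := by
  intro w L hL
  match s, w with
  | .up, [] => cases hL
  | .down, [] => cases hL
  | .up, .down :: w => cases hL
  | .down, .up :: w => cases hL
  | .up, .up :: w =>
    rw [← hL, one_apply]
    refine Eq.trans ?_ (mul_apply_of_some_some rfl rfl).symm
    exact some_congr (V.snake₄ _).symm
  | .down, .down :: w =>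
    rw [← hL, one_apply]
    refine Eq.trans ?_ (mul_apply_of_some_some rfl rfl).symm
    exact some_congr (V.snake₂ _).symm

theorem cu_gr (s : Strand) : V.cu s * P.sh V.gr = V.cu s * V.gr := by
  ext1 w
  cases s
  · refine (mul_apply_of_some_some rfl rfl).trans
        (Eq.trans ?_ (mul_apply_of_some_some rfl rfl).symm)
    exact some_congr (V.rot _)
  · refine (mul_apply_of_some_some rfl rfl).trans
        (Eq.trans ?_ (mul_apply_of_some_some rfl rfl).symm)
    exact some_congr (V.rot' _)

theorem gr_mid : V.gr * P.sh V.gr = V.gr * V.gr := by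
  ext1 w
  match w with
  | [] => rfl
  | .up :: w =>
    refine (mul_apply_of_some_some rfl rfl).trans
        (Eq.trans ?_ (mul_apply_of_some_some rfl rfl).symm)
    exact some_congr (V.mid _)
  | .down :: w =>
    refine (mul_apply_of_some_some rfl rfl).trans
        (Eq.trans ?_ (mul_apply_of_some_some rfl rfl).symm)
    exact some_congr (V.mid' _)

theorem gr_last : V.gr * P.sh (P.sh V.gr) = V.gr * V.gr := by
  ext1 w
  match w with
  | [] => rfl
  | .up :: w =>
    refine (mul_apply_of_some_some rfl rfl).trans
        (Eq.trans ?_ (mul_apply_of_some_some rfl rfl).symm)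
    exact some_congr (V.last _)
  | .down :: w =>
    refine (mul_apply_of_some_some rfl rfl).trans
        (Eq.trans ?_ (mul_apply_of_some_some rfl rfl).symm)
    exact some_congr (V.last' _)

end NestedVertex
end

/-! ### Spiders -/

section
variable {C : Type u} [Category.{v} C] [MonoidalCategory C]

namespace NestedVertex
variable {P : DualObjects C} (V : NestedVertex P.A P.Ad)
open DualObjects DualObjects.Tr

theorem lf_mul_gr : V.lf * V.gr = V.gr * V.lf := by
  rw [← gr_mul_ca, mul_assoc, ← mul_ca, ← mul_assoc, gr_last, mul_assoc]

theorem rt_mul_gr' : V.rt * V.gr = V.gr * P.sh (P.sh V.rt) := by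
  rw [← gr_mul_sh_ca, mul_assoc, mul_gr, ← mul_assoc, ← gr_last, map_mul, map_mul, mul_assoc]

theorem gr_sh_lf : V.gr * P.sh V.lf = V.gr * V.rt := by
  rw [← gr_mul_ca, map_mul, ← mul_assoc, gr_mid, mul_assoc, gr_mul_sh_ca]

theorem gr_sh_rt' : V.gr * P.sh V.rt = V.gr * P.sh (P.sh V.lf) := by
  rw [← gr_mul_ca, ← gr_mul_sh_ca, map_mul, map_mul, map_mul, ← mul_assoc, gr_mid, ← mul_assoc,
    gr_last]

theorem cu_lf (s : Strand) : V.cu s * V.lf = V.cu s * P.sh V.rt := by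
  ext1 w
  cases s
  · exact (mul_apply_of_some_some rfl rfl).trans
      ((some_congr (V.wA_rot _)).trans (mul_apply_of_some_some rfl rfl).symm)
  · exact (mul_apply_of_some_some rfl rfl).trans
      ((some_congr (V.flip.wA_rot _)).trans (mul_apply_of_some_some rfl rfl).symm)

theorem cu_rt (s : Strand) : V.cu s * V.rt = V.cu s * P.sh V.lf := by
  ext1 w
  cases s
  · exact (mul_apply_of_some_some rfl rfl).trans
      ((some_congr (V.bA_rot _)).trans (mul_apply_of_some_some rfl rfl).symm)
  · exact (mul_apply_of_some_some rfl rfl).trans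
      ((some_congr (V.flip.bA_rot _)).trans (mul_apply_of_some_some rfl rfl).symm)

theorem lf_mul_rt : V.lf * V.rt = V.rt * V.lf := by
  conv_lhs => rw [← gr_mul_sh_ca, ← mul_assoc, lf_mul_gr, mul_assoc, ← mul_lf, ← mul_assoc,
    gr_mul_sh_ca]

theorem commute_lf_rt : Commute V.lf V.rt := V.lf_mul_rt
theorem commute_lf_gr : Commute V.lf V.gr := V.lf_mul_gr

theorem gr_pow_mul_sft (k : ℕ) (T : P.Tr) :
    V.gr ^ k * P.sft (2 * k + 1) T = P.sh T * V.gr ^ k := by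
  induction k with
  | zero => simp [sft_succ]
  | succ k ih =>
    have : P.sft (2 * (k + 1) + 1) T = P.sh (P.sh (P.sh (P.sft (2 * k) T))) := by
      rw [← sft_succ, ← sft_succ, ← sft_succ]; rfl
    rw [pow_succ, mul_assoc, this, ← mul_gr, ← sft_succ, ← mul_assoc, ih, mul_assoc]

theorem gr_pow_mul_sft_gr (k i : ℕ) (hi : i < 2 * k + 1) :
    V.gr ^ k * P.sft i V.gr = V.gr ^ (k + 1) := by
  induction k generalizing i with
  | zero => obtain rfl : i = 0 := by omega
            simp
  | succ k ih =>
    rw [pow_succ V.gr k]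
    match i, hi with
    | 0, _ => rw [sft_zero, pow_succ, pow_succ]
    | 1, _ => rw [sft_succ, sft_zero, mul_assoc, gr_mid, pow_succ, pow_succ, mul_assoc]
    | 2, _ => rw [sft_succ, sft_succ, sft_zero, mul_assoc, gr_last, pow_succ, pow_succ, mul_assoc]
    | j + 3, hj =>
      rw [sft_succ, sft_succ, sft_succ, mul_assoc, ← mul_gr, ← sft_succ, ← mul_assoc,
        ih (j + 1) (by omega), ← pow_succ]

theorem cu_mul_lf_pow (s : Strand) (m : ℕ) : V.cu s * V.lf ^ m = V.cu s * P.sh (V.rt ^ m) := by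
  induction m with
  | zero => simp
  | succ m ih =>
    rw [pow_succ, ← mul_assoc, ih, mul_assoc, mul_lf, ← mul_assoc, cu_lf, mul_assoc, ← map_mul,
      pow_succ']

theorem cu_mul_rt_pow (s : Strand) (m : ℕ) : V.cu s * V.rt ^ m = V.cu s * P.sh (V.lf ^ m) := by
  induction m with
  | zero => simp
  | succ m ih =>
    rw [pow_succ, ← mul_assoc, ih, mul_assoc, mul_rt, ← mul_assoc, cu_rt, mul_assoc, ← map_mul,
      pow_succ']

theorem sh_mul_lf_pow (T : P.Tr) (m : ℕ) : P.sh T * V.lf ^ m = V.lf ^ m * P.sh T :=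
  (show Commute (P.sh T) V.lf from V.mul_lf T).pow_right m

theorem sh_mul_rt_pow (T : P.Tr) (m : ℕ) : P.sh T * V.rt ^ m = V.rt ^ m * P.sh T :=
  (show Commute (P.sh T) V.rt from V.mul_rt T).pow_right m

/-- A spider with the first wire of a word as one of its legs: `m` left and `n` right loops followed
by `k` comultiplications. -/
def stalk (k m n : ℕ) : P.Tr := V.lf ^ m * V.rt ^ n * V.gr ^ k

/-- The spider with `2 k + 2` legs and with `m` left and `n` right loops: a cup with left end `s`
whose left end carries a stalk. With all inputs bent, every normal form is a
spider. -/
def spider (s : Strand) (k m n : ℕ) : P.Tr := V.cu s * V.stalk k m n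

theorem stalk_mul_sft (k m n : ℕ) (T : P.Tr) :
    V.stalk k m n * P.sft (2 * k + 1) T = P.sh T * V.stalk k m n := by
  rw [stalk, mul_assoc, gr_pow_mul_sft, ← mul_assoc, mul_assoc _ _ (P.sh T), ← sh_mul_rt_pow,
    ← mul_assoc, ← sh_mul_lf_pow]
  simp only [mul_assoc]

theorem stalk_mul_sft_gr (k m n i : ℕ) (hi : i < 2 * k + 1) :
    V.stalk k m n * P.sft i V.gr = V.stalk (k + 1) m n := by
  rw [stalk, mul_assoc, gr_pow_mul_sft_gr V k i hi, stalk]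

section Sliding
variable {V} (hV : NestedSliding V)
include hV

theorem gr_sh_sh_lf : V.gr * P.sh (P.sh V.lf) = V.gr * V.lf := by
  ext1 w
  match w with
  | [] => rfl
  | .up :: w =>
    exact (mul_apply_of_some_some rfl rfl).trans
      ((some_congr (hV.slide_w _)).trans (mul_apply_of_some_some rfl rfl).symm)
  | .down :: w =>
    exact (mul_apply_of_some_some rfl rfl).trans
      ((some_congr (hV.flip.slide_w _)).trans (mul_apply_of_some_some rfl rfl).symm)

theorem gr_sh_sh_rt : V.gr * P.sh (P.sh V.rt) = V.gr * V.rt := by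
  ext1 w
  match w with
  | [] => rfl
  | .up :: w =>
    exact (mul_apply_of_some_some rfl rfl).trans
      ((some_congr (hV.slide_b _).symm).trans (mul_apply_of_some_some rfl rfl).symm)
  | .down :: w =>
    exact (mul_apply_of_some_some rfl rfl).trans
      ((some_congr (hV.flip.slide_b _).symm).trans (mul_apply_of_some_some rfl rfl).symm)

theorem commute_rt_gr : Commute V.rt V.gr :=
  V.rt_mul_gr'.trans (gr_sh_sh_rt hV)

theorem gr_sh_rt : V.gr * P.sh V.rt = V.gr * V.lf :=
  V.gr_sh_rt'.trans (gr_sh_sh_lf hV)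

/-- A loop on any output of a chain of comultiplications. -/
theorem gr_pow_mul_sft_loops (k i : ℕ) (hi : i < 2 * k + 1) :
    (V.gr ^ k * P.sft i V.lf = V.lf * V.gr ^ k ∧ V.gr ^ k * P.sft i V.rt = V.rt * V.gr ^ k) ∨
    (V.gr ^ k * P.sft i V.lf = V.rt * V.gr ^ k ∧ V.gr ^ k * P.sft i V.rt = V.lf * V.gr ^ k) := by
  induction k generalizing i with
  | zero => obtain rfl : i = 0 := by omega
            simp
  | succ k ih =>
    have hl := V.commute_lf_gr
    have hr := commute_rt_gr hV
    have hl' := (hl.pow_right (k + 1)).eq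
    have hr' := (hr.pow_right (k + 1)).eq
    rw [pow_succ] at hl' hr'
    rw [pow_succ V.gr k]
    match i, hi with
    | 0, _ =>
      left
      rw [sft_zero, sft_zero, hl', hr']; exact ⟨rfl, rfl⟩
    | 1, _ =>
      right
      rw [sft_succ, sft_zero, mul_assoc, gr_sh_lf, sft_succ, sft_zero, mul_assoc, gr_sh_rt hV,
        hl', hr', mul_assoc, mul_assoc]; exact ⟨rfl, rfl⟩
    | 2, _ =>
      left
      rw [sft_succ, sft_succ, sft_zero, mul_assoc, gr_sh_sh_lf hV, sft_succ, sft_succ, sft_zero,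
        mul_assoc, gr_sh_sh_rt hV, hl', hr', mul_assoc, mul_assoc]; exact ⟨rfl, rfl⟩
    | j + 3, hj =>
      have key (T : P.Tr) : V.gr ^ k * V.gr * P.sft (j + 3) T =
          V.gr ^ k * P.sft (j + 1) T * V.gr := by
        rw [sft_succ, sft_succ, sft_succ, mul_assoc, ← mul_gr, ← sft_succ, ← mul_assoc]
      rw [key, key]
      rcases ih (j + 1) (by omega) with ⟨h, h'⟩ | ⟨h, h'⟩
      · left; rw [h, h', mul_assoc, mul_assoc]; exact ⟨rfl, rfl⟩
      · right; rw [h, h', mul_assoc, mul_assoc]; exact ⟨rfl, rfl⟩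

omit hV in
theorem lf_mul_stalk (k m n : ℕ) : V.lf * V.stalk k m n = V.stalk k (m + 1) n := by
  rw [stalk, stalk, pow_succ']; simp only [mul_assoc]

omit hV in
theorem rt_mul_stalk (k m n : ℕ) : V.rt * V.stalk k m n = V.stalk k m (n + 1) := by
  rw [stalk, stalk, pow_succ', ← mul_assoc, ← mul_assoc, ← (V.commute_lf_rt.pow_left m).eq]
  simp only [mul_assoc]

omit hV in
theorem stalk_mul_lf (k m n : ℕ) : V.stalk k m n * V.lf = V.stalk k (m + 1) n := by
  rw [← V.lf_mul_stalk]
  exact (((Commute.refl V.lf).pow_right m).mul_right (V.commute_lf_rt.pow_right n)).mul_right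
    (V.commute_lf_gr.pow_right k) |>.eq.symm

theorem stalk_mul_rt (k m n : ℕ) : V.stalk k m n * V.rt = V.stalk k m (n + 1) := by
  rw [← V.rt_mul_stalk]
  exact ((V.commute_lf_rt.symm.pow_right m).mul_right ((Commute.refl V.rt).pow_right n)).mul_right
    ((commute_rt_gr hV).pow_right k) |>.eq.symm

omit hV in
theorem stalk_mul_gr (k m n : ℕ) : V.stalk k m n * V.gr = V.stalk (k + 1) m n := by
  rw [stalk, stalk, pow_succ]; simp only [mul_assoc]

theorem gr_mul_stalk (k m n : ℕ) : V.gr * V.stalk k m n = V.stalk (k + 1) m n := by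
  rw [← V.stalk_mul_gr]
  exact ((V.commute_lf_gr.symm.pow_right m).mul_right
    ((commute_rt_gr hV).symm.pow_right n)).mul_right ((Commute.refl V.gr).pow_right k)

/-- A spider absorbs a comultiplication on any of its legs. -/
theorem spider_mul_gr (s : Strand) (k m n i : ℕ) (hi : i < 2 * k + 2) :
    V.spider s k m n * P.sft i V.gr = V.spider s (k + 1) m n := by
  rw [spider, mul_assoc]
  rcases Nat.lt_succ_iff_lt_or_eq.1 hi with hi | rfl
  · rw [stalk_mul_sft_gr V k m n i hi, spider]
  · rw [stalk_mul_sft, ← mul_assoc, cu_gr, mul_assoc, gr_mul_stalk hV, spider]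

/-- A spider absorbs a loop on any of its legs, which becomes a left or a right loop of the stalk.
-/
theorem spider_mul_loops (s : Strand) (k m n i : ℕ) (hi : i < 2 * k + 2) :
    (V.spider s k m n * P.sft i V.lf = V.spider s k (m + 1) n ∧
      V.spider s k m n * P.sft i V.rt = V.spider s k m (n + 1)) ∨
    (V.spider s k m n * P.sft i V.lf = V.spider s k m (n + 1) ∧
      V.spider s k m n * P.sft i V.rt = V.spider s k (m + 1) n) := by
  simp only [spider]
  rw [mul_assoc, mul_assoc]
  rcases Nat.lt_succ_iff_lt_or_eq.1 hi with hi | rfl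
  · have h0 : ∀ T : P.Tr, V.stalk k m n * T = V.lf ^ m * V.rt ^ n * (V.gr ^ k * T) :=
      fun T => mul_assoc _ _ _
    have h1 : V.lf ^ m * V.rt ^ n * (V.lf * V.gr ^ k) = V.stalk k (m + 1) n := by
      rw [← V.stalk_mul_lf, stalk, (V.commute_lf_gr.pow_right k).eq]; simp only [mul_assoc]
    have h2 : V.lf ^ m * V.rt ^ n * (V.rt * V.gr ^ k) = V.stalk k m (n + 1) := by
      rw [← stalk_mul_rt hV, stalk, ((commute_rt_gr hV).pow_right k).eq]; simp only [mul_assoc]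
    rcases gr_pow_mul_sft_loops hV k i hi with ⟨h, h'⟩ | ⟨h, h'⟩
    · left; rw [h0, h0, h, h', h1, h2]; exact ⟨rfl, rfl⟩
    · right; rw [h0, h0, h, h', h1, h2]; exact ⟨rfl, rfl⟩
  · right
    rw [stalk_mul_sft, stalk_mul_sft, ← mul_assoc, ← cu_rt, ← mul_assoc, ← cu_lf, mul_assoc,
      mul_assoc, V.lf_mul_stalk, V.rt_mul_stalk]
    exact ⟨rfl, rfl⟩

theorem spider_mul_lf (s : Strand) (k m n i : ℕ) (hi : i < 2 * k + 2) :
    ∃ m' n', V.spider s k m n * P.sft i V.lf = V.spider s k m' n' := by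
  rcases spider_mul_loops hV s k m n i hi with h | h
  exacts [⟨_, _, h.1⟩, ⟨_, _, h.1⟩]

theorem spider_mul_rt (s : Strand) (k m n i : ℕ) (hi : i < 2 * k + 2) :
    ∃ m' n', V.spider s k m n * P.sft i V.rt = V.spider s k m' n' := by
  rcases spider_mul_loops hV s k m n i hi with h | h
  exacts [⟨_, _, h.2⟩, ⟨_, _, h.2⟩]

/-- A spider absorbs a cap on any two neighbouring legs, which becomes a loop of the stalk. -/
theorem spider_mul_ca (s : Strand) (k m n i : ℕ) (hi : i + 1 < 2 * k + 4) :
    ∃ m' n', V.spider s (k + 1) m n * P.sft i V.ca = V.spider s k m' n' := by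
  rcases Nat.lt_succ_iff_lt_or_eq.1 (show i < 2 * k + 2 + 1 by omega) with hi | rfl
  · rw [← spider_mul_gr hV s k m n i hi, mul_assoc, ← map_mul, gr_mul_ca]
    exact spider_mul_lf hV s k m n i hi
  · rw [← spider_mul_gr hV s k m n (2 * k + 1) (by omega), mul_assoc,
      show P.sft (2 * k + 2) V.ca = P.sft (2 * k + 1) (P.sh V.ca) from sft_succ' _ _, ← map_mul,
      gr_mul_sh_ca]
    exact spider_mul_rt hV s k m n _ (by omega)

/-- The stalk of a spider can be moved from the left to the right end of the cup, where left and
right loops change places. -/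
theorem spider_eq_cu_mul_sh (s : Strand) (k m n : ℕ) :
    V.spider s k m n = V.cu s * P.sh (V.stalk k n m) := by
  have h0 : V.spider s 0 m n = V.cu s * P.sh (V.stalk 0 n m) := by
    simp only [spider, stalk, pow_zero, mul_one]
    rw [← mul_assoc, cu_mul_lf_pow, mul_assoc, sh_mul_rt_pow, ← mul_assoc, cu_mul_rt_pow, mul_assoc,
      ← map_mul]
  induction k with
  | zero => exact h0
  | succ k ih =>
    rw [← spider_mul_gr hV s k m n 1 (by omega), ih, mul_assoc, sft_succ, sft_zero, ← map_mul,
      V.stalk_mul_gr]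

/-- Connecting the first leg of a spider with the wire on its left turns the spider into a stalk on
that wire. This is only an inequality since the cap is undefined on wires of the same kind. -/
theorem sh_spider_mul_ca_le (s : Strand) (k m n : ℕ) :
    P.sh (V.spider s k m n) * V.ca ≤ V.stalk k n m := by
  rw [spider_eq_cu_mul_sh hV, map_mul, mul_assoc, mul_ca, ← mul_assoc]
  conv_rhs => rw [← one_mul (V.stalk k n m)]
  exact mul_le_mul (V.snake_left s) le_rfl

omit hV in
/-- Connecting the last leg of a spider with the wire on its right turns the spider into a stalk on
that wire. -/
theorem spider_mul_ca_le (s : Strand) (k m n : ℕ) :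
    V.spider s k m n * P.sft (2 * k + 1) V.ca ≤ V.stalk k m n := by
  rw [spider, mul_assoc, stalk_mul_sft, ← mul_assoc]
  conv_rhs => rw [← one_mul (V.stalk k m n)]
  exact mul_le_mul (V.snake_right s) le_rfl

end Sliding
end NestedVertex
end

/-! ### Tidy operations -/

section
variable {C : Type u} [Category.{v} C] [MonoidalCategory C]

namespace NestedVertex
variable {P : DualObjects C} (V : NestedVertex P.A P.Ad)
open DualObjects DualObjects.Tr

theorem mul_spider (s : Strand) (k m n : ℕ) (T : P.Tr) :
    T * V.spider s k m n = V.spider s k m n * P.sft (2 * k + 2) T := by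
  rw [spider, mul_assoc, show P.sft (2 * k + 2) T = P.sft (2 * k + 1) (P.sh T) from sft_succ' _ _,
    stalk_mul_sft, ← mul_assoc, ← mul_assoc, mul_cu]

/-- `Tidy W B ls T` says that the operation `T`, which creates one wire for each entry of `ls`, is a
product of spiders, up to operations from `W` (empty in the planar case, the symmetry in the
commutative case) acting on neighbouring wires. The set `B` contains the labels of the connected
components created so far, and `ls` lists the component to which each wire belongs.

* `adjoin` inserts a new spider between two wires.
* `closed` is a single component without legs.
* `lost` describes a component without legs besides another component. Such a diagram can never
  become connected, so that nothing is recorded about its operation.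
* `swap` applies an operation from `W` to two neighbouring wires. -/
inductive Tidy (W : Set P.Tr) : Finset ℕ → List ℕ → P.Tr → Prop
  | nil : Tidy W ∅ [] 1
  | adjoin (κ : ℕ) (B : Finset ℕ) (lx ly : List ℕ) (T : P.Tr) (s : Strand) (k m n : ℕ)
      (h : Tidy W B (lx ++ ly) T) (hκ : κ ∉ B) :
      Tidy W (insert κ B) (lx ++ (List.replicate (2 * k + 2) κ ++ ly))
        (T * P.sft lx.length (V.spider s k m n))
  | closed (κ : ℕ) (s : Strand) (m n : ℕ) : Tidy W {κ} [] (V.spider s 0 m n * V.ca)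
  | lost (κ κ' : ℕ) (B : Finset ℕ) (ls : List ℕ) (T : P.Tr) (h : κ ∈ B) (h' : κ' ∈ B)
      (hne : κ ≠ κ') (hl : ∀ l ∈ ls, l ∈ B) (hκ : κ ∉ ls) : Tidy W B ls T
  | swap (χ : P.Tr) (hχ : χ ∈ W) (B : Finset ℕ) (lx : List ℕ) (a b : ℕ) (ly : List ℕ) (T : P.Tr)
      (h : Tidy W B (lx ++ a :: b :: ly) T) :
      Tidy W B (lx ++ b :: a :: ly) (T * P.sft lx.length χ)

variable {V} {W : Set P.Tr}

theorem Tidy.mem_of_mem {B : Finset ℕ} {ls : List ℕ} {T : P.Tr} (h : V.Tidy W B ls T) :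
    ∀ l ∈ ls, l ∈ B := by
  induction h with
  | nil => simp
  | adjoin κ B lx ly T s k m n h hκ ih =>
    intro l hl
    simp only [List.mem_append, List.mem_replicate] at hl ih
    rw [Finset.mem_insert]
    rcases hl with hl | ⟨-, hl⟩ | hl
    · exact Or.inr (ih l (Or.inl hl))
    · exact Or.inl hl
    · exact Or.inr (ih l (Or.inr hl))
  | closed => simp
  | lost κ κ' B ls T h h' hne hl hκ => exact hl
  | swap χ hχ B lx a b ly T h ih =>
    intro l hl
    refine ih l ?_
    simp only [List.mem_append, List.mem_cons] at hl ⊢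
    tauto

theorem Tidy.map {B : Finset ℕ} {ls : List ℕ} {T : P.Tr} (h : V.Tidy W B ls T) (φ : ℕ → ℕ)
    (hφ : Set.InjOn φ B) : V.Tidy W (B.image φ) (ls.map φ) T := by
  induction h with
  | nil => exact .nil
  | adjoin κ B lx ly T s k m n h hκ ih =>
    rw [Finset.image_insert, List.map_append, List.map_append, List.map_replicate]
    have := Tidy.adjoin (V := V) (W := W) (φ κ) (B.image φ) (lx.map φ) (ly.map φ) T s k m n
      (by rw [← List.map_append]
          exact ih (hφ.mono (by simp))) (by
        rw [Finset.mem_image]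
        rintro ⟨b, hb, hbκ⟩
        exact hκ (hφ (by simp [hb]) (by simp) hbκ ▸ hb))
    rwa [List.length_map] at this
  | closed κ s m n => rw [Finset.image_singleton]; exact .closed _ _ _ _
  | lost κ κ' B ls T h h' hne hl hκ =>
    refine .lost (φ κ) (φ κ') _ _ _ (Finset.mem_image_of_mem _ h) (Finset.mem_image_of_mem _ h')
      (fun e => hne (hφ h h' e)) ?_ ?_
    · intro l hl'
      obtain ⟨l', hl₁, rfl⟩ := List.mem_map.1 hl'
      exact Finset.mem_image_of_mem _ (hl _ hl₁)
    · intro h1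
      obtain ⟨l', hl₁, e⟩ := List.mem_map.1 h1
      exact hκ (hφ (hl _ hl₁) h e ▸ hl₁)
  | swap χ hχ B lx a b ly T h ih =>
    have h1 := ih hφ
    rw [List.map_append, List.map_cons, List.map_cons] at h1 ⊢
    have := Tidy.swap χ hχ _ _ _ _ _ _ h1
    rwa [List.length_map] at this

/-- For an operation `χ` exchanging the first two wires, the operation moving the wire in position
`n` to the front. -/
def pull (χ : P.Tr) : ℕ → P.Tr
  | 0 => 1
  | n + 1 => P.sh (pull χ n) * χ

/-- For an operation `χ` exchanging the first two wires, the operation moving the first wire to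
position `n`. -/
def push (χ : P.Tr) : ℕ → P.Tr
  | 0 => 1
  | n + 1 => χ * P.sh (push χ n)

theorem Tidy.mul_pull {χ : P.Tr} (hχ : χ ∈ W) {B : Finset ℕ} (l : List ℕ) {lx ly : List ℕ} {a : ℕ}
    {T : P.Tr} (h : V.Tidy W B (lx ++ (l ++ a :: ly)) T) :
    V.Tidy W B (lx ++ a :: (l ++ ly)) (T * P.sft lx.length (pull χ l.length)) := by
  induction l generalizing lx with
  | nil => simpa [pull] using h
  | cons b l ih =>
    have h1 := ih (lx := lx ++ [b]) (by simpa using h)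
    have h2 := Tidy.swap χ hχ B lx b a (l ++ ly) _ (by simpa using h1)
    rw [List.length_cons, pull, map_mul, ← mul_assoc, ← sft_succ']
    simpa using h2

theorem Tidy.mul_push {χ : P.Tr} (hχ : χ ∈ W) {B : Finset ℕ} (l : List ℕ) {lx ly : List ℕ} {a : ℕ}
    {T : P.Tr} (h : V.Tidy W B (lx ++ a :: (l ++ ly)) T) :
    V.Tidy W B (lx ++ (l ++ a :: ly)) (T * P.sft lx.length (push χ l.length)) := by
  induction l generalizing lx T with
  | nil => simpa [push] using h
  | cons b l ih =>
    have h1 := Tidy.swap χ hχ B lx a b (l ++ ly) _ h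
    have h2 := ih (lx := lx ++ [b]) (by simpa using h1)
    rw [List.length_cons, push, map_mul, ← mul_assoc, ← sft_succ']
    simpa using h2

theorem sft_mul_sft (p : ℕ) {x y x' y' a b a' b' : ℕ} {T K T' K' : P.Tr}
    (h : P.sft x T * P.sft y K = P.sft x' T' * P.sft y' K') (ha : a = p + x) (hb : b = p + y)
    (ha' : a' = p + x') (hb' : b' = p + y') :
    P.sft a T * P.sft b K = P.sft a' T' * P.sft b' K' := by
  subst ha hb ha' hb'
  rw [sft_add, sft_add, sft_add, sft_add, ← map_mul, ← map_mul, h]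

theorem append_replicate_append_eq {α : Type*} {n : ℕ} {κ a : α} {lx' ly' lx ly : List α}
    (h : lx' ++ (List.replicate n κ ++ ly') = lx ++ a :: ly) :
    (∃ l, lx' = lx ++ a :: l ∧ ly = l ++ (List.replicate n κ ++ ly')) ∨
    (a = κ ∧ ∃ i j, n = i + 1 + j ∧ lx = lx' ++ List.replicate i κ ∧
      ly = List.replicate j κ ++ ly') ∨
    (∃ l, ly' = l ++ a :: ly ∧ lx = lx' ++ (List.replicate n κ ++ l)) := by
  rcases List.append_eq_append_iff.1 h with ⟨l, rfl, h1⟩ | ⟨l, rfl, h1⟩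
  · rcases List.append_eq_append_iff.1 h1 with ⟨l2, rfl, h2⟩ | ⟨l2, h2, h3⟩
    · exact Or.inr (Or.inr ⟨l2, h2, rfl⟩)
    · obtain ⟨h4, h5, h6⟩ := List.append_eq_replicate_iff.1 h2.symm
      cases l2 with
      | nil =>
        simp only [List.length_nil, add_zero] at h4
        refine Or.inr (Or.inr ⟨[], by simpa using h3.symm, ?_⟩)
        rw [h5, h4]; simp
      | cons b l2 =>
        simp only [List.cons_append, List.cons.injEq] at h3
        obtain ⟨rfl, rfl⟩ := h3
        rw [List.length_cons, List.replicate_succ, List.cons.injEq] at h6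
        refine Or.inr (Or.inl ⟨h6.1, l.length, l2.length, ?_, ?_, ?_⟩)
        · simp only [List.length_cons] at h4; omega
        · rw [← h5]
        · rw [← h6.2]
  · cases l with
    | nil =>
      cases n with
      | zero =>
        right; right
        exact ⟨[], by simpa using h1.symm, by simp⟩
      | succ n =>
        simp only [List.nil_append, List.replicate_succ, List.cons_append, List.cons.injEq] at h1
        exact Or.inr (Or.inl ⟨h1.1, 0, n, by omega, by simp, h1.2⟩)
    | cons b l =>
      simp only [List.cons_append, List.cons.injEq] at h1
      obtain ⟨rfl, rfl⟩ := h1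
      exact Or.inl ⟨l, rfl, rfl⟩

variable (V W) in
/-- An operation replacing the first wire by `c` wires that is absorbed by spiders and that can be
moved past the operations in `W`. -/
structure LegOp (O : P.Tr) (c : ℕ) : Prop where
  sh_mul : ∀ T : P.Tr, P.sh T * O = O * P.sft c T
  spider : ∀ s k m n i, i < 2 * k + 2 → ∃ k' m' n', 2 * k' + 2 = 2 * k + 1 + c ∧
    V.spider s k m n * P.sft i O = V.spider s k' m' n'
  swap_mul : ∀ χ ∈ W, χ * O = P.sh O * push χ c
  swap_mul_sh : ∀ χ ∈ W, χ * P.sh O = O * pull χ c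
  swap_comm : ∀ χ ∈ W, ∀ T : P.Tr, P.sh (P.sh T) * χ = χ * P.sh (P.sh T)

theorem Tidy.legOp {O : P.Tr} {c : ℕ} (hO : LegOp V W O c) {B : Finset ℕ} {ls : List ℕ} {T : P.Tr}
    (h : V.Tidy W B ls T) {lx ly : List ℕ} {a : ℕ} (hls : ls = lx ++ a :: ly) :
    V.Tidy W B (lx ++ (List.replicate c a ++ ly)) (T * P.sft lx.length O) := by
  induction h generalizing lx a ly with
  | nil => simp at hls
  | adjoin κ B lx' ly' T s k m n h hκ ih =>
    rcases append_replicate_append_eq hls with ⟨l, rfl, rfl⟩ | ⟨rfl, i, j, hij, rfl, rfl⟩ |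
      ⟨l, rfl, rfl⟩
    · have h1 := ih (lx := lx) (a := a) (ly := l ++ ly') (by simp)
      have h2 := Tidy.adjoin κ B (lx ++ (List.replicate c a ++ l)) ly' _ s k m n (by simpa using h1)
        hκ
      convert h2 using 1
      · simp
      · rw [mul_assoc, mul_assoc]
        congr 1
        refine sft_mul_sft lx.length (x := l.length + 1) (y := 0) (x' := 0) (y' := c + l.length) ?_
          (by simp) (by simp) (by simp) (by simp)
        rw [sft_succ, sft_zero, hO.sh_mul, ← sft_add]
    · obtain ⟨k', m', n', hk', e⟩ := hO.spider s k m n i (by omega)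
      have h2 := Tidy.adjoin a B lx' ly' T s k' m' n' h hκ
      convert h2 using 1
      · rw [show 2 * k' + 2 = i + (c + j) by omega, List.replicate_add, List.replicate_add]
        simp only [List.append_assoc]
      · rw [mul_assoc, List.length_append, List.length_replicate, sft_add, ← map_mul, e]
    · have h1 := ih (lx := lx' ++ l) (a := a) (ly := ly) (by simp)
      have h2 := Tidy.adjoin κ B lx' (l ++ (List.replicate c a ++ ly)) _ s k m n (by simpa using h1)
        hκ
      convert h2 using 1
      · simp
      · rw [mul_assoc, mul_assoc]
        congr 1
        refine sft_mul_sft lx'.length (x := 0) (y := 2 * k + 2 + l.length) (x' := l.length)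
          (y' := 0) ?_ (by simp) (by simp) (by simp) (by simp)
        rw [sft_zero, mul_spider, sft_add]
  | closed => simp at hls
  | lost κ κ' B ls T h h' hne hl hκ =>
    subst hls
    refine .lost κ κ' _ _ _ h h' hne ?_ ?_
    · intro l hl'
      refine hl l ?_
      simp only [List.mem_append, List.mem_cons, List.mem_replicate] at hl' ⊢
      tauto
    · intro hl'
      refine hκ ?_
      simp only [List.mem_append, List.mem_cons, List.mem_replicate] at hl' ⊢
      tauto
  | swap χ hχ B lx' a' b' ly' T h ih =>
    rcases List.append_eq_append_iff.1 hls with ⟨l, rfl, h1⟩ | ⟨l, rfl, h1⟩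
    · match l, h1 with
      | [], h1 =>
        simp only [List.nil_append, List.cons.injEq] at h1
        obtain ⟨rfl, rfl⟩ := h1
        have h2 := ih (lx := lx' ++ [a']) (a := b') (ly := ly') (by simp)
        have h3 := Tidy.mul_push hχ (List.replicate c b') (lx := lx') (a := a') (ly := ly')
          (by simpa using h2)
        convert h3 using 1
        · simp
        · simp only [List.append_nil, List.length_replicate]
          rw [mul_assoc, mul_assoc, ← map_mul, hO.swap_mul χ hχ, map_mul, sft_succ']
      | [b''], h1 =>
        simp only [List.cons_append, List.nil_append, List.cons.injEq] at h1
        obtain ⟨rfl, rfl, rfl⟩ := h1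
        have h2 := ih (lx := lx') (a := a') (ly := b' :: ly') (by simp)
        have h3 := Tidy.mul_pull hχ (List.replicate c a') (lx := lx') (a := b') (ly := ly')
          (by simpa using h2)
        convert h3 using 1
        · simp
        · simp only [List.length_append, List.length_cons, List.length_nil, List.length_replicate]
          rw [mul_assoc, mul_assoc, sft_succ', ← map_mul, hO.swap_mul_sh χ hχ, map_mul]
      | b'' :: a'' :: l, h1 =>
        simp only [List.cons_append, List.cons.injEq] at h1
        obtain ⟨rfl, rfl, rfl⟩ := h1
        have h2 := ih (lx := lx' ++ a' :: b' :: l) (a := a) (ly := ly) (by simp)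
        have h3 := Tidy.swap χ hχ B lx' a' b' _ _ (by simpa using h2)
        convert h3 using 1
        · simp
        · rw [mul_assoc, mul_assoc]
          congr 1
          refine sft_mul_sft lx'.length (x := 0) (y := l.length + 2) (x' := l.length + 2)
            (y' := 0) ?_ (by simp) (by simp) (by simp) (by simp)
          exact (hO.swap_comm χ hχ _).symm
    · match l, h1 with
      | [], h1 =>
        simp only [List.nil_append, List.cons.injEq] at h1
        obtain ⟨rfl, rfl⟩ := h1
        have h2 := ih (lx := lx ++ [a']) (a := a) (ly := ly') (by simp)
        have h3 := Tidy.mul_push hχ (List.replicate c a) (lx := lx) (a := a') (ly := ly')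
          (by simpa using h2)
        convert h3 using 1
        simp only [List.append_nil, List.length_replicate]
        rw [mul_assoc, mul_assoc, ← map_mul, hO.swap_mul χ hχ, map_mul, sft_succ']
      | b'' :: l, h1 =>
        simp only [List.cons_append, List.cons.injEq] at h1
        obtain ⟨rfl, rfl⟩ := h1
        have h2 := ih (lx := lx) (a := a) (ly := l ++ a' :: b' :: ly') (by simp)
        have h3 := Tidy.swap χ hχ B (lx ++ (List.replicate c a ++ l)) a' b' ly' _
          (by simpa using h2)
        convert h3 using 1
        · simp
        · rw [mul_assoc, mul_assoc]
          congr 1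
          refine sft_mul_sft lx.length (x := l.length + 1) (y := 0) (x' := 0)
            (y' := c + l.length) ?_ (by simp) (by simp) (by simp) (by simp)
          rw [sft_succ, sft_zero, hO.sh_mul, ← sft_add]

end NestedVertex
end

/-! ### Connecting neighbouring legs -/

section
variable {C : Type u} [Category.{v} C] [MonoidalCategory C]

namespace NestedVertex
variable {P : DualObjects C} {V : NestedVertex P.A P.Ad}
open DualObjects DualObjects.Tr

theorem legOp_gr (hV : NestedSliding V) : V.LegOp ∅ V.gr 3 where
  sh_mul T := V.mul_gr T
  spider s k m n i hi := ⟨k + 1, m, n, by omega, spider_mul_gr hV s k m n i hi⟩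
  swap_mul χ hχ := by cases hχ
  swap_mul_sh χ hχ := by cases hχ
  swap_comm χ hχ := by cases hχ

theorem legOp_lf (hV : NestedSliding V) : V.LegOp ∅ V.lf 1 where
  sh_mul T := V.mul_lf T
  spider s k m n i hi := by
    obtain ⟨m', n', h⟩ := spider_mul_lf hV s k m n i hi
    exact ⟨k, m', n', by omega, h⟩
  swap_mul χ hχ := by cases hχ
  swap_mul_sh χ hχ := by cases hχ
  swap_comm χ hχ := by cases hχ

theorem legOp_rt (hV : NestedSliding V) : V.LegOp ∅ V.rt 1 where
  sh_mul T := V.mul_rt T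
  spider s k m n i hi := by
    obtain ⟨m', n', h⟩ := spider_mul_rt hV s k m n i hi
    exact ⟨k, m', n', by omega, h⟩
  swap_mul χ hχ := by cases hχ
  swap_mul_sh χ hχ := by cases hχ
  swap_comm χ hχ := by cases hχ

theorem Tidy.pow {W : Set P.Tr} {O : P.Tr} (hO : V.LegOp W O 1) {B : Finset ℕ} {T : P.Tr}
    {lx ly : List ℕ} {a : ℕ} (h : V.Tidy W B (lx ++ a :: ly) T) (m : ℕ) :
    V.Tidy W B (lx ++ a :: ly) (T * P.sft lx.length (O ^ m)) := by
  induction m with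
  | zero => simpa using h
  | succ m ih =>
    have := ih.legOp hO rfl
    rw [pow_succ, map_mul, ← mul_assoc]
    simpa using this

theorem Tidy.pow_gr {W : Set P.Tr} (hO : V.LegOp W V.gr 3) {B : Finset ℕ} {T : P.Tr}
    {lx ly : List ℕ} {a : ℕ} (h : V.Tidy W B (lx ++ a :: ly) T) (k : ℕ) :
    V.Tidy W B (lx ++ (List.replicate (2 * k + 1) a ++ ly)) (T * P.sft lx.length (V.gr ^ k)) := by
  induction k with
  | zero => simpa using h
  | succ k ih =>
    have := ih.legOp hO (lx := lx) (a := a) (ly := List.replicate (2 * k) a ++ ly)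
      (by rw [List.replicate_succ]; rfl)
    rw [pow_succ, map_mul, ← mul_assoc]
    convert this using 2
    rw [show 2 * (k + 1) + 1 = 3 + 2 * k by omega, List.replicate_add, List.append_assoc]

theorem Tidy.stalk {W : Set P.Tr} (hg : V.LegOp W V.gr 3) (hl : V.LegOp W V.lf 1)
    (hr : V.LegOp W V.rt 1) {B : Finset ℕ} {T : P.Tr}
    {lx ly : List ℕ} {a : ℕ} (h : V.Tidy W B (lx ++ a :: ly) T) (k m n : ℕ) :
    V.Tidy W B (lx ++ (List.replicate (2 * k + 1) a ++ ly))
      (T * P.sft lx.length (V.stalk k m n)) := by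
  have := ((h.pow hl m).pow hr n).pow_gr hg k
  rwa [mul_assoc, mul_assoc, ← map_mul, ← map_mul, ← mul_assoc] at this

/-- The relabelling of components that replaces the label `b` by `a`. -/
def merge (a b l : ℕ) : ℕ := if l = b then a else l

theorem merge_self (a l : ℕ) : merge a a l = l := by
  unfold merge; split <;> simp_all

theorem merge_right (a b : ℕ) : merge a b b = a := by simp [merge]

theorem merge_of_ne {a b l : ℕ} (h : l ≠ b) : merge a b l = l := by simp [merge, h]

theorem merge_left (a b : ℕ) : merge a b a = a := by
  unfold merge; split <;> rfl

theorem map_merge_of_not_mem {a b : ℕ} {ls : List ℕ} (h : b ∉ ls) : ls.map (merge a b) = ls := by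
  conv_rhs => rw [← List.map_id ls]
  exact List.map_congr_left fun l hl => merge_of_ne fun e => h (e ▸ hl)

theorem map_merge_self {a : ℕ} {ls : List ℕ} : ls.map (merge a a) = ls := by
  conv_rhs => rw [← List.map_id ls]
  exact List.map_congr_left fun l hl => merge_self a l

theorem image_merge_of_not_mem {a b : ℕ} {B : Finset ℕ} (h : b ∉ B) :
    B.image (merge a b) = B := by
  conv_rhs => rw [← Finset.image_id (s := B)]
  exact Finset.image_congr fun l hl => merge_of_ne fun e => h (e ▸ hl)

theorem image_merge_self {a : ℕ} {B : Finset ℕ} : B.image (merge a a) = B := by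
  conv_rhs => rw [← Finset.image_id (s := B)]
  exact Finset.image_congr fun l hl => merge_self a l

/-- When legs of the components `a` and `b` have been connected, which results in the operation `T`
with output labels `ls`, the operation is tidy with both components merged, up to extending its
domain. -/
def Joined (V : NestedVertex P.A P.Ad) (W : Set P.Tr) (a b : ℕ) (B : Finset ℕ) (ls : List ℕ)
    (T : P.Tr) : Prop :=
  ∃ T', T ≤ T' ∧ V.Tidy W (B.image (merge a b)) (ls.map (merge a b)) T'

/-- A lost component stays lost when labels are merged. -/
theorem joined_of_lost {W : Set P.Tr} {κ κ' a b : ℕ} {B : Finset ℕ} {ls : List ℕ} (T : P.Tr)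
    (h : κ ∈ B) (h' : κ' ∈ B) (hne : κ ≠ κ') (hl : ∀ l ∈ ls, l ∈ B) (hκ : κ ∉ ls) (ha : a ≠ κ)
    (hb : b ≠ κ) : Joined V W a b B ls T := by
  have e : ∀ l, merge a b l = κ → l = κ := by
    intro l hl
    unfold merge at hl
    split at hl
    · exact absurd hl ha
    · exact hl
  refine ⟨T, le_rfl, .lost κ (merge a b κ') _ _ _ ?_ (Finset.mem_image_of_mem _ h')
    (fun h1 => hne (e _ h1.symm).symm) ?_ ?_⟩
  · exact Finset.mem_image.2 ⟨κ, h, merge_of_ne hb.symm⟩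
  · intro l hl'
    obtain ⟨l', hl₁, rfl⟩ := List.mem_map.1 hl'
    exact Finset.mem_image_of_mem _ (hl _ hl₁)
  · intro h1
    obtain ⟨l', hl₁, e'⟩ := List.mem_map.1 h1
    exact hκ (e _ e' ▸ hl₁)

theorem Tidy.eq_one {W : Set P.Tr} {B : Finset ℕ} {ls : List ℕ} {T : P.Tr} (h : V.Tidy W B ls T)
    (hB : B = ∅) : T = 1 := by
  cases h with
  | nil => rfl
  | adjoin κ B => simp at hB
  | closed => simp at hB
  | lost κ κ' _ _ _ h => simp [hB] at h
  | swap χ hχ B lx a b ly T h =>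
    have := h.mem_of_mem a (by simp)
    simp [hB] at this

/-- Connecting two neighbouring legs of the same spider. -/
theorem Tidy.joined_inside {W : Set P.Tr} (hV : NestedSliding V) {κ : ℕ} {B : Finset ℕ}
    {lx ly : List ℕ} {T : P.Tr} (h : V.Tidy W B (lx ++ ly) T) (hκ : κ ∉ B) (s : Strand)
    (k m n i : ℕ) (hi : i + 1 < 2 * k + 2) :
    Joined V W κ κ (insert κ B) (lx ++ (List.replicate (2 * k) κ ++ ly))
      (T * P.sft lx.length (V.spider s k m n * P.sft i V.ca)) := by
  cases k with
  | zero =>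
    obtain rfl : i = 0 := by omega
    by_cases hB : B = ∅
    · subst hB
      have hnil : lx ++ ly = [] :=
        List.eq_nil_iff_forall_not_mem.2 fun l hl => by simpa using h.mem_of_mem l hl
      obtain ⟨rfl, rfl⟩ := List.append_eq_nil_iff.1 hnil
      obtain rfl := h.eq_one rfl
      rw [one_mul, List.length_nil, sft_zero, sft_zero]
      refine ⟨_, le_rfl, ?_⟩
      rw [image_merge_self, map_merge_self]
      exact .closed κ s m n
    · obtain ⟨κ', hκ'⟩ := Finset.nonempty_iff_ne_empty.2 hB
      have : κ ≠ κ' := fun e => hκ (e ▸ hκ')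
      refine ⟨_, le_rfl, ?_⟩
      rw [image_merge_self, map_merge_self]
      refine .lost κ κ' _ _ _ (by simp) (by simp [hκ']) this ?_ ?_
      · intro l hl
        exact Finset.mem_insert_of_mem (h.mem_of_mem l (by simpa using hl))
      · intro hl
        exact hκ (h.mem_of_mem κ (by simpa using hl))
  | succ k =>
    obtain ⟨m', n', e⟩ := spider_mul_ca hV s k m n i (by omega)
    rw [e]
    refine ⟨_, le_rfl, ?_⟩
    rw [image_merge_self, map_merge_self]
    exact .adjoin κ B lx ly T s k m' n' h hκ

/-- Connecting two neighbouring legs in the planar case. Legs of the same spider produce a loop, and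
a spider connected with another one becomes a stalk on a leg of the latter, where it is absorbed. -/
theorem Tidy.joined (hV : NestedSliding V) {B : Finset ℕ} {ls : List ℕ}
    {T : P.Tr} (h : V.Tidy ∅ B ls T) {lx ly : List ℕ} {a b : ℕ} (hls : ls = lx ++ a :: b :: ly) :
    Joined V ∅ a b B (lx ++ ly) (T * P.sft lx.length V.ca) := by
  induction h generalizing lx a b ly with
  | nil => simp at hls
  | adjoin κ B lx' ly' T s k m n h hκ ih =>
    have hmem := h.mem_of_mem
    rcases append_replicate_append_eq hls with ⟨l, rfl, h1⟩ | ⟨rfl, i, j, hij, rfl, h1⟩ |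
      ⟨l, rfl, rfl⟩
    · cases l with
      | nil =>
        -- the second leg is the first leg of the spider
        rw [List.nil_append, List.replicate_succ, List.cons_append, List.cons.injEq] at h1
        obtain ⟨rfl, rfl⟩ := h1
        have ha : a ∈ B := hmem a (by simp)
        refine ⟨T * P.sft lx.length (V.stalk k n m), ?_, ?_⟩
        · rw [List.length_append, List.length_singleton, sft_succ', mul_assoc, ← map_mul]
          exact mul_le_mul le_rfl (sft_mono _ (sh_spider_mul_ca_le hV s k m n))
        · have h2 := Tidy.stalk (legOp_gr hV) (legOp_lf hV) (legOp_rt hV) (lx := lx) (a := a)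
            (ly := ly') (by simpa using h) k n m
          convert h2 using 1
          · rw [Finset.image_insert, merge_right, image_merge_of_not_mem hκ,
              Finset.insert_eq_of_mem ha]
          · rw [List.map_append, List.map_append, List.map_replicate, merge_right,
              map_merge_of_not_mem fun hl => hκ (hmem _ (by simp [hl])),
              map_merge_of_not_mem fun hl => hκ (hmem _ (by simp [hl]))]
      | cons c l =>
        rw [List.cons_append, List.cons.injEq] at h1
        obtain ⟨rfl, rfl⟩ := h1
        have ha : a ∈ B := hmem a (by simp)
        have hb : b ∈ B := hmem b (by simp)
        have hκa : merge a b κ = κ := merge_of_ne fun e => hκ (e ▸ hb)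
        have hκ' : κ ∉ B.image (merge a b) := by
          rw [Finset.mem_image]
          rintro ⟨x, hx, e⟩
          unfold merge at e
          split at e
          · exact hκ (e ▸ ha)
          · exact hκ (e ▸ hx)
        obtain ⟨T', hT, h2⟩ := ih (lx := lx) (a := a) (b := b) (ly := l ++ ly') (by simp)
        refine ⟨T' * P.sft (lx ++ l).length (V.spider s k m n), ?_, ?_⟩
        · refine le_trans (le_of_eq ?_) (mul_le_mul hT le_rfl)
          rw [mul_assoc, mul_assoc]
          congr 1
          refine sft_mul_sft lx.length (x := l.length + 2) (y := 0) (x' := 0) (y' := l.length) ?_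
            (by simp) (by simp) (by simp) (by simp)
          exact V.mul_ca _
        · have h3 := Tidy.adjoin κ _ ((lx ++ l).map (merge a b)) (ly'.map (merge a b)) T' s k m n
            (by simpa using h2) hκ'
          convert h3 using 1
          · rw [Finset.image_insert, hκa]
          · rw [← List.append_assoc, List.map_append (l₁ := lx ++ l),
              List.map_append (l₁ := List.replicate _ _),
              List.map_replicate, hκa]
          · rw [List.length_map]
    · cases j with
      | zero =>
        rw [List.replicate_zero, List.nil_append] at h1
        subst h1
        have hb : b ∈ B := hmem b (by simp)
        have hinj : Set.InjOn (merge a b) B := by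
          intro x hx y hy e
          unfold merge at e
          split at e <;> split at e
          · simp_all
          · exact absurd (e ▸ hy) hκ
          · exact absurd (e ▸ hx) hκ
          · exact e
        refine ⟨T * P.sft lx'.length (V.stalk k m n), ?_, ?_⟩
        · rw [List.length_append, List.length_replicate, sft_add, mul_assoc, ← map_mul,
            show i = 2 * k + 1 by omega]
          exact mul_le_mul le_rfl (sft_mono _ (spider_mul_ca_le s k m n))
        · have h2 := (Tidy.stalk (legOp_gr hV) (legOp_lf hV) (legOp_rt hV) (lx := lx') (a := b)
            (ly := ly) h k m n).map _ hinj
          convert h2 using 1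
          · rw [Finset.image_insert, merge_left, Finset.insert_eq_of_mem]
            exact Finset.mem_image.2 ⟨b, hb, merge_right a b⟩
          · rw [List.append_assoc, List.map_append, List.map_append, List.map_append,
              List.map_append, List.map_replicate, List.map_replicate, merge_left, merge_right,
              show i = 2 * k + 1 by omega]
      | succ j =>
        rw [List.replicate_succ, List.cons_append, List.cons.injEq] at h1
        obtain ⟨rfl, rfl⟩ := h1
        have := h.joined_inside hV hκ s k m n i (by omega)
        convert this using 1
        · rw [show 2 * k = i + j by omega, List.replicate_add, List.append_assoc, List.append_assoc]
        · rw [mul_assoc, List.length_append, List.length_replicate, sft_add, map_mul]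
    · have ha : a ∈ B := hmem a (by simp)
      have hb : b ∈ B := hmem b (by simp)
      have hκa : merge a b κ = κ := merge_of_ne fun e => hκ (e ▸ hb)
      have hκ' : κ ∉ B.image (merge a b) := by
        rw [Finset.mem_image]
        rintro ⟨x, hx, e⟩
        unfold merge at e
        split at e
        · exact hκ (e ▸ ha)
        · exact hκ (e ▸ hx)
      obtain ⟨T', hT, h2⟩ := ih (lx := lx' ++ l) (a := a) (b := b) (ly := ly) (by simp)
      refine ⟨T' * P.sft lx'.length (V.spider s k m n), ?_, ?_⟩
      · refine le_trans (le_of_eq ?_) (mul_le_mul hT le_rfl)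
        rw [mul_assoc, mul_assoc]
        congr 1
        refine sft_mul_sft lx'.length (x := 0) (y := 2 * k + 2 + l.length) (x' := l.length)
          (y' := 0) ?_ (by simp) (by simp) (by simp) (by simp)
        rw [sft_zero, mul_spider, sft_add]
      · have h3 := Tidy.adjoin κ _ (lx'.map (merge a b)) ((l ++ ly).map (merge a b)) T' s k m n
          (by simpa using h2) hκ'
        convert h3 using 1
        · rw [Finset.image_insert, hκa]
        · rw [List.append_assoc, List.append_assoc, List.map_append, List.map_append,
            List.map_replicate, hκa]
        · rw [List.length_map]
  | closed => simp at hls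
  | lost κ κ' B ls T h h' hne hl hκ =>
    subst hls
    refine joined_of_lost _ h h' hne ?_ ?_ ?_ ?_
    · intro l hl'
      refine hl l ?_
      simp only [List.mem_append, List.mem_cons] at hl' ⊢
      tauto
    · intro hl'
      refine hκ ?_
      simp only [List.mem_append, List.mem_cons] at hl' ⊢
      tauto
    · rintro rfl
      simp at hκ
    · rintro rfl
      simp at hκ
  | swap χ hχ => cases hχ

end NestedVertex
end

/-! ### Tracing diagrams -/

section
variable {C : Type u} [Category.{v} C] [MonoidalCategory C]

theorem List.ofFn_addCases {α : Type*} {m n k : ℕ} (e : k = m + n) (f : Fin m → α)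
    (g : Fin n → α) :
    List.ofFn (fun i : Fin k => (Fin.addCases f g (Fin.cast e i) : α)) =
      List.ofFn f ++ List.ofFn g := by
  subst e
  rw [List.ofFn_add]
  congr 1
  · congr 1
    funext i
    exact Fin.addCases_left i
  · congr 1
    funext i
    exact Fin.addCases_right i

theorem List.ofFn_get_cast {α : Type*} (l : List α) {n : ℕ} (h : l.length = n) :
    List.ofFn (fun i : Fin n => l.get (Fin.cast h.symm i)) = l := by
  subst h
  exact List.ofFn_get l

theorem List.ofFn_elim_addCases {α N N' : Type*} {m n k : ℕ} (e : k = m + n) (f : Fin m → N)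
    (g : Fin n → N') (c : N → α) (c' : N' → α) :
    List.ofFn (fun i : Fin k => Sum.elim c c'
      (Fin.addCases (fun j => Sum.inl (f j)) (fun j => Sum.inr (g j)) (Fin.cast e i))) =
      List.ofFn (fun i => c (f i)) ++ List.ofFn (fun i => c' (g i)) := by
  rw [← List.ofFn_addCases e]
  congr 1
  funext i
  refine Fin.addCases (fun j => ?_) (fun j => ?_) (Fin.cast e i) <;> simp

namespace NestedVertex
variable {P : DualObjects C} (V : NestedVertex P.A P.Ad)
open DualObjects DualObjects.Tr

/-- The multiplication: a comultiplication with its last two outputs bent around the right side. -/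
def mu : P.Tr := V.gr * P.sft 2 V.ca * P.sft 1 V.ca

/-- The operation of a piece, where `χ` is the operation of the swaps. -/
def actPiece {k : Flavour} (χ : k = .commutative → P.Tr) :
    {w w' : List Strand} → Piece k w w' → P.Tr
  | _, _, .mul => V.mu
  | _, _, .comul => V.gr
  | _, _, .cup => V.cu .down
  | _, _, .cupSwap => V.cu .up
  | _, _, .cap => V.ca
  | _, _, .capSwap => V.ca
  | _, _, .swap _ _ => χ rfl

/-- The operation of a diagram, where `χ` is the operation of the swaps. -/
def act {k : Flavour} (χ : k = .commutative → P.Tr) :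
    {w w' : List Strand} → Diagram k w w' → P.Tr
  | _, _, .piece x => V.actPiece χ x
  | _, _, .ident _ => 1
  | _, _, .comp d e => act χ d * act χ e
  | _, _, .tensor (w₁' := w₁') d e => act χ d * P.sft w₁'.length (act χ e)

/-- The operation `K` of a diagram with nodes `N` preserves tidiness: applied behind the wires `lx`,
it turns a tidy operation `T` into one that is tidy up to extension. The old labels change by `φ`,
since the diagram may connect components, and `c` labels the nodes of the diagram. Linked nodes get
the same label, and the labels of inputs and outputs agree with those of their nodes. -/
def Traced (W : Set P.Tr) (K : P.Tr) {N : Type} {l l' : ℕ} (inN : Fin l → N) (outN : Fin l' → N)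
    (link : N → N → Prop) : Prop :=
  ∀ (B : Finset ℕ) (lx lw ly : List ℕ) (T : P.Tr), V.Tidy W B (lx ++ (lw ++ ly)) T →
    lw.length = l →
    ∃ (φ : ℕ → ℕ) (c : N → ℕ) (B' : Finset ℕ) (T' : P.Tr), T * P.sft lx.length K ≤ T' ∧
      (∀ x y, link x y → c x = c y) ∧ List.ofFn (fun i => c (inN i)) = lw.map φ ∧
      (B' : Set ℕ) = φ '' B ∪ Set.range c ∧
      V.Tidy W B' (lx.map φ ++ (List.ofFn (fun i => c (outN i)) ++ ly.map φ)) T'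

variable {V} {W : Set P.Tr} {k : Flavour} {χ : k = .commutative → P.Tr}

/-- Pieces preserve tidiness: a multiplication is absorbed by comultiplying and capping twice, a cup
is a new spider, and a cap connects two legs. -/
theorem traced_piece (hg : V.LegOp W V.gr 3)
    (hj : ∀ {B : Finset ℕ} {T : P.Tr} {lx ly : List ℕ} {a b : ℕ},
      V.Tidy W B (lx ++ a :: b :: ly) T → V.Joined W a b B (lx ++ ly) (T * P.sft lx.length V.ca))
    (hχ : ∀ h, χ h ∈ W) {w w' : List Strand} (x : Piece k w w') :
    V.Traced W (V.actPiece χ x) x.inNode x.outNode (fun _ _ => False) := by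
  have cup (s : Strand) (B : Finset ℕ) (lx ly : List ℕ) (T : P.Tr) (h : V.Tidy W B (lx ++ ly) T) :
      ∃ (φ : ℕ → ℕ) (c : Unit → ℕ) (B' : Finset ℕ) (T' : P.Tr),
        T * P.sft lx.length (V.cu s) ≤ T' ∧ ([] : List ℕ) = [].map φ ∧
        (B' : Set ℕ) = φ '' B ∪ Set.range c ∧
        V.Tidy W B' (lx.map φ ++ ([c (), c ()] ++ ly.map φ)) T' := by
    obtain ⟨κ, hκ⟩ := Infinite.exists_notMem_finset B
    refine ⟨id, fun _ => κ, insert κ B, _, le_rfl, rfl, ?_, ?_⟩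
    · rw [Finset.coe_insert, Set.insert_eq, Set.union_comm, Set.image_id, Set.range_const]
    · have := Tidy.adjoin κ B lx ly T s 0 0 0 h hκ
      simpa [NestedVertex.spider, NestedVertex.stalk] using this
  have cap (B : Finset ℕ) (lx lw ly : List ℕ) (T : P.Tr) (h : V.Tidy W B (lx ++ (lw ++ ly)) T)
      (hl : lw.length = 2) :
      ∃ (φ : ℕ → ℕ) (c : Unit → ℕ) (B' : Finset ℕ) (T' : P.Tr),
        T * P.sft lx.length V.ca ≤ T' ∧ [c (), c ()] = lw.map φ ∧
        (B' : Set ℕ) = φ '' B ∪ Set.range c ∧ V.Tidy W B' (lx.map φ ++ ([] ++ ly.map φ)) T' := by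
    obtain ⟨a, b, rfl⟩ := List.length_eq_two.1 hl
    obtain ⟨T', hT, h'⟩ := hj (by simpa using h)
    refine ⟨merge a b, fun _ => a, _, T', hT, ?_, ?_, by simpa using h'⟩
    · simp [merge_left, merge_right]
    · have : a ∈ merge a b '' B := ⟨a, h.mem_of_mem a (by simp), merge_left a b⟩
      simp [this]
  cases x with
  | mul =>
    intro B lx lw ly T h hl
    obtain ⟨a, b, c, rfl⟩ := List.length_eq_three.1 hl
    have h1 := h.legOp hg (lx := lx) (a := a) (ly := b :: c :: ly) (by simp)
    obtain ⟨T₁, hT₁, h2⟩ := hj (lx := lx ++ [a, a]) (a := a) (b := b) (ly := c :: ly)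
      (by simpa using h1)
    obtain ⟨T₂, hT₂, h3⟩ := hj (lx := (lx ++ [a]).map (merge a b)) (a := merge a b a)
      (b := merge a b c) (ly := ly.map (merge a b)) (by simpa using h2)
    refine ⟨merge (merge a b a) (merge a b c) ∘ merge a b, fun _ => a,
      (B.image (merge a b)).image (merge (merge a b a) (merge a b c)), T₂, ?_, ?_, ?_, ?_, ?_⟩
    · refine le_trans ?_ hT₂
      refine le_trans (le_of_eq ?_) (mul_le_mul hT₁ le_rfl)
      simp only [actPiece, mu, map_mul, ← sft_add, mul_assoc, List.length_append, List.length_map,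
        List.length_cons, List.length_nil]
    · rintro - - ⟨⟩
    · simp [merge_left, merge_right]
    · have : a ∈ merge (merge a b a) (merge a b c) ∘ merge a b '' B :=
        ⟨a, h.mem_of_mem a (by simp), by simp [merge_left]⟩
      change _ = _ ∪ Set.range (fun _ : Unit => a)
      rw [Set.range_const, Finset.coe_image, Finset.coe_image, ← Set.image_comp]
      exact (Set.union_eq_left.2 (Set.singleton_subset_iff.2 this)).symm
    · simpa [Piece.outNode, merge_left, Function.comp_def] using h3
  | comul =>
    intro B lx lw ly T h hl
    obtain ⟨a, rfl⟩ := List.length_eq_one_iff.1 hl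
    have h1 := h.legOp hg (lx := lx) (a := a) (ly := ly) (by simp)
    refine ⟨id, fun _ => a, B, _, le_rfl, ?_, ?_, ?_, ?_⟩
    · rintro - - ⟨⟩
    · simp
    · have : a ∈ B := h.mem_of_mem a (by simp)
      change (B : Set ℕ) = id '' B ∪ Set.range (fun _ : Unit => a)
      simp [this]
    · simpa [Piece.outNode, actPiece] using h1
  | cup =>
    intro B lx lw ly T h hl
    obtain rfl := List.length_eq_zero_iff.1 hl
    obtain ⟨φ, c, B', T', h1, h2, h3, h4⟩ := cup .down B lx ly T (by simpa using h)
    exact ⟨φ, c, B', T', h1, by rintro - - ⟨⟩, h2, h3, h4⟩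
  | cupSwap =>
    intro B lx lw ly T h hl
    obtain rfl := List.length_eq_zero_iff.1 hl
    obtain ⟨φ, c, B', T', h1, h2, h3, h4⟩ := cup .up B lx ly T (by simpa using h)
    exact ⟨φ, c, B', T', h1, by rintro - - ⟨⟩, h2, h3, h4⟩
  | cap =>
    intro B lx lw ly T h hl
    obtain ⟨φ, c, B', T', h1, h2, h3, h4⟩ := cap B lx lw ly T h hl
    exact ⟨φ, c, B', T', h1, by rintro - - ⟨⟩, h2, h3, h4⟩
  | capSwap =>
    intro B lx lw ly T h hl
    obtain ⟨φ, c, B', T', h1, h2, h3, h4⟩ := cap B lx lw ly T h hl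
    exact ⟨φ, c, B', T', h1, by rintro - - ⟨⟩, h2, h3, h4⟩
  | swap a b =>
    intro B lx lw ly T h hl
    obtain ⟨a, b, rfl⟩ := List.length_eq_two.1 hl
    have h1 := Tidy.swap (χ rfl) (hχ rfl) B lx a b ly T (by simpa using h)
    refine ⟨id, ![a, b], B, _, le_rfl, ?_, ?_, ?_, ?_⟩
    · rintro - - ⟨⟩
    · simp [Piece.inNode, List.ofFn_succ]
    · have ha : a ∈ B := h.mem_of_mem a (by simp)
      have hb : b ∈ B := h.mem_of_mem b (by simp)
      rw [Set.image_id]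
      refine (Set.union_eq_left.2 ?_).symm
      rintro - ⟨i, rfl⟩
      change Fin 2 at i
      match i with
      | 0 => exact ha
      | 1 => exact hb
    · simpa [Piece.outNode, List.ofFn_succ, actPiece] using h1

theorem traced (hg : V.LegOp W V.gr 3)
    (hj : ∀ {B : Finset ℕ} {T : P.Tr} {lx ly : List ℕ} {a b : ℕ},
      V.Tidy W B (lx ++ a :: b :: ly) T → V.Joined W a b B (lx ++ ly) (T * P.sft lx.length V.ca))
    (hχ : ∀ h, χ h ∈ W) {w w' : List Strand} (d : Diagram k w w') :
    V.Traced W (V.act χ d) d.inNode d.outNode d.Link := by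
  induction d with
  | piece x => exact traced_piece hg hj hχ x
  | ident w =>
    intro B lx lw ly T h hl
    refine ⟨id, fun i => lw.get (Fin.cast hl.symm i), B, T, ?_, ?_, ?_, ?_, ?_⟩
    · rw [act, map_one, mul_one]
    · rintro - - ⟨⟩
    · rw [List.map_id]
      exact List.ofFn_get_cast lw hl
    · rw [Set.image_id]
      refine (Set.union_eq_left.2 ?_).symm
      rintro - ⟨i, rfl⟩
      exact h.mem_of_mem _ (by simp)
    · have e : List.ofFn (fun i => lw.get (Fin.cast hl.symm i)) = lw := List.ofFn_get_cast lw hl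
      rw [List.map_id, List.map_id]
      change V.Tidy W B (lx ++ (List.ofFn (fun i => lw.get (Fin.cast hl.symm i)) ++ ly)) T
      rwa [e]
  | comp d e ihd ihe =>
    intro B lx lw ly T h hl
    obtain ⟨φ₁, c₁, B₁, T₁, h1, h2, h3, h4, h5⟩ := ihd B lx lw ly T h hl
    obtain ⟨φ₂, c₂, B₂, T₂, k1, k2, k3, k4, k5⟩ := ihe B₁ _ _ _ T₁ h5 (List.length_ofFn)
    rw [List.map_ofFn, List.ofFn_inj] at k3
    refine ⟨φ₂ ∘ φ₁, Sum.elim (φ₂ ∘ c₁) c₂, B₂, T₂, ?_, ?_, ?_, ?_, ?_⟩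
    · refine le_trans ?_ k1
      rw [act, map_mul, ← mul_assoc, List.length_map]
      exact mul_le_mul h1 le_rfl
    · rintro (x | x) (y | y) hxy
      · exact congrArg φ₂ (h2 x y hxy)
      · obtain ⟨i, rfl, rfl⟩ := hxy
        exact (congrFun k3 i).symm
      · exact hxy.elim
      · exact k2 x y hxy
    · rw [← List.map_map, ← h3, List.map_ofFn]
      rfl
    · rw [k4, h4, Set.image_union, Set.image_comp, Set.union_assoc, ← Set.range_comp]
      exact congrArg _ (Set.Sum.elim_range (φ₂ ∘ c₁) c₂).symm
    · rw [← List.map_map, ← List.map_map]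
      exact k5
  | @tensor w₁ w₁' w₂ w₂' d e ihd ihe =>
    intro B lx lw ly T h hl
    obtain ⟨l₁, l₂, rfl, hl₁⟩ : ∃ l₁ l₂, lw = l₁ ++ l₂ ∧ l₁.length = w₁.length :=
      ⟨lw.take w₁.length, lw.drop w₁.length, (List.take_append_drop _ _).symm, by
        rw [List.length_take, hl, List.length_append]; omega⟩
    have hl₂ : l₂.length = w₂.length := by
      simp only [List.length_append] at hl; omega
    obtain ⟨φ₁, c₁, B₁, T₁, h1, h2, h3, h4, h5⟩ := ihd B lx l₁ (l₂ ++ ly) T (by simpa using h) hl₁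
    obtain ⟨φ₂, c₂, B₂, T₂, k1, k2, k3, k4, k5⟩ := ihe B₁
      (lx.map φ₁ ++ List.ofFn (fun i => c₁ (d.outNode i))) (l₂.map φ₁) (ly.map φ₁) T₁
      (by simpa using h5) (by simpa using hl₂)
    refine ⟨φ₂ ∘ φ₁, Sum.elim (φ₂ ∘ c₁) c₂, B₂, T₂, ?_, ?_, ?_, ?_, ?_⟩
    · refine le_trans ?_ k1
      rw [act, map_mul, ← mul_assoc, List.length_append, List.length_map, List.length_ofFn, sft_add]
      exact mul_le_mul h1 le_rfl
    · rintro (x | x) (y | y) hxy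
      · exact congrArg φ₂ (h2 x y hxy)
      · exact hxy.elim
      · exact hxy.elim
      · exact k2 x y hxy
    · refine (List.ofFn_elim_addCases List.length_append _ _ _ _).trans ?_
      rw [List.map_append, ← List.map_map, ← List.map_map, ← k3, ← h3, List.map_ofFn]
      rfl
    · rw [k4, h4, Set.image_union, Set.image_comp, Set.union_assoc, ← Set.range_comp]
      exact congrArg _ (Set.Sum.elim_range (φ₂ ∘ c₁) c₂).symm
    · have := List.ofFn_elim_addCases List.length_append d.outNode e.outNode (φ₂ ∘ c₁) c₂
      erw [this]
      simpa [Function.comp_def] using k5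

end NestedVertex
end

/-! ### Operations representing morphisms -/

section
variable {C : Type u} [Category.{v} C] [MonoidalCategory C]

namespace DualObjects
variable (P : DualObjects C)

/-- A morphism between words with the wires `y` added on the right. -/
def padRight (w w' : List Strand) (f : P.word w ⟶ P.word w') (y : List Strand) :
    P.word (w ++ y) ⟶ P.word (w' ++ y) :=
  (P.wordAppend w y).hom ≫ f ▷ P.word y ≫ (P.wordAppend w' y).inv

/-- A morphism between words with wires added on the left. -/
def padLeft {z z' : List Strand} (f : P.word z ⟶ P.word z') :
    (w : List Strand) → (P.word (w ++ z) ⟶ P.word (w ++ z'))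
  | [] => f
  | s :: w => P.ob s ◁ padLeft f w

theorem padLeft_eq {z z' : List Strand} (f : P.word z ⟶ P.word z') (w : List Strand) :
    P.padLeft f w = (P.wordAppend w z).hom ≫ P.word w ◁ f ≫ (P.wordAppend w z').inv := by
  induction w with
  | nil =>
    change f = (λ_ _).inv ≫ 𝟙_ C ◁ f ≫ (λ_ _).hom
    simp
  | cons s w ih =>
    change P.ob s ◁ P.padLeft f w = (P.ob s ◁ (P.wordAppend w z).hom ≫ (α_ _ _ _).inv) ≫
      (P.ob s ⊗ P.word w) ◁ f ≫ (α_ _ _ _).hom ≫ P.ob s ◁ (P.wordAppend w z').inv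
    rw [ih]
    simp

theorem padRight_comp (w w' w'' : List Strand) (f : P.word w ⟶ P.word w')
    (g : P.word w' ⟶ P.word w'') (y : List Strand) :
    P.padRight w w'' (f ≫ g) y = P.padRight w w' f y ≫ P.padRight w' w'' g y := by
  simp [padRight]

theorem padRight_id (w : List Strand) (y : List Strand) :
    P.padRight w w (𝟙 _) y = 𝟙 _ := by
  simp [padRight]

/-- The identification of words that are equal. -/
def wordCast {z z' : List Strand} (h : z = z') : P.word z ⟶ P.word z' :=
  eqToHom (congrArg P.word h)

theorem wordCast_rfl {z : List Strand} (h : z = z) : P.wordCast h = 𝟙 _ := rfl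

theorem whiskerLeft_wordCast (s : Strand) {z z' : List Strand} (h : z = z') :
    P.ob s ◁ P.wordCast h = P.wordCast (congrArg (s :: ·) h) := by
  subst h
  exact whiskerLeft_id _ _

theorem wordAppend_assoc (w t y : List Strand) :
    (P.wordAppend (w ++ t) y).hom ≫ (P.wordAppend w t).hom ▷ P.word y =
      P.wordCast (List.append_assoc w t y) ≫ (P.wordAppend w (t ++ y)).hom ≫
        P.word w ◁ (P.wordAppend t y).hom ≫ (α_ _ _ _).inv := by
  induction w with
  | nil =>
    change (P.wordAppend t y).hom ≫ (λ_ _).inv ▷ P.word y = 𝟙 _ ≫ (λ_ _).inv ≫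
      𝟙_ C ◁ (P.wordAppend t y).hom ≫ (α_ _ _ _).inv
    simp
  | cons s w ih =>
    have e : P.wordCast (List.append_assoc (s :: w) t y) =
      P.ob s ◁ P.wordCast (List.append_assoc w t y) := (P.whiskerLeft_wordCast _ _).symm
    rw [e]
    change (P.ob s ◁ (P.wordAppend (w ++ t) y).hom ≫ (α_ _ _ _).inv) ≫
        (P.ob s ◁ (P.wordAppend w t).hom ≫ (α_ _ _ _).inv) ▷ P.word y =
      P.ob s ◁ P.wordCast (List.append_assoc w t y) ≫
        (P.ob s ◁ (P.wordAppend w (t ++ y)).hom ≫ (α_ _ _ _).inv) ≫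
        (P.ob s ⊗ P.word w) ◁ (P.wordAppend t y).hom ≫ (α_ _ _ _).inv
    have := congrArg (fun f => P.ob s ◁ f) ih
    simp only [whiskerLeft_comp] at this
    simp only [comp_whiskerRight, Category.assoc, ← associator_inv_naturality_middle_assoc,
      reassoc_of% this]
    simp

theorem wordAppend_assoc_inv (w t y : List Strand) :
    (P.wordAppend w t).inv ▷ P.word y ≫ (P.wordAppend (w ++ t) y).inv =
      (α_ _ _ _).hom ≫ P.word w ◁ (P.wordAppend t y).inv ≫ (P.wordAppend w (t ++ y)).inv ≫
        P.wordCast (List.append_assoc w t y).symm := by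
  have h : P.wordAppend (w ++ t) y ≪≫ whiskerRightIso (P.wordAppend w t) (P.word y) =
      eqToIso (congrArg P.word (List.append_assoc w t y)) ≪≫ P.wordAppend w (t ++ y) ≪≫
        whiskerLeftIso (P.word w) (P.wordAppend t y) ≪≫ (α_ _ _ _).symm :=
    Iso.ext (by simpa [wordCast] using P.wordAppend_assoc w t y)
  simpa [wordCast] using congrArg Iso.inv h

theorem padRight_padRight (w w' t y : List Strand) (f : P.word w ⟶ P.word w') :
    P.padRight (w ++ t) (w' ++ t) (P.padRight w w' f t) y =
      P.wordCast (List.append_assoc w t y) ≫ P.padRight w w' f (t ++ y) ≫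
        P.wordCast (List.append_assoc w' t y).symm := by
  simp only [padRight, comp_whiskerRight, Category.assoc, P.wordAppend_assoc_inv]
  rw [reassoc_of% P.wordAppend_assoc]
  simp only [associator_naturality_left_assoc, Iso.inv_hom_id_assoc,
    ← whisker_exchange_assoc, ← whiskerLeft_comp_assoc, Iso.hom_inv_id]
  simp

variable {P}

theorem Tr.apply_cast {T : P.Tr} {z z' x x' : List Strand} {f : P.word z ⟶ P.word z'}
    (h : T z = some ⟨z', f⟩) (hx : x = z) (hx' : z' = x') :
    T x = some ⟨x', P.wordCast hx ≫ f ≫ P.wordCast hx'⟩ := by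
  subst hx hx'
  rw [h, wordCast_rfl, wordCast_rfl, Category.id_comp, Category.comp_id]

theorem sft_append {T : P.Tr} {z z' : List Strand} {f : P.word z ⟶ P.word z'}
    (h : T z = some ⟨z', f⟩) (w : List Strand) :
    P.sft w.length T (w ++ z) = some ⟨w ++ z', P.padLeft f w⟩ := by
  induction w with
  | nil => exact h
  | cons s w ih => exact sh_cons_some s ih

/-- The operation `T` represents the morphism `f`: on every word beginning with `w` it is defined
and acts as `f` on the wires `w`. -/
def Rep (T : P.Tr) (w w' : List Strand) (f : P.word w ⟶ P.word w') : Prop :=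
  ∀ y, T (w ++ y) = some ⟨w' ++ y, P.padRight w w' f y⟩

theorem Rep.mono {T T' : P.Tr} {w w' : List Strand} {f : P.word w ⟶ P.word w'}
    (h : Rep T w w' f) (hT : T ≤ T') : Rep T' w w' f := fun y => hT _ _ (h y)

theorem Rep.one (w : List Strand) : Rep (1 : P.Tr) w w (𝟙 _) := fun y => by
  rw [padRight_id]; rfl

theorem Rep.mul {T K : P.Tr} {w w' w'' : List Strand} {f : P.word w ⟶ P.word w'}
    {g : P.word w' ⟶ P.word w''} (h : Rep T w w' f) (h' : Rep K w' w'' g) :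
    Rep (T * K) w w'' (f ≫ g) := fun y => by
  rw [padRight_comp]
  exact Tr.mul_apply_of_some_some (h y) (h' y)

theorem Rep.append {T : P.Tr} {w w' : List Strand} {f : P.word w ⟶ P.word w'}
    (h : Rep T w w' f) (t : List Strand) :
    Rep T (w ++ t) (w' ++ t) (P.padRight w w' f t) := fun y => by
  rw [padRight_padRight]
  exact Tr.apply_cast (h (t ++ y)) _ _

theorem Rep.sft {T : P.Tr} {w w' : List Strand} {f : P.word w ⟶ P.word w'}
    (h : Rep T w w' f) (t : List Strand) :
    Rep (P.sft t.length T) (t ++ w) (t ++ w') (P.padLeft f t) := fun y => by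
  have := Tr.apply_cast (sft_append (h y) t) (List.append_assoc t w y)
      (List.append_assoc _ _ _).symm
  rw [this]
  refine some_congr ?_
  rw [padLeft_eq, padRight, padLeft_eq]
  simp only [padRight, comp_whiskerRight, whiskerLeft_comp, Category.assoc, P.wordAppend_assoc_inv]
  rw [reassoc_of% P.wordAppend_assoc]
  simp

theorem Rep.unique {T T' : P.Tr} {w w' w'' : List Strand} {f : P.word w ⟶ P.word w'}
    {g : P.word w ⟶ P.word w''} (h : Rep T w w' f) (h' : Rep T' w w'' g) (hT : T ≤ T') :
    (⟨w, w', f⟩ : P.Mor) = ⟨w, w'', g⟩ := by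
  have e := (hT _ _ (h [])).symm.trans (h' [])
  rw [Option.some.injEq, Sigma.mk.injEq, List.append_left_inj] at e
  obtain ⟨rfl, e⟩ := e
  rw [heq_eq_eq, padRight, padRight, cancel_epi, cancel_mono] at e
  rw [(MonoidalCategory.whiskerRight_iff f g).1 e]

theorem Rep.tensor {T K : P.Tr} {w₁ w₁' w₂ w₂' : List Strand} {f : P.word w₁ ⟶ P.word w₁'}
    {g : P.word w₂ ⟶ P.word w₂'} (h : Rep T w₁ w₁' f) (h' : Rep K w₂ w₂' g) :
    Rep (T * P.sft w₁'.length K) (w₁ ++ w₂) (w₁' ++ w₂')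
      ((P.wordAppend w₁ w₂).hom ≫ (f ⊗ₘ g) ≫ (P.wordAppend w₁' w₂').inv) := by
  convert (h.append w₂).mul (h'.sft w₁') using 1
  rw [padLeft_eq, padRight, MonoidalCategory.tensorHom_def]
  simp

end DualObjects
end

/-! ### The operation of a diagram represents its morphism -/

section
variable {C : Type u} [Category.{v} C] [MonoidalCategory C]

section Coherence
variable {X Y X' Y' : C}

theorem swap_coherence (f : X ⊗ Y ⟶ Y ⊗ X) (Z : C) :
    (α_ X Y Z).inv ≫ f ▷ Z ≫ (α_ Y X Z).hom =
      (X ◁ (Y ◁ (λ_ Z).inv ≫ (α_ Y (𝟙_ C) Z).inv) ≫ (α_ X (Y ⊗ 𝟙_ C) Z).inv) ≫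
        (X ◁ (ρ_ Y).hom ≫ f ≫ Y ◁ (ρ_ X).inv) ▷ Z ≫
        (α_ Y (X ⊗ 𝟙_ C) Z).hom ≫ Y ◁ ((α_ X (𝟙_ C) Z).hom ≫ X ◁ (λ_ Z).hom) := by
  monoidal

theorem cup_coherence (f : 𝟙_ C ⟶ X ⊗ Y) (Z : C) :
    (λ_ Z).inv ≫ f ▷ Z ≫ (α_ X Y Z).hom = (λ_ Z).inv ≫ (f ≫ X ◁ (ρ_ Y).inv) ▷ Z ≫
      (α_ X (Y ⊗ 𝟙_ C) Z).hom ≫ X ◁ ((α_ Y (𝟙_ C) Z).hom ≫ Y ◁ (λ_ Z).hom) := by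
  monoidal

theorem cap_coherence (f : X ⊗ Y ⟶ 𝟙_ C) (Z : C) :
    (α_ X Y Z).inv ≫ f ▷ Z ≫ (λ_ Z).hom =
      (X ◁ (Y ◁ (λ_ Z).inv ≫ (α_ Y (𝟙_ C) Z).inv) ≫ (α_ X (Y ⊗ 𝟙_ C) Z).inv) ≫
        (X ◁ (ρ_ Y).hom ≫ f) ▷ Z ≫ (λ_ Z).hom := by
  monoidal

theorem comul_coherence (f : X ⟶ X ⊗ Y ⊗ X) (Z : C) :
    f ▷ Z ≫ (α_ X (Y ⊗ X) Z).hom ≫ X ◁ (α_ Y X Z).hom =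
      (X ◁ (λ_ Z).inv ≫ (α_ X (𝟙_ C) Z).inv) ≫
        ((ρ_ X).hom ≫ f ≫ X ◁ Y ◁ (ρ_ X).inv) ▷ Z ≫
        (α_ X (Y ⊗ X ⊗ 𝟙_ C) Z).hom ≫ X ◁ ((α_ Y (X ⊗ 𝟙_ C) Z).hom ≫
          Y ◁ ((α_ X (𝟙_ C) Z).hom ≫ X ◁ (λ_ Z).hom)) := by
  monoidal

theorem mul_coherence (f : X ⊗ Y ⊗ X ⟶ X) (Z : C) :
    X ◁ (α_ Y X Z).inv ≫ (α_ X (Y ⊗ X) Z).inv ≫ f ▷ Z =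
      (X ◁ (Y ◁ (X ◁ (λ_ Z).inv ≫ (α_ X (𝟙_ C) Z).inv) ≫ (α_ Y (X ⊗ 𝟙_ C) Z).inv) ≫
          (α_ X (Y ⊗ X ⊗ 𝟙_ C) Z).inv) ≫
        (X ◁ Y ◁ (ρ_ X).hom ≫ f ≫ (ρ_ X).inv) ▷ Z ≫ (α_ X (𝟙_ C) Z).hom ≫ X ◁ (λ_ Z).hom := by
  monoidal

theorem loop_coherence (f : X ⟶ X) (Z : C) :
    f ▷ Z = (X ◁ (λ_ Z).inv ≫ (α_ X (𝟙_ C) Z).inv) ≫ ((ρ_ X).hom ≫ f ≫ (ρ_ X).inv) ▷ Z ≫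
      (α_ X (𝟙_ C) Z).hom ≫ X ◁ (λ_ Z).hom := by
  monoidal

end Coherence

namespace DualObjects
variable (P : DualObjects C)

/-- The first two wires are exchanged by means of `σ`. -/
def sw (σ : ∀ a b : Strand, P.ob a ⊗ P.ob b ⟶ P.ob b ⊗ P.ob a) : P.Tr
  | a :: b :: w => some ⟨b :: a :: w,
      (α_ (P.ob a) (P.ob b) (P.word w)).inv ≫ σ a b ▷ P.word w ≫ (α_ _ _ _).hom⟩
  | _ => none

theorem rep_sw (σ : ∀ a b : Strand, P.ob a ⊗ P.ob b ⟶ P.ob b ⊗ P.ob a) (a b : Strand) :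
    Rep (P.sw σ) [a, b] [b, a]
      (P.ob a ◁ (ρ_ (P.ob b)).hom ≫ σ a b ≫ P.ob b ◁ (ρ_ (P.ob a)).inv) := fun y => by
  refine some_congr ?_
  exact swap_coherence _ _

end DualObjects

namespace FrobeniusThreeStructure
variable (S : FrobeniusThreeStructure C)
open DualObjects DualObjects.Tr

/-- The four-legged vertex of a Frobenius 3-structure. -/
abbrev vertex : NestedVertex S.A S.Ad := S.nestedMul.toNestedVertex

theorem gr_up (w : List Strand) :
    S.vertex.gr (.up :: w) = some ⟨.up :: .down :: .up :: w, S.comulAct (S.word w)⟩ :=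
  some_congr (P := S.toDualObjects) (w := .up :: w) (w' := .up :: .down :: .up :: w)
    (S.nestedMul_g (S.word w))

theorem mu_up (w : List Strand) :
    S.vertex.mu (.up :: .down :: .up :: w) = some ⟨.up :: w, S.mulAct (S.word w)⟩ :=
  (mul_apply_of_some_some (mul_apply_of_some_some rfl rfl) rfl).trans
    (some_congr (P := S.toDualObjects) (w := .up :: .down :: .up :: w) (w' := .up :: w)
      ((Category.assoc _ _ _).trans (S.nestedMul.m_eq (S.word w)).symm))

theorem lf_up (w : List Strand) :
    S.vertex.lf (.up :: w) = some ⟨.up :: w, S.leftLoop ▷ S.word w⟩ :=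
  some_congr (P := S.toDualObjects) (w := .up :: w) (w' := .up :: w)
    ((S.nestedMul.wA_eq (S.word w)).trans (S.nestedMul_left (S.word w)))

theorem rt_up (w : List Strand) :
    S.vertex.rt (.up :: w) = some ⟨.up :: w, S.rightLoop ▷ S.word w⟩ :=
  some_congr (P := S.toDualObjects) (w := .up :: w) (w' := .up :: w)
    ((S.nestedMul.bA_eq (S.word w)).trans (S.nestedMul_right (S.word w)))

theorem rep_cu_up : Rep (S.vertex.cu .up) [] [.up, .down] (S.cupSwap ≫ S.A ◁ (ρ_ S.Ad).inv) :=
  fun y => by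
    refine some_congr (P := S.toDualObjects) (w := [] ++ y) (w' := [.up, .down] ++ y) ?_
    exact cup_coherence _ _

theorem rep_cu_down : Rep (S.vertex.cu .down) [] [.down, .up] (S.cup ≫ S.Ad ◁ (ρ_ S.A).inv) :=
  fun y => by
    refine some_congr (P := S.toDualObjects) (w := [] ++ y) (w' := [.down, .up] ++ y) ?_
    exact cup_coherence _ _

theorem rep_ca_up : Rep S.vertex.ca [.up, .down] [] (S.A ◁ (ρ_ S.Ad).hom ≫ S.cap) :=
  fun y => by
    refine some_congr (P := S.toDualObjects) (w := [.up, .down] ++ y) (w' := [] ++ y) ?_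
    exact cap_coherence _ _

theorem rep_ca_down : Rep S.vertex.ca [.down, .up] [] (S.Ad ◁ (ρ_ S.A).hom ≫ S.capSwap) :=
  fun y => by
    refine some_congr (P := S.toDualObjects) (w := [.down, .up] ++ y) (w' := [] ++ y) ?_
    exact cap_coherence _ _

theorem rep_gr : Rep S.vertex.gr [.up] [.up, .down, .up]
    ((ρ_ S.A).hom ≫ S.comul ≫ S.A ◁ S.Ad ◁ (ρ_ S.A).inv) := fun y => by
  refine (S.gr_up y).trans (some_congr (P := S.toDualObjects) (w := [.up] ++ y)
      (w' := [.up, .down, .up] ++ y) ?_)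
  exact comul_coherence _ _

theorem rep_mu : Rep S.vertex.mu [.up, .down, .up] [.up]
    (S.A ◁ S.Ad ◁ (ρ_ S.A).hom ≫ S.mul ≫ (ρ_ S.A).inv) := fun y => by
  refine (S.mu_up y).trans (some_congr (P := S.toDualObjects) (w := [.up, .down, .up] ++ y)
      (w' := [.up] ++ y) ?_)
  exact mul_coherence _ _

theorem rep_lf : Rep S.vertex.lf [.up] [.up] ((ρ_ S.A).hom ≫ S.leftLoop ≫ (ρ_ S.A).inv) :=
  fun y => by
    refine (S.lf_up y).trans (some_congr (P := S.toDualObjects) (w := [.up] ++ y) (w' := [.up] ++ y)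
        ?_)
    exact loop_coherence _ _

theorem rep_rt : Rep S.vertex.rt [.up] [.up] ((ρ_ S.A).hom ≫ S.rightLoop ≫ (ρ_ S.A).inv) :=
  fun y => by
    refine (S.rt_up y).trans (some_congr (P := S.toDualObjects) (w := [.up] ++ y) (w' := [.up] ++ y)
        ?_)
    exact loop_coherence _ _

/-- The operation of a diagram represents the morphism denoted by the diagram. -/
theorem rep_act {k : Flavour}
    (σ : k = .commutative → (a b : Strand) → (S.ob a ⊗ S.ob b ⟶ S.ob b ⊗ S.ob a))
    {w w' : List Strand} (d : Diagram k w w') :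
    Rep (S.vertex.act (fun h => S.sw (σ h)) d) w w' (S.evalWith σ d) := by
  induction d with
  | piece x =>
    cases x with
    | mul => exact S.rep_mu
    | comul => exact S.rep_gr
    | cup => exact S.rep_cu_down
    | cupSwap => exact S.rep_cu_up
    | cap => exact S.rep_ca_up
    | capSwap => exact S.rep_ca_down
    | swap a b => exact rep_sw S.toDualObjects (σ rfl) a b
  | ident w => exact Rep.one w
  | comp d e ihd ihe => exact ihd.mul ihe
  | tensor d e ihd ihe => exact ihd.tensor ihe

end FrobeniusThreeStructure
end

/-! ### Bending -/

section
variable {C : Type u} [Category.{v} C]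

theorem comp_assoc₄ {V W X Y Z : C} (a : V ⟶ W) (b : W ⟶ X) (c : X ⟶ Y) (d : Y ⟶ Z) :
    a ≫ b ≫ c ≫ d = (a ≫ b ≫ c) ≫ d := by
  simp

theorem comp_chain {U V W X Y Z : C} (a : U ⟶ V) (b : V ⟶ W) (c : W ⟶ X) (d : X ⟶ Y) (e : Y ⟶ Z) :
    (a ≫ b ≫ c ≫ d) ≫ e = (a ≫ b ≫ c) ≫ d ≫ e := by
  simp

theorem conj_iter_id {X Y : C} (r : X ≅ Y) : r.hom ≫ 𝟙 Y ≫ r.inv = 𝟙 X := by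
  simp

theorem conj_comp {X Y : C} (r : X ≅ Y) (f g : Y ⟶ Y) :
    r.hom ≫ (f ≫ g) ≫ r.inv = (r.hom ≫ f ≫ r.inv) ≫ r.hom ≫ g ≫ r.inv := by
  simp

theorem conj_chain {W X Y Z : C} (r : X ≅ Y) (a : W ⟶ Y) (f g : Y ⟶ Y) (b : Y ⟶ Z) :
    a ≫ f ≫ g ≫ b =
      (a ≫ r.inv) ≫ ((r.hom ≫ f ≫ r.inv) ≫ r.hom ≫ g ≫ r.inv) ≫ r.hom ≫ b := by
  simp

variable [MonoidalCategory C]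

theorem Strand.flip_flip (s : Strand) : s.flip.flip = s := by cases s <;> rfl

theorem rightUnitor_coherence {X Y W : C} (e : Y ⟶ W ⊗ 𝟙_ C) :
    X ◁ (e ≫ (ρ_ W).hom) = (X ◁ e ≫ (α_ X W (𝟙_ C)).inv) ≫ (ρ_ (X ⊗ W)).hom := by
  simp

theorem rightUnitor_cancel {W Z : C} (e : Z ≅ W ⊗ 𝟙_ C) :
    𝟙 W = ((ρ_ W).inv ≫ e.inv) ≫ e.hom ≫ (ρ_ W).hom := by
  simp

theorem bendInRight_coherence {W X Y W₂ W' Z₀ Z₁ Z₂ Z₃ : C} (c : 𝟙_ C ⟶ X ⊗ Y)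
    (e₀ : Z₀ ≅ W ⊗ 𝟙_ C) (e₁ : Z₁ ≅ W ⊗ X ⊗ Y ⊗ 𝟙_ C) (e₂ : Z₂ ≅ W₂ ⊗ Y ⊗ 𝟙_ C)
    (es : W₂ ≅ W ⊗ X ⊗ 𝟙_ C) (k : Z₁ ⟶ Z₂)
    (hk : k ≫ e₂.hom = e₁.hom ≫
      W ◁ (X ◁ (λ_ (Y ⊗ 𝟙_ C)).inv ≫ (α_ X (𝟙_ C) (Y ⊗ 𝟙_ C)).inv) ≫ (α_ _ _ _).inv ≫
        es.inv ▷ (Y ⊗ 𝟙_ C)) (f : W₂ ⟶ W') (e₃ : Z₃ ≅ W' ⊗ Y ⊗ 𝟙_ C) :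
    (ρ_ W).inv ≫ W ◁ c ≫ (α_ W X Y).inv ≫ ((W ◁ (ρ_ X).inv ≫ es.inv) ≫ f) ▷ Y ≫
        W' ◁ (ρ_ Y).inv ≫ e₃.inv =
      (((ρ_ W).inv ≫ e₀.inv) ≫ (e₀.hom ≫ W ◁ (c ≫ X ◁ (ρ_ Y).inv) ≫ e₁.inv) ≫ k) ≫
        e₂.hom ≫ f ▷ (Y ⊗ 𝟙_ C) ≫ e₃.inv := by
  simp only [Category.assoc, reassoc_of% hk, Iso.inv_hom_id_assoc]
  monoidal

theorem bendOutRight_coherence {W X Y W₂ W' Z₀ Z₁ Z₂ Z₃ : C} (c : X ⊗ Y ⟶ 𝟙_ C)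
    (e₀ : Z₀ ≅ W ⊗ 𝟙_ C) (e₁ : Z₁ ≅ W ⊗ X ⊗ Y ⊗ 𝟙_ C) (e₂ : Z₂ ≅ W₂ ⊗ Y ⊗ 𝟙_ C)
    (es : W₂ ≅ W ⊗ X ⊗ 𝟙_ C) (k : Z₂ ⟶ Z₁)
    (hk : e₂.inv ≫ k = es.hom ▷ (Y ⊗ 𝟙_ C) ≫ (α_ _ _ _).hom ≫
      W ◁ ((α_ X (𝟙_ C) (Y ⊗ 𝟙_ C)).hom ≫ X ◁ (λ_ (Y ⊗ 𝟙_ C)).hom) ≫ e₁.inv)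
    (f : W' ⟶ W₂) (e₃ : Z₃ ≅ W' ⊗ Y ⊗ 𝟙_ C) :
    (e₃.hom ≫ W' ◁ (ρ_ Y).hom) ≫ (f ≫ es.hom ≫ W ◁ (ρ_ X).hom) ▷ Y ≫ (α_ W X Y).hom ≫
        W ◁ c ≫ (ρ_ W).hom =
      (e₃.hom ≫ f ▷ (Y ⊗ 𝟙_ C) ≫ e₂.inv) ≫ k ≫
        (e₁.hom ≫ W ◁ (X ◁ (ρ_ Y).hom ≫ c) ≫ e₀.inv) ≫ e₀.hom ≫ (ρ_ W).hom := by
  simp only [Category.assoc, reassoc_of% hk, Iso.inv_hom_id_assoc]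
  monoidal

namespace DualObjects
variable {P : DualObjects C}

theorem Rep.head {T : P.Tr} {l l' : List Strand} {f : P.word l ⟶ P.word l'} (h : Rep T l l' f)
    {w : List Strand} {g : P.word (l ++ w) ⟶ P.word (l' ++ w)}
    (hg : T (l ++ w) = some ⟨l' ++ w, g⟩) : Rep T (l ++ w) (l' ++ w) g := by
  have e := hg.symm.trans (h w)
  rw [Option.some.injEq, Sigma.mk.injEq, heq_eq_eq] at e
  rw [e.2]
  exact h.append w

theorem Rep.congr {T : P.Tr} {w w' : List Strand} {f g : P.word w ⟶ P.word w'}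
    (h : Rep T w w' f) (e : f = g) : Rep T w w' g := e ▸ h

theorem Rep.cast {T : P.Tr} {w w' x x' : List Strand} {f : P.word w ⟶ P.word w'}
    (h : Rep T w w' f) (hx : x = w) (hx' : w' = x') :
    Rep T x x' (P.wordCast hx ≫ f ≫ P.wordCast hx') := by
  subst hx hx'
  rwa [wordCast_rfl, wordCast_rfl, Category.id_comp, Category.comp_id]

instance isIso_wordCast {w w' : List Strand} (h : w = w') : IsIso (P.wordCast h) := by
  unfold wordCast
  infer_instance

theorem wordCast_append_nil (w : List Strand) :
    P.wordCast (List.append_nil w) = (P.wordAppend w []).hom ≫ (ρ_ (P.word w)).hom := by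
  induction w with
  | nil =>
    change 𝟙 _ = (λ_ (𝟙_ C)).inv ≫ (ρ_ (𝟙_ C)).hom
    rw [← unitors_equal, Iso.inv_hom_id]
  | cons s w ih =>
    have e : P.wordCast (List.append_nil (s :: w)) = P.ob s ◁ P.wordCast (List.append_nil w) :=
      (P.whiskerLeft_wordCast _ _).symm
    rw [e, ih]
    exact rightUnitor_coherence _

theorem wordCast_append_nil_symm (w : List Strand) :
    P.wordCast (List.append_nil w).symm = (ρ_ (P.word w)).inv ≫ (P.wordAppend w []).inv := by
  have e : P.wordCast (List.append_nil w).symm ≫ P.wordCast (List.append_nil w) = 𝟙 _ := by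
    simp [wordCast]
  rw [← cancel_mono (P.wordCast (List.append_nil w)), e, wordCast_append_nil]
  exact rightUnitor_cancel _

theorem Rep.bendInRight {T K : P.Tr} {s : Strand} {w w' : List Strand}
    {f : P.word (w ++ [s]) ⟶ P.word w'} (h : Rep T (w ++ [s]) w' f)
    (hK : Rep K [] [s, s.flip] (P.cupAt s ≫ P.ob s ◁ (ρ_ (P.ob s.flip)).inv)) :
    Rep (P.sft w.length K * T) w (w' ++ [s.flip]) (P.bendInRight s w w' f) := by
  convert ((hK.sft w).cast (List.append_nil w).symm
    (List.append_assoc w [s] [s.flip]).symm).mul (h.append [s.flip]) using 1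
  rw [wordCast_append_nil_symm, padLeft_eq, padRight]
  have h1 : P.wordCast (List.append_assoc w [s] [s.flip]).symm ≫
      (P.wordAppend (w ++ [s]) [s.flip]).hom =
      (P.wordAppend w [s, s.flip]).hom ≫ P.word w ◁ (P.wordAppend [s] [s.flip]).hom ≫
        (α_ _ _ _).inv ≫ (P.wordAppend w [s]).inv ▷ P.word [s.flip] := by
    have e : P.wordCast (List.append_assoc w [s] [s.flip]).symm ≫
      P.wordCast (List.append_assoc w [s] [s.flip]) = 𝟙 _ := by simp [wordCast]
    rw [← cancel_mono ((P.wordAppend w [s]).hom ▷ P.word [s.flip])]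
    simp only [Category.assoc, P.wordAppend_assoc, reassoc_of% e]
    simp [← comp_whiskerRight]
  exact bendInRight_coherence (P.cupAt s) (P.wordAppend w []) (P.wordAppend w [s, s.flip])
    (P.wordAppend (w ++ [s]) [s.flip]) (P.wordAppend w [s]) _ h1 f (P.wordAppend w' [s.flip])

theorem Rep.bendOutRight {T K : P.Tr} {s : Strand} {w w' : List Strand}
    {f : P.word w ⟶ P.word (w' ++ [s])} (h : Rep T w (w' ++ [s]) f)
    (hK : Rep K [s, s.flip] [] (P.ob s ◁ (ρ_ (P.ob s.flip)).hom ≫ P.capAt s)) :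
    Rep (T * P.sft w'.length K) (w ++ [s.flip]) w' (P.bendOutRight s w w' f) := by
  convert (h.append [s.flip]).mul ((hK.sft w').cast (List.append_assoc w' [s] [s.flip])
    (List.append_nil w')) using 1
  rw [wordCast_append_nil, padLeft_eq, padRight]
  have h1 : (P.wordAppend (w' ++ [s]) [s.flip]).inv ≫
      P.wordCast (List.append_assoc w' [s] [s.flip]) =
      (P.wordAppend w' [s]).hom ▷ P.word [s.flip] ≫ (α_ _ _ _).hom ≫
        P.word w' ◁ (P.wordAppend [s] [s.flip]).inv ≫ (P.wordAppend w' [s, s.flip]).inv := by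
    have e : P.wordCast (List.append_assoc w' [s] [s.flip]).symm ≫
      P.wordCast (List.append_assoc w' [s] [s.flip]) = 𝟙 _ := by simp [wordCast]
    rw [← cancel_epi ((P.wordAppend w' [s]).inv ▷ P.word [s.flip])]
    rw [reassoc_of% P.wordAppend_assoc_inv, e]
    simp [← comp_whiskerRight_assoc]
  refine Eq.trans ?_ ((bendOutRight_coherence (P.capAt s) (P.wordAppend w' [])
    (P.wordAppend w' [s, s.flip]) (P.wordAppend (w' ++ [s]) [s.flip]) (P.wordAppend w' [s]) _ h1 f
    (P.wordAppend w [s.flip])).trans ?_)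
  · rfl
  · simp only [Category.assoc]
    rfl

end DualObjects

namespace FrobeniusThreeStructure
variable (S : FrobeniusThreeStructure C)
open DualObjects DualObjects.Tr

theorem rep_cu (s : Strand) : Rep (S.vertex.cu s) [] [s, s.flip]
    (S.cupAt s ≫ S.ob s ◁ (ρ_ (S.ob s.flip)).inv) := by
  cases s
  exacts [S.rep_cu_up, S.rep_cu_down]

theorem rep_ca (s : Strand) : Rep S.vertex.ca [s, s.flip] []
    (S.ob s ◁ (ρ_ (S.ob s.flip)).hom ≫ S.capAt s) := by
  cases s
  exacts [S.rep_ca_up, S.rep_ca_down]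

variable {S}

theorem rep_bendInLeft {T : S.Tr} {s : Strand} {w w' : List Strand}
    {f : S.word (s :: w) ⟶ S.word w'} (h : Rep T (s :: w) w' f) :
    Rep (S.vertex.cu s.flip * S.sh T) w (s.flip :: w') (S.bendInLeft s w w' f) := by
  cases s
  · exact Rep.congr (P := S.toDualObjects) (w := w) (w' := .down :: w')
      (((S.rep_cu .down).head (w := w) rfl).mul (h.sft [.down]))
      (comp_assoc₄ (C := C) _ _ _ _).symm
  · exact Rep.congr (P := S.toDualObjects) (w := w) (w' := .up :: w')
      (((S.rep_cu .up).head (w := w) rfl).mul (h.sft [.up]))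
      (comp_assoc₄ (C := C) _ _ _ _).symm

variable (S)

theorem rep_mu_pow (p : ℕ) :
    Rep (S.vertex.mu ^ p) (oddWord p) [.up] (S.mulChain p ≫ (ρ_ S.A).inv) := by
  induction p with
  | zero =>
    exact Rep.congr (P := S.toDualObjects) (w := [.up]) (w' := [.up]) (Rep.one [.up])
      (Iso.hom_inv_id (C := C) _).symm
  | succ p ih =>
    rw [pow_succ']
    refine Rep.congr (P := S.toDualObjects) (w := oddWord (p + 1)) (w' := [.up])
      ((S.rep_mu.head (S.mu_up (tailWord p))).mul ih) ?_
    exact (comp_chain (C := C) _ _ _ _ _).symm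

theorem rep_lf_pow (m : ℕ) :
    Rep (S.vertex.lf ^ m) [.up] [.up] ((ρ_ S.A).hom ≫ iter S.leftLoop m ≫ (ρ_ S.A).inv) := by
  induction m with
  | zero =>
    exact Rep.congr (P := S.toDualObjects) (w := [.up]) (w' := [.up]) (Rep.one [.up])
      (conj_iter_id (C := C) _).symm
  | succ m ih =>
    rw [pow_succ]
    exact Rep.congr (P := S.toDualObjects) (w := [.up]) (w' := [.up]) (ih.mul S.rep_lf)
      (conj_comp (C := C) _ _ _).symm

theorem rep_rt_pow (m : ℕ) :
    Rep (S.vertex.rt ^ m) [.up] [.up] ((ρ_ S.A).hom ≫ iter S.rightLoop m ≫ (ρ_ S.A).inv) := by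
  induction m with
  | zero =>
    exact Rep.congr (P := S.toDualObjects) (w := [.up]) (w' := [.up]) (Rep.one [.up])
      (conj_iter_id (C := C) _).symm
  | succ m ih =>
    rw [pow_succ]
    exact Rep.congr (P := S.toDualObjects) (w := [.up]) (w' := [.up]) (ih.mul S.rep_rt)
      (conj_comp (C := C) _ _ _).symm

theorem rep_gr_pow (q : ℕ) :
    Rep (S.vertex.gr ^ q) [.up] (oddWord q) ((ρ_ S.A).hom ≫ S.comulChain q) := by
  induction q with
  | zero =>
    exact Rep.congr (P := S.toDualObjects) (w := [.up]) (w' := [.up]) (Rep.one [.up])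
      (Iso.hom_inv_id (C := C) _).symm
  | succ q ih =>
    rw [pow_succ]
    exact Rep.congr (P := S.toDualObjects) (w := [.up]) (w' := oddWord (q + 1))
      (ih.mul (S.rep_gr.head (S.gr_up (tailWord q)))) (Category.assoc (obj := C) _ _ _)

theorem rep_normalForm (p q m n : ℕ) :
    Rep (S.vertex.mu ^ p * S.vertex.stalk q m n) (oddWord p) (oddWord q)
      (S.normalForm p q m n).hom := by
  exact Rep.congr (P := S.toDualObjects) (w := oddWord p) (w' := oddWord q)
    ((S.rep_mu_pow p).mul (((S.rep_lf_pow m).mul (S.rep_rt_pow n)).mul (S.rep_gr_pow q)))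
    (conj_chain (C := C) _ _ _ _ _).symm

end FrobeniusThreeStructure
end

/-! ### States and normal forms -/

section
variable {C : Type u} [Category.{v} C] [MonoidalCategory C]

/-- The outputs that arise when all wires of a word are bent around the left side. -/
def Strand.turn : List Strand → List Strand
  | [] => []
  | s :: w => turn w ++ [s.flip]

theorem Strand.length_turn (w : List Strand) : (turn w).length = w.length := by
  induction w with
  | nil => rfl
  | cons s w ih => simp [turn, ih]

theorem Strand.turn_append_singleton (w : List Strand) (a : Strand) :
    turn (w ++ [a]) = a.flip :: turn w := by
  induction w with
  | nil => rfl
  | cons s w ih => rw [List.cons_append, turn, ih, turn, List.cons_append]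

theorem Strand.flip_injective : Function.Injective Strand.flip :=
  Function.LeftInverse.injective Strand.flip_flip

theorem Strand.turn_injective : Function.Injective turn := by
  intro w
  induction w with
  | nil =>
    intro w' h
    cases w' with
    | nil => rfl
    | cons s w' => simp [turn] at h
  | cons s w ih =>
    intro w' h
    cases w' with
    | nil => simp [turn] at h
    | cons s' w' =>
      rw [turn, turn] at h
      have h' := List.append_inj' h rfl
      rw [ih h'.1, Strand.flip_injective (List.singleton_inj.1 h'.2)]

/-- The alternating word of length `n` with first letter `s`. -/
def Strand.alternating : Strand → ℕ → List Strand
  | _, 0 => []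
  | s, n + 1 => s :: alternating s.flip n

namespace NestedVertex
variable {P : DualObjects C} (V : NestedVertex P.A P.Ad)
open DualObjects DualObjects.Tr

/-- Nested cups creating all wires of a word, together with the wires they are bent to. -/
def nest : List Strand → P.Tr
  | [] => 1
  | s :: w => nest w * P.sft w.length (V.cu s.flip)

/-- Nested caps on `2 n` wires. -/
def caps : ℕ → P.Tr
  | 0 => 1
  | n + 1 => P.sh (caps n) * V.ca

/-- The operation `T` with all inputs bent around the left side. -/
def state (T : P.Tr) (w : List Strand) : P.Tr := V.nest w * P.sft w.length T

theorem mul_nest (T : P.Tr) (w : List Strand) :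
    T * V.nest w = V.nest w * P.sft (w.length + w.length) T := by
  induction w with
  | nil => simp [nest]
  | cons s w ih =>
    rw [nest, ← mul_assoc, ih, mul_assoc, sft_add, ← map_mul, mul_cu, map_mul, mul_assoc,
      List.length_cons, show w.length + 1 + (w.length + 1) = w.length + (w.length + 2) by omega,
      sft_add, show w.length + 2 = 1 + 1 + w.length by omega, sft_add, sft_add]
    rfl

theorem nest_append_singleton (w : List Strand) (a : Strand) :
    V.nest (w ++ [a]) = V.cu a.flip * P.sh (V.nest w) := by
  induction w with
  | nil => simp [nest]
  | cons s w ih =>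
    rw [List.cons_append, nest, ih, nest, map_mul, mul_assoc, List.length_append]
    rfl

theorem sft_mul_caps (T : P.Tr) (n : ℕ) : P.sft (n + n) T * V.caps n = V.caps n * T := by
  induction n generalizing T with
  | zero => simp [caps]
  | succ n ih =>
    rw [caps, ← mul_assoc, show n + 1 + (n + 1) = 1 + (n + n) + 1 by omega, sft_succ', sft_add,
      show P.sft 1 (P.sft (n + n) (P.sh T)) = P.sh (P.sft (n + n) (P.sh T)) from rfl,
      ← map_mul, ih, map_mul, mul_assoc, mul_ca, mul_assoc]

theorem state_nil (T : P.Tr) : V.state T [] = T := one_mul T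

theorem state_cons (T : P.Tr) (s : Strand) (w : List Strand) :
    V.state T (s :: w) = V.state (V.cu s.flip * P.sh T) w := by
  rw [state, state, nest, map_mul, mul_assoc, ← sft_succ']
  rfl

theorem state_append_singleton (T : P.Tr) (w : List Strand) (a : Strand) :
    V.state T (w ++ [a]) = V.cu a.flip * P.sh (V.state T w) := by
  rw [state, nest_append_singleton, state, map_mul, mul_assoc, List.length_append]
  rfl

theorem snake_apply (s : Strand) (y : List Strand) :
    (P.sh (V.cu s.flip) * V.ca) (s :: y) = some ⟨s :: y, 𝟙 _⟩ := by
  cases s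
  · exact (mul_apply_of_some_some rfl rfl).trans (some_congr (V.snake₁ _))
  · exact (mul_apply_of_some_some rfl rfl).trans (some_congr (V.snake₃ _))

theorem rep_snake (s : Strand) (w : List Strand) :
    Rep (P.sh (V.cu s.flip) * V.ca) (s :: w) (s :: w) (𝟙 _) := fun y => by
  rw [padRight_id]
  exact V.snake_apply s (w ++ y)

theorem rep_nest_mul_caps (w : List Strand) :
    Rep (P.sft w.length (V.nest w) * V.caps w.length) w w (𝟙 _) := by
  induction w with
  | nil =>
    simp only [nest, map_one, List.length_nil, caps, mul_one]
    exact Rep.one []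
  | cons s w ih =>
    have e : P.sft (s :: w).length (V.nest (s :: w)) * V.caps (s :: w).length =
        P.sh (P.sft w.length (V.nest w) * V.caps w.length) * (P.sh (V.cu s.flip) * V.ca) := by
      rw [List.length_cons, nest, sft_succ, caps, ← mul_assoc, ← mul_assoc, ← map_mul, ← map_mul,
        map_mul (P.sft w.length), ← sft_add, mul_assoc, sft_mul_caps, mul_assoc]
    rw [e]
    refine (((ih.sft [s]).congr ?_).mul (V.rep_snake s w)).congr (Category.id_comp _)
    exact whiskerLeft_id (C := C) _ _

/-- Bending the inputs back recovers the morphism. -/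
theorem rep_state_mul_caps {T : P.Tr} {w w' : List Strand} {f : P.word w ⟶ P.word w'}
    (h : Rep T w w' f) : Rep (P.sft w.length (V.state T w) * V.caps w.length) w w' f := by
  rw [state, map_mul, mul_assoc, ← sft_add, sft_mul_caps, ← mul_assoc]
  exact ((V.rep_nest_mul_caps w).mul h).congr (Category.id_comp _)

theorem cu_mul_snake (s : Strand) : V.cu s * (P.sh (V.cu s.flip) * V.ca) = V.cu s := by
  ext1 y
  cases s
  · refine (mul_apply_of_some_some (T := V.cu .up) (w := y) rfl
      (V.snake_apply .up (.down :: y))).trans ?_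
    exact some_congr (P := P) (w := y) (w' := .up :: .down :: y) (Category.comp_id _)
  · refine (mul_apply_of_some_some (T := V.cu .down) (w := y) rfl
      (V.snake_apply .down (.up :: y))).trans ?_
    exact some_congr (P := P) (w := y) (w' := .down :: .up :: y) (Category.comp_id _)

theorem state_bendInRight_eq (T : P.Tr) (w : List Strand) (a : Strand) :
    V.state (P.sft w.length (V.cu a) * T) w = V.cu a * V.state T w := by
  rw [state, state, ← mul_assoc, mul_nest, map_mul, sft_add, mul_assoc]

theorem state_bendInRight_le (hV : NestedSliding V) {T : P.Tr} {w : List Strand} {a s : Strand}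
    {k m n : ℕ} (h : V.state T (w ++ [a]) ≤ V.spider s k m n) :
    V.state (P.sft w.length (V.cu a) * T) w ≤ V.spider a k n m := by
  rw [state_append_singleton] at h
  rw [state_bendInRight_eq, ← cu_mul_snake, mul_assoc, mul_assoc, ← mul_ca, ← mul_assoc (P.sh _),
    ← map_mul]
  refine mul_le_mul le_rfl (le_trans (mul_le_mul (sh_mono h) le_rfl) ?_)
  exact sh_spider_mul_ca_le hV s k m n

theorem state_bendOutRight_le (hV : NestedSliding V) {T : P.Tr} {w : List Strand} {t s : Strand}
    {k l m n : ℕ} (h : V.state T w ≤ V.spider t k m n) (hl : w.length + l = 2 * k + 1) :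
    V.state (T * P.sft l V.ca) (w ++ [s.flip]) ≤ V.spider s k n m := by
  rw [state_append_singleton, Strand.flip_flip, spider_eq_cu_mul_sh hV]
  refine mul_le_mul le_rfl (sh_mono ?_)
  rw [state, map_mul, ← mul_assoc, ← sft_add, hl]
  exact le_trans (mul_le_mul h le_rfl) (V.spider_mul_ca_le t k m n)

theorem cu_mul_cu_mul_mu_le :
    V.cu .up * P.sh (V.cu .down * P.sh V.mu) ≤ V.gr := by
  have e : ∀ s, V.spider s 1 0 0 = V.cu s * V.gr := fun s => by simp [spider, stalk]
  have e' : V.stalk 1 0 0 = V.gr := by simp [stalk]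
  have h1 : V.cu .down * P.sh (V.gr * P.sft 2 V.ca) ≤ V.gr := by
    rw [map_mul, ← mul_assoc, cu_gr, ← e, ← e']
    exact V.spider_mul_ca_le .down 1 0 0
  have h2 : V.cu .up * P.sh V.gr * P.sft 3 V.ca ≤ V.gr := by
    rw [cu_gr, ← e, ← e']
    exact V.spider_mul_ca_le .up 1 0 0
  refine le_trans (le_of_eq ?_) (le_trans (mul_le_mul (mul_le_mul le_rfl (sh_mono h1))
    (le_refl (P.sft 3 V.ca))) h2)
  rw [mu, map_mul P.sh (V.gr * P.sft 2 V.ca), ← mul_assoc (V.cu .down), map_mul P.sh (_ * _),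
    ← mul_assoc]
  rfl

theorem length_tailWord (p : ℕ) : (FrobeniusThreeStructure.tailWord p).length = 2 * p := by
  induction p with
  | zero => rfl
  | succ p ih =>
    rw [FrobeniusThreeStructure.tailWord, List.length_cons, List.length_cons, ih]
    omega

/-- The normal form with all inputs bent is a spider. -/
theorem state_normalForm_le (hV : NestedSliding V) (p q m n : ℕ) :
    V.state (V.mu ^ p * V.stalk q m n) (FrobeniusThreeStructure.oddWord p) ≤
      V.spider .down (p + q) n m := by
  induction p with
  | zero =>
    rw [pow_zero, one_mul, zero_add, spider_eq_cu_mul_sh hV]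
    exact le_of_eq ((V.state_cons _ .up []).trans (V.state_nil _))
  | succ p ih =>
    set Y := V.mu ^ p * V.stalk q m n with hY
    have e : V.cu .down * P.sh (V.cu .up * P.sh (V.cu .down * P.sh (V.mu * Y))) =
        V.cu .down * P.sh (V.cu .up * P.sh (V.cu .down * P.sh V.mu)) * P.sft 3 Y := by
      rw [map_mul P.sh V.mu, ← mul_assoc (V.cu .down), map_mul P.sh _ (P.sh Y),
        ← mul_assoc (V.cu .up), map_mul P.sh _ (P.sh (P.sh Y)), mul_assoc]
      rfl
    have e' : V.cu .down * P.sh V.gr * P.sft 3 Y = V.cu .down * P.sh Y * V.gr := by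
      rw [cu_gr, mul_assoc, mul_assoc, mul_gr]
      rfl
    change V.state _ (.up :: .down :: .up :: FrobeniusThreeStructure.tailWord p) ≤ _
    rw [state_cons, state_cons, state_cons, pow_succ', mul_assoc, ← hY]
    change V.nest (FrobeniusThreeStructure.tailWord p) * P.sft _ (V.cu .down * P.sh
      (V.cu .up * P.sh (V.cu .down * P.sh (V.mu * Y)))) ≤ _
    rw [e]
    refine le_trans (mul_le_mul le_rfl (sft_mono _ (mul_le_mul (mul_le_mul le_rfl
      (sh_mono V.cu_mul_cu_mul_mu_le)) le_rfl))) ?_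
    rw [e', map_mul, ← mul_assoc]
    refine le_trans (mul_le_mul (K' := P.sft _ V.gr)
        (le_trans (le_of_eq (V.state_cons Y .up _).symm) ih)
      le_rfl) (le_of_eq ?_)
    rw [spider_mul_gr hV _ _ _ _ _ (by rw [length_tailWord]; omega)]
    congr 1
    omega

theorem lf_apply (s : Strand) (z : List Strand) : ∃ f, V.lf (s :: z) = some ⟨s :: z, f⟩ := by
  cases s <;> exact ⟨_, rfl⟩

theorem rt_apply (s : Strand) (z : List Strand) : ∃ f, V.rt (s :: z) = some ⟨s :: z, f⟩ := by
  cases s <;> exact ⟨_, rfl⟩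

theorem pow_apply {T : P.Tr} {w : List Strand} (h : ∃ f, T w = some ⟨w, f⟩) (m : ℕ) :
    ∃ f, (T ^ m) w = some ⟨w, f⟩ := by
  induction m with
  | zero => exact ⟨_, rfl⟩
  | succ m ih =>
    obtain ⟨f, hf⟩ := h
    obtain ⟨g, hg⟩ := ih
    exact ⟨_, by rw [pow_succ]; exact mul_apply_of_some_some hg hf⟩

theorem gr_pow_apply (k : ℕ) (s : Strand) (z : List Strand) :
    ∃ f, (V.gr ^ k) (s :: z) = some ⟨s.alternating (2 * k + 1) ++ z, f⟩ := by
  induction k with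
  | zero => exact ⟨_, rfl⟩
  | succ k ih =>
    obtain ⟨f, hf⟩ := ih
    have : ∃ g, V.gr (s.alternating (2 * k + 1) ++ z) =
        some ⟨s.alternating (2 * (k + 1) + 1) ++ z, g⟩ := by
      cases s <;> exact ⟨_, rfl⟩
    obtain ⟨g, hg⟩ := this
    exact ⟨_, by rw [pow_succ]; exact mul_apply_of_some_some hf hg⟩

/-- The legs of a spider alternate between the two kinds of wires. -/
theorem spider_apply (s : Strand) (k m n : ℕ) (z : List Strand) :
    ∃ f, V.spider s k m n z = some ⟨s.alternating (2 * k + 1) ++ s.flip :: z, f⟩ := by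
  obtain ⟨f₁, h₁⟩ := pow_apply (V.lf_apply s (s.flip :: z)) m
  obtain ⟨f₂, h₂⟩ := pow_apply (V.rt_apply s (s.flip :: z)) n
  obtain ⟨f₃, h₃⟩ := V.gr_pow_apply k s (s.flip :: z)
  have : ∃ f, V.cu s z = some ⟨s :: s.flip :: z, f⟩ := by cases s <;> exact ⟨_, rfl⟩
  obtain ⟨f, h⟩ := this
  exact ⟨_, mul_apply_of_some_some h (mul_apply_of_some_some (mul_apply_of_some_some h₁ h₂) h₃)⟩

end NestedVertex

namespace FrobeniusThreeStructure
variable {S : FrobeniusThreeStructure C}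
open DualObjects DualObjects.Tr

/-- Bending all inputs of a morphism around the left side gives a morphism that is represented by
the state. -/
theorem exists_bendIn_rep_state {T : S.Tr} {w w' : List Strand} {f : S.word w ⟶ S.word w'}
    (h : Rep T w w' f) : ∃ F : 𝟙_ C ⟶ S.word (Strand.turn w ++ w'),
      Relation.ReflTransGen S.BendIn ⟨w, w', f⟩ ⟨[], Strand.turn w ++ w', F⟩ ∧
      Rep (S.vertex.state T w) [] (Strand.turn w ++ w') F := by
  induction w generalizing w' T with
  | nil => exact ⟨f, .refl, by rw [NestedVertex.state_nil]; exact h⟩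
  | cons s w ih =>
    obtain ⟨F, h₁, h₂⟩ := ih (rep_bendInLeft h)
    rw [NestedVertex.state_cons, Strand.turn, List.append_assoc]
    exact ⟨F, .head (.left s w w' f) h₁, h₂⟩

theorem rep_word_eq {T T' : S.Tr} {w w' : List Strand} {f : 𝟙_ C ⟶ S.word w}
    {g : 𝟙_ C ⟶ S.word w'} (h : Rep T [] w f) (hT : T ≤ T') (h' : T' [] = some ⟨w', g⟩) :
    w = w' := by
  have := congrArg (Option.map Sigma.fst) ((hT _ _ (h [])).symm.trans h')
  simpa using this

/-- A morphism whose state lies below a spider with first leg `A*` is in normal form. -/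
theorem eq_normalForm (hS : S.Sliding) {T : S.Tr} {w w' : List Strand} {f : S.word w ⟶ S.word w'}
    (h : Rep T w w' f) {p q k m n : ℕ} (hT : S.vertex.state T w ≤ S.vertex.spider .down k m n)
    (hk : k = p + q) (hw : w.length = 2 * p + 1) : (⟨w, w', f⟩ : S.Mor) = S.normalForm p q n m := by
  have hV := S.nestedMul_sliding hS
  subst hk
  have hN := S.rep_normalForm p q n m
  have hle := S.vertex.state_normalForm_le hV p q n m
  obtain ⟨F, -, hF⟩ := exists_bendIn_rep_state h
  obtain ⟨G, -, hG⟩ := exists_bendIn_rep_state hN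
  obtain ⟨g, hg⟩ := S.vertex.spider_apply .down (p + q) m n []
  have e := (rep_word_eq hF hT hg).trans (rep_word_eq hG hle hg).symm
  have hl : (Strand.turn w).length = (Strand.turn (oddWord p)).length := by
    rw [Strand.length_turn, Strand.length_turn, hw, oddWord, List.length_cons,
      NestedVertex.length_tailWord]
  obtain ⟨e₁, e₂⟩ := List.append_inj e hl
  obtain rfl := Strand.turn_injective e₁
  exact Rep.unique ((S.vertex.rep_state_mul_caps h).mono (mul_le_mul (sft_mono _ hT) le_rfl))
    ((S.vertex.rep_state_mul_caps hN).mono (mul_le_mul (sft_mono _ hle) le_rfl)) le_rfl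

end FrobeniusThreeStructure
end

/-! ### Connected planar diagrams -/

section
variable {C : Type u} [Category.{v} C] [MonoidalCategory C]

namespace NestedVertex
variable {P : DualObjects C} {V : NestedVertex P.A P.Ad} {W : Set P.Tr}
open DualObjects DualObjects.Tr

/-- Nested cups form a tidy diagram in which every cup is a component of its own. -/
theorem tidy_nest (w : List Strand) (lw : List ℕ) (hl : lw.length = w.length) (hn : lw.Nodup) :
    V.Tidy W lw.toFinset (lw.reverse ++ lw) (V.nest w) := by
  induction w generalizing lw with
  | nil =>
    obtain rfl := List.length_eq_zero_iff.1 hl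
    exact .nil
  | cons s w ih =>
    cases lw with
    | nil => simp at hl
    | cons l lw =>
      rw [List.nodup_cons] at hn
      have hl' : lw.length = w.length := by simpa using hl
      have h := Tidy.adjoin l _ _ _ _ s.flip 0 0 0 (ih lw hl' hn.2)
        (fun h => hn.1 (List.mem_toFinset.1 h))
      have e : V.spider s.flip 0 0 0 = V.cu s.flip := by simp [spider, stalk]
      rw [e, List.length_reverse, hl'] at h
      rw [nest, List.toFinset_cons, List.reverse_cons, List.append_assoc]
      exact h

/-- The state of a connected diagram has a single component. -/
theorem exists_tidy_state {k : Flavour} {χ : k = .commutative → P.Tr} (hg : V.LegOp W V.gr 3)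
    (hj : ∀ {B : Finset ℕ} {T : P.Tr} {lx ly : List ℕ} {a b : ℕ},
      V.Tidy W B (lx ++ a :: b :: ly) T → V.Joined W a b B (lx ++ ly) (T * P.sft lx.length V.ca))
    (hχ : ∀ h, χ h ∈ W) {w w' : List Strand} (d : Diagram k w w') (hd : d.Connected) :
    ∃ (κ : ℕ) (ls : List ℕ) (T : P.Tr), V.state (V.act χ d) w ≤ T ∧ V.Tidy W {κ} ls T ∧
      ls.length = w.length + w'.length := by
  set lw := List.range w.length with hlw
  have h := tidy_nest (V := V) (W := W) w lw (by simp [hlw]) List.nodup_range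
  obtain ⟨φ, c, B', T, hT, hlink, hin, hB', h'⟩ :=
    traced hg hj hχ d _ lw.reverse lw [] _ (by simpa using h) (by simp [hlw])
  rw [List.length_reverse, hlw, List.length_range] at hT
  obtain ⟨⟨x⟩, hx⟩ := hd
  have hc : ∀ y, c y = c x := fun y => by
    induction hx y x with
    | rel _ _ h => exact hlink _ _ h
    | refl => rfl
    | symm _ _ _ ih => exact ih.symm
    | trans _ _ _ _ _ ih ih' => exact ih.trans ih'
  have e : B' = {c x} := by
    rw [← Finset.coe_inj, hB', Finset.coe_singleton]
    refine Set.Subset.antisymm (Set.union_subset ?_ ?_) ?_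
    · rintro _ ⟨l, hl, rfl⟩
      have hm : φ l ∈ lw.map φ := List.mem_map_of_mem (List.mem_toFinset.1 hl)
      rw [← hin, List.mem_ofFn] at hm
      obtain ⟨i, hi⟩ := hm
      rw [← hi]
      exact hc _
    · rintro _ ⟨y, rfl⟩
      exact hc y
    · rintro _ rfl
      exact Or.inr ⟨x, rfl⟩
  rw [e] at h'
  exact ⟨_, _, T, hT, h', by simp [hlw]⟩

/-- A connected planar diagram with at least one leg is a spider. -/
theorem Tidy.eq_spider {κ : ℕ} {ls : List ℕ} {T : P.Tr} (h : V.Tidy ∅ {κ} ls T) (hls : ls ≠ []) :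
    ∃ s k m n, T = V.spider s k m n ∧ ls.length = 2 * k + 2 := by
  generalize hB : ({κ} : Finset ℕ) = B at h
  cases h with
  | nil => exact absurd rfl hls
  | adjoin κ' B lx ly T s k m n h hκ =>
    have e : B = ∅ := by
      rw [Finset.eq_empty_iff_forall_notMem]
      intro b hb
      have h1 := hB ▸ Finset.mem_insert_self κ' B
      have h2 := hB ▸ Finset.mem_insert_of_mem (b := κ') hb
      rw [Finset.mem_singleton] at h1 h2
      exact hκ (h1.trans h2.symm ▸ hb)
    subst e
    have hnil : lx ++ ly = [] :=
      List.eq_nil_iff_forall_not_mem.2 fun l hl => by simpa using h.mem_of_mem l hl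
    obtain ⟨rfl, rfl⟩ := List.append_eq_nil_iff.1 hnil
    obtain rfl := h.eq_one rfl
    exact ⟨s, k, m, n, one_mul _, by simp⟩
  | closed => exact absurd rfl hls
  | lost κ' κ'' B ls T h h' hne =>
    subst hB
    exact absurd ((Finset.mem_singleton.1 h).trans (Finset.mem_singleton.1 h').symm) hne
  | swap χ hχ => cases hχ

end NestedVertex

namespace FrobeniusThreeStructure
variable {S : FrobeniusThreeStructure C}
open DualObjects DualObjects.Tr

/-- The number of legs and the alternation of their kinds determine which legs have to be bent for
both words to be odd and to begin with `A`; the result is a normal form since it has the same state.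
-/
theorem bendAtMostOne_normalForm (hS : S.Sliding) {T : S.Tr} {w w' : List Strand}
    {f : S.word w ⟶ S.word w'} (h : Rep T w w' f) (hw : w ≠ []) {s : Strand} {k m n : ℕ}
    (hT : S.vertex.state T w ≤ S.vertex.spider s k m n) (hk : w.length + w'.length = 2 * k + 2) :
    ∃ p q m n, S.BendAtMostOne ⟨w, w', f⟩ (S.normalForm p q m n) := by
  have hV := S.nestedMul_sliding hS
  obtain ⟨F, -, hF⟩ := exists_bendIn_rep_state h
  obtain ⟨g, hg⟩ := S.vertex.spider_apply s k m n []
  have e := rep_word_eq hF hT hg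
  rcases Nat.even_or_odd' w.length with ⟨l, hl | hl⟩
  · cases s with
    | up =>
      obtain ⟨w, a, rfl⟩ := List.eq_nil_or_concat' w |>.resolve_left hw
      rw [Strand.turn_append_singleton, List.cons_append, Strand.alternating, List.cons_append,
        List.cons.injEq] at e
      obtain rfl : a = .down := by rw [← a.flip_flip, e.1]; rfl
      rw [List.length_append, List.length_singleton] at hl hk
      refine ⟨l - 1, k - (l - 1), m, n, _, .single (.right .down w w' f), ?_⟩
      rw [eq_normalForm hS (h.bendInRight (S.rep_cu .down))
        (S.vertex.state_bendInRight_le hV hT) (p := l - 1) (q := k - (l - 1)) (by omega) (by omega)]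
    | down =>
      obtain ⟨b, w, rfl⟩ := List.exists_cons_of_ne_nil hw
      rw [List.length_cons] at hl hk
      refine ⟨l - 1, k - (l - 1), n, m, _, .single (.left b w w' f), ?_⟩
      rw [NestedVertex.state_cons] at hT
      rw [eq_normalForm hS (rep_bendInLeft h) hT (p := l - 1) (q := k - (l - 1)) (by omega)
        (by omega)]
  · cases s with
    | up =>
      obtain ⟨b, w, rfl⟩ := List.exists_cons_of_ne_nil hw
      have hw' : w' ≠ [] := by
        rintro rfl
        rw [List.length_nil] at hk
        omega
      obtain ⟨w', c, rfl⟩ := List.eq_nil_or_concat' w' |>.resolve_left hw'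
      have hc : c = .down := by
        have := congrArg List.getLast? e
        rw [← List.append_assoc, List.getLast?_concat, List.getLast?_concat] at this
        exact Option.some.inj this
      subst hc
      rw [NestedVertex.state_cons] at hT
      simp only [List.length_append, List.length_cons, List.length_nil] at hl hk
      have h₁ := rep_bendInLeft h
      have h₂ := Rep.bendOutRight (w' := b.flip :: w') h₁ (S.rep_ca .down)
      refine ⟨l, k - l, m, n, _, .single (.left b w _ f), ?_⟩
      rw [← eq_normalForm hS h₂ (S.vertex.state_bendOutRight_le hV hT
        (by rw [List.length_cons]; omega)) (p := l) (q := k - l) (by omega)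
        (by rw [List.length_append, List.length_singleton]; omega)]
      exact .single (.right .down w (b.flip :: w') _)
    | down =>
      refine ⟨l, k - l, n, m, _, .refl, ?_⟩
      rw [eq_normalForm hS h hT (p := l) (q := k - l) (by omega) hl]

theorem bendAtMostOne_of_connected (hS : S.Sliding) {w w' : List Strand}
    (d : Diagram .planar w w') (hd : d.Connected) (hw : w ≠ []) :
    ∃ p q m n, S.BendAtMostOne ⟨w, w', S.eval d⟩ (S.normalForm p q m n) := by
  have hV := S.nestedMul_sliding hS
  obtain ⟨κ, ls, T, hT, h, hl⟩ := NestedVertex.exists_tidy_state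
    (χ := fun h => S.sw (Flavour.noConfusion h)) (NestedVertex.legOp_gr hV)
    (fun h => h.joined hV rfl) (fun h => Flavour.noConfusion h) d hd
  obtain ⟨s, k, m, n, rfl, hk⟩ := h.eq_spider (by
    rintro rfl
    exact hw (List.length_eq_zero_iff.1 (by rw [List.length_nil] at hl; omega)))
  exact bendAtMostOne_normalForm hS (S.rep_act _ d) hw hT (by omega)

end FrobeniusThreeStructure
end

/-! ### The symmetry as an operation on words -/

section
variable {C : Type u} [Category.{v} C] [MonoidalCategory C] [SymmetricCategory C]

section Coherence
variable {X Y Z W W' : C}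

omit [SymmetricCategory C] in
theorem whisker_snoc_coherence {B : C} (e : Y ⟶ W ⊗ B) (g : B ⟶ Z) :
    (X ◁ e ≫ (α_ _ _ _).inv) ≫ (X ⊗ W) ◁ g = X ◁ (e ≫ W ◁ g) ≫ (α_ _ _ _).inv := by
  simp

theorem pull_nil_coherence (X : C) :
    𝟙 (X ⊗ 𝟙_ C) = ((λ_ (X ⊗ 𝟙_ C)).inv ≫ 𝟙_ C ◁ (ρ_ X).hom) ≫ (β_ (𝟙_ C) X).hom := by
  rw [braiding_tensorUnit_left]
  monoidal

theorem push_nil_coherence (X : C) :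
    𝟙 (X ⊗ 𝟙_ C) = (β_ X (𝟙_ C)).hom ≫ 𝟙_ C ◁ (ρ_ X).inv ≫ (λ_ (X ⊗ 𝟙_ C)).hom := by
  rw [braiding_tensorUnit_right]
  monoidal

theorem pull_cons_coherence (e : Y ⟶ W ⊗ Z) :
    X ◁ (e ≫ (β_ W Z).hom) ≫ (α_ _ _ _).inv ≫ (β_ X Z).hom ▷ W ≫ (α_ _ _ _).hom =
      (X ◁ e ≫ (α_ _ _ _).inv) ≫ (β_ (X ⊗ W) Z).hom := by
  rw [BraidedCategory.braiding_tensor_left_hom]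
  simp

theorem push_cons_coherence (e : W ⊗ Z ⟶ Y) :
    ((α_ _ _ _).inv ≫ (β_ Z X).hom ▷ W ≫ (α_ _ _ _).hom) ≫ X ◁ ((β_ Z W).hom ≫ e) =
      (β_ Z (X ⊗ W)).hom ≫ (α_ _ _ _).hom ≫ X ◁ e := by
  rw [BraidedCategory.braiding_tensor_right_hom]
  simp

theorem pull_natural_coherence (e : Y ⟶ W ⊗ Z ⊗ 𝟙_ C) {Y' : C} (e' : Y' ≅ W' ⊗ Z ⊗ 𝟙_ C)
    (f : W ⟶ W') :
    ((e ≫ W ◁ (ρ_ Z).hom) ≫ (β_ W Z).hom) ≫ Z ◁ f =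
      (e ≫ f ▷ (Z ⊗ 𝟙_ C) ≫ e'.inv) ≫ (e'.hom ≫ W' ◁ (ρ_ Z).hom) ≫ (β_ W' Z).hom := by
  simp only [Category.assoc, Iso.inv_hom_id_assoc, ← BraidedCategory.braiding_naturality_left,
    whisker_exchange_assoc]

theorem push_natural_coherence (e : Y ≅ W ⊗ Z ⊗ 𝟙_ C) {Y' : C} (e' : W' ⊗ Z ⊗ 𝟙_ C ⟶ Y')
    (f : W ⟶ W') :
    Z ◁ f ≫ (β_ Z W').hom ≫ W' ◁ (ρ_ Z).inv ≫ e' =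
      ((β_ Z W).hom ≫ W ◁ (ρ_ Z).inv ≫ e.inv) ≫ e.hom ≫ f ▷ (Z ⊗ 𝟙_ C) ≫ e' := by
  simp only [Category.assoc, Iso.inv_hom_id_assoc, BraidedCategory.braiding_naturality_right_assoc,
    whisker_exchange_assoc]

theorem braid_natural_coherence (f : W ⟶ W') :
    X ◁ Y ◁ f ≫ (α_ X Y W').inv ≫ (β_ X Y).hom ▷ W' ≫ (α_ Y X W').hom =
      ((α_ X Y W).inv ≫ (β_ X Y).hom ▷ W ≫ (α_ Y X W).hom) ≫ Y ◁ X ◁ f := by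
  simp only [associator_inv_naturality_right_assoc, whisker_exchange_assoc,
    associator_naturality_right, Category.assoc]

theorem braid_braid_coherence (X Y W : C) :
    ((α_ X Y W).inv ≫ (β_ X Y).hom ▷ W ≫ (α_ Y X W).hom) ≫
      (α_ Y X W).inv ≫ (β_ Y X).hom ▷ W ≫ (α_ X Y W).hom = 𝟙 (X ⊗ Y ⊗ W) := by
  simp [← comp_whiskerRight_assoc]

end Coherence

namespace DualObjects
variable (P : DualObjects C)
open NestedVertex (pull push)

/-- The symmetry map exchanging the first two wires. -/
def braid : P.Tr := P.sw fun a b => (β_ (P.ob a) (P.ob b)).hom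

theorem braid_apply (a b : Strand) (w : List Strand) : P.braid (a :: b :: w) = some ⟨b :: a :: w,
    (α_ (P.ob a) (P.ob b) (P.word w)).inv ≫ (β_ (P.ob a) (P.ob b)).hom ▷ P.word w ≫
      (α_ _ _ _).hom⟩ := rfl

omit [SymmetricCategory C] in
theorem wordSnoc_cons (s a : Strand) (w : List Strand) :
    P.wordSnoc (s :: w) a = whiskerLeftIso (P.ob s) (P.wordSnoc w a) ≪≫ (α_ _ _ _).symm :=
  Iso.ext (whisker_snoc_coherence _ _)

/-- The last wire of a word moves to the front. -/
def wordPull (w : List Strand) (a : Strand) : P.word (w ++ [a]) ⟶ P.word (a :: w) :=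
  (P.wordSnoc w a).hom ≫ (β_ (P.word w) (P.ob a)).hom

/-- The first wire of a word moves to the end. -/
def wordPush (w : List Strand) (a : Strand) : P.word (a :: w) ⟶ P.word (w ++ [a]) :=
  (β_ (P.ob a) (P.word w)).hom ≫ (P.wordSnoc w a).inv

variable {P}

theorem rep_braid_head (a b : Strand) (w : List Strand) :
    Rep P.braid (a :: b :: w) (b :: a :: w)
      ((α_ (P.ob a) (P.ob b) (P.word w)).inv ≫ (β_ (P.ob a) (P.ob b)).hom ▷ P.word w ≫
        (α_ _ _ _).hom) :=
  (rep_sw P _ a b).head (w := w) rfl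

theorem rep_pull (w : List Strand) (a : Strand) :
    Rep (pull P.braid w.length) (w ++ [a]) (a :: w) (P.wordPull w a) := by
  induction w with
  | nil =>
    refine (Rep.one [a]).congr ?_
    exact pull_nil_coherence _
  | cons s w ih =>
    refine ((ih.sft [s]).mul (rep_braid_head s a w)).congr ?_
    exact (pull_cons_coherence _).trans (congrArg (fun e : P.word (s :: w ++ [a]) ≅ _ =>
      e.hom ≫ (β_ (P.ob s ⊗ P.word w) (P.ob a)).hom) (P.wordSnoc_cons s a w)).symm

theorem rep_push (w : List Strand) (a : Strand) :
    Rep (push P.braid w.length) (a :: w) (w ++ [a]) (P.wordPush w a) := by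
  induction w with
  | nil =>
    refine (Rep.one [a]).congr ?_
    exact push_nil_coherence _
  | cons s w ih =>
    refine ((rep_braid_head a s w).mul (ih.sft [s])).congr ?_
    exact (push_cons_coherence _).trans (congrArg (fun e : P.word (s :: w ++ [a]) ≅ _ =>
      (β_ (P.ob a) (P.ob s ⊗ P.word w)).hom ≫ e.inv) (P.wordSnoc_cons s a w)).symm

/-- A wire can be pulled across any operation. -/
theorem Rep.pull_natural {K : P.Tr} {w w' : List Strand} {f : P.word w ⟶ P.word w'}
    (h : Rep K w w' f) (a : Strand) (y : List Strand) :
    (pull P.braid w.length * P.sh K) (w ++ [a] ++ y) =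
      (K * pull P.braid w'.length) (w ++ [a] ++ y) := by
  refine (((rep_pull w a).mul (h.sft [a])) y).trans (Eq.trans ?_ (((h.append [a]).mul
    (rep_pull w' a)) y).symm)
  refine some_congr (congrArg (fun e => P.padRight (w ++ [a]) (a :: w') e y) ?_)
  exact pull_natural_coherence _ _ _

theorem Rep.push_natural {K : P.Tr} {w w' : List Strand} {f : P.word w ⟶ P.word w'}
    (h : Rep K w w' f) (a : Strand) (y : List Strand) :
    (P.sh K * push P.braid w'.length) (a :: w ++ y) =
      (push P.braid w.length * K) (a :: w ++ y) := by
  refine (((h.sft [a]).mul (rep_push w' a)) y).trans (Eq.trans ?_ (((rep_push w a).mul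
    (h.append [a])) y).symm)
  refine some_congr (congrArg (fun e => P.padRight (a :: w) (w' ++ [a]) e y) ?_)
  exact push_natural_coherence _ _ _

variable (P)

theorem sh_sh_mul_braid (T : P.Tr) : P.sh (P.sh T) * P.braid = P.braid * P.sh (P.sh T) := by
  ext1 w
  match w with
  | [] => rfl
  | [a] => rfl
  | a :: b :: w =>
    cases h : T w with
    | none =>
      rw [Tr.mul_apply_of_none _ (sh_cons_none _ (sh_cons_none _ h)),
        Tr.mul_apply_of_some_none (P.braid_apply a b w) (sh_cons_none _ (sh_cons_none _ h))]
    | some L =>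
      rw [Tr.mul_apply_of_some_some (sh_cons_some _ (sh_cons_some _ h)) (P.braid_apply a b _),
        Tr.mul_apply_of_some_some (P.braid_apply a b w) (sh_cons_some _ (sh_cons_some _ h))]
      refine some_congr (P := P) (w := a :: b :: w) (w' := b :: a :: L.1) ?_
      exact braid_natural_coherence _

theorem braid_mul_braid_apply (a b : Strand) (w : List Strand) :
    (P.braid * P.braid) (a :: b :: w) = some ⟨a :: b :: w, 𝟙 _⟩ := by
  refine (Tr.mul_apply_of_some_some (P.braid_apply a b w) (P.braid_apply b a w)).trans ?_
  refine some_congr (P := P) (w := a :: b :: w) (w' := a :: b :: w) ?_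
  exact braid_braid_coherence _ _ _

theorem braid_mul_braid_le : P.braid * P.braid ≤ 1 := by
  intro w L hL
  match w with
  | [] => cases hL
  | [a] => cases hL
  | a :: b :: w => exact (P.braid_mul_braid_apply a b w).symm.trans hL

theorem braid_yang_baxter :
    P.braid * P.sh P.braid * P.braid = P.sh P.braid * P.braid * P.sh P.braid := by
  ext1 w
  match w with
  | [] => rfl
  | [a] => rfl
  | [a, b] => rfl
  | a :: b :: c :: w =>
    have := (rep_sw P (fun a b => (β_ (P.ob a) (P.ob b)).hom) a b).pull_natural c w
    simp only [List.length_cons, List.length_nil, pull, map_one, one_mul] at this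
    rw [mul_assoc]
    exact this.symm

variable {P}

theorem pull_apply_none {c : ℕ} {w : List Strand} (h : w.length ≤ c + 1) :
    pull P.braid (c + 1) w = none := by
  induction c generalizing w with
  | zero =>
    match w with
    | [] => rfl
    | [a] => rfl
    | a :: b :: w => simp at h
  | succ c ih =>
    match w with
    | [] => rfl
    | a :: w => exact Tr.mul_apply_of_none _ (sh_cons_none _ (ih (by simpa using h)))

theorem braid_mul_sh_of_rep {K : P.Tr} {c : ℕ}
    (hK : ∀ s, ∃ w' f, w'.length = c + 1 ∧ Rep K [s] w' f)
    (h₀ : K [] = none) : P.braid * P.sh K = K * pull P.braid (c + 1) := by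
  ext1 w
  match w with
  | [] => exact (Tr.mul_apply_of_none _ h₀).symm
  | [s] =>
    obtain ⟨w', f, hw', h⟩ := hK s
    exact (Tr.mul_apply_of_some_none (h []) (pull_apply_none (by simp [hw']))).symm
  | s :: a :: w =>
    obtain ⟨w', f, hw', h⟩ := hK s
    have := h.pull_natural a w
    rw [hw'] at this
    refine Eq.trans ?_ this
    simp [pull]

theorem braid_mul_of_rep {K : P.Tr} {c : ℕ} (hK : ∀ s, ∃ w' f, w'.length = c + 1 ∧ Rep K [s] w' f)
    (h₀ : K [] = none) : P.braid * K = P.sh K * push P.braid (c + 1) := by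
  ext1 w
  match w with
  | [] => rfl
  | [s] => exact (Tr.mul_apply_of_none _ (sh_cons_none _ h₀)).symm
  | a :: s :: w =>
    obtain ⟨w', f, hw', h⟩ := hK s
    have := h.push_natural a w
    rw [hw'] at this
    refine Eq.trans ?_ this.symm
    simp [push]

end DualObjects
end

/-! ### Exchanging legs of a vertex -/

section
variable {C : Type u} [Category.{v} C] [MonoidalCategory C]

namespace DualObjects
variable {P : DualObjects C}
open NestedVertex (pull push)

/-- Every word produced by `T` has at least `n` letters. -/
def Tr.HasLength (T : P.Tr) (n : ℕ) : Prop := ∀ w L, T w = some L → n ≤ L.1.length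

/-- `T` is defined on all words. -/
def Tr.IsTotal (T : P.Tr) : Prop := ∀ w, ∃ L, T w = some L

theorem Tr.IsTotal.eq_of_le {T K : P.Tr} (h : T.IsTotal) (hTK : T ≤ K) : T = K := by
  ext1 w
  obtain ⟨L, hL⟩ := h w
  exact hL.trans (hTK w L hL).symm

theorem Tr.exists_of_mul {T K : P.Tr} {w : List Strand} {L} (h : (T * K) w = some L) :
    ∃ M N, T w = some M ∧ K M.1 = some N ∧ L = ⟨N.1, M.2 ≫ N.2⟩ := by
  rw [mul_apply] at h
  cases hT : T w with
  | none => simp [hT] at h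
  | some M =>
    rw [hT] at h
    simp only [Option.bind_some, Option.map_eq_some_iff] at h
    obtain ⟨N, hN, rfl⟩ := h
    exact ⟨M, N, rfl, hN, rfl⟩

theorem exists_of_sh {T : P.Tr} {s : Strand} {w : List Strand} {L}
    (h : P.sh T (s :: w) = some L) :
    ∃ M, T w = some M ∧ L = ⟨s :: M.1, P.ob s ◁ M.2⟩ := by
  rw [sh_cons] at h
  simp only [Option.map_eq_some_iff] at h
  obtain ⟨N, hN, rfl⟩ := h
  exact ⟨N, hN, rfl⟩

end DualObjects

namespace NestedVertex
variable {P : DualObjects C} (V : NestedVertex P.A P.Ad)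
open DualObjects DualObjects.Tr

/-- The properties of the symmetry map exchanging the first two wires of a word, as an operation
`x`: it is a natural involution satisfying the Yang-Baxter equation, wires can be moved across cups,
caps, loops and comultiplications, a cap is unchanged by exchanging its two wires (`mul_ca`), and
the multiplication by exchanging its first and its third input (`mu_comm`). Some of these laws are
inequalities since `x` is undefined on words with fewer than two wires. -/
structure Braiding (x : P.Tr) : Prop where
  apply : ∀ a b w, ∃ f, x (a :: b :: w) = some ⟨b :: a :: w, f⟩
  length : ∀ w L, x w = some L → L.1.length = w.length
  comm : ∀ T : P.Tr, P.sh (P.sh T) * x = x * P.sh (P.sh T)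
  yb : x * P.sh x * x = P.sh x * x * P.sh x
  mul_self_le : x * x ≤ 1
  mul_gr : x * V.gr = P.sh V.gr * push x 3
  mul_sh_gr : x * P.sh V.gr = V.gr * pull x 3
  mul_lf : x * V.lf = P.sh V.lf * push x 1
  mul_sh_lf : x * P.sh V.lf = V.lf * pull x 1
  cu_pull : ∀ s, V.cu s * pull x 2 ≤ P.sh (V.cu s)
  cu_push : ∀ s, P.sh (V.cu s) * push x 2 ≤ V.cu s
  mul_sh_ca : x * P.sh V.ca = P.sh x * V.ca
  mul_ca : x * V.ca = V.ca
  mu_comm : ∀ w, (x * P.sh x * x * V.mu) (.up :: .down :: .up :: w) =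
    V.mu (.up :: .down :: .up :: w)

theorem pull_two (x : P.Tr) : pull x 2 = P.sh x * x := by simp [pull]
theorem push_two (x : P.Tr) : push x 2 = x * P.sh x := by simp [push]
theorem pull_three (x : P.Tr) : pull x 3 = P.sft 2 x * P.sh x * x := by simp [pull, sft_succ]
theorem push_three (x : P.Tr) : push x 3 = x * P.sh x * P.sft 2 x := by
  simp [push, sft_succ, mul_assoc]

variable {V} {x : P.Tr}

namespace Braiding
section
variable (hx : V.Braiding x)
include hx

theorem sft_comm {i j : ℕ} (h : i + 2 ≤ j) (T : P.Tr) :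
    P.sft j T * P.sft i x = P.sft i x * P.sft j T := by
  obtain ⟨j, rfl⟩ := Nat.exists_eq_add_of_le h
  rw [show i + 2 + j = i + (2 + j) by omega, sft_add i, ← map_mul, sft_add 2, ← map_mul]
  exact congrArg (P.sft i) (hx.comm _)

theorem sft_length (i : ℕ) : ∀ w L, P.sft i x w = some L → L.1.length = w.length := by
  induction i with
  | zero => exact hx.length
  | succ i ih =>
    intro w L hL
    cases w with
    | nil => cases hL; rfl
    | cons s w =>
      obtain ⟨M, hM, rfl⟩ := exists_of_sh hL
      exact congrArg (· + 1) (ih _ _ hM)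

theorem sft_apply (i : ℕ) : ∀ w : List Strand, i + 2 ≤ w.length → ∃ L, P.sft i x w = some L := by
  induction i with
  | zero =>
    intro w hw
    match w, hw with
    | a :: b :: w, _ =>
      obtain ⟨f, hf⟩ := hx.apply a b w
      exact ⟨_, hf⟩
  | succ i ih =>
    intro w hw
    cases w with
    | nil => simp at hw
    | cons s w =>
      obtain ⟨L, hL⟩ := ih w (by simpa using hw)
      exact ⟨_, sh_cons_some s hL⟩

theorem sft_mul_self (i : ℕ) :
    ∀ w : List Strand, i + 2 ≤ w.length → (P.sft i x * P.sft i x) w = some ⟨w, 𝟙 _⟩ := by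
  intro w hw
  obtain ⟨L, hL⟩ := hx.sft_apply i w hw
  obtain ⟨M, hM⟩ := hx.sft_apply i L.1 (by rwa [hx.sft_length i _ _ hL])
  have h := mul_apply_of_some_some hL hM
  rw [h]
  have h1 := sft_mono i hx.mul_self_le
  rw [map_mul, map_one] at h1
  exact (h1 _ _ h).symm

theorem mul_sw_mul_sw {T : P.Tr} {n : ℕ} (h : T.HasLength n) {i : ℕ} (hi : i + 2 ≤ n) :
    T * P.sft i x * P.sft i x = T := by
  rw [mul_assoc]
  ext1 w
  cases hT : T w with
  | none => exact mul_apply_of_none _ hT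
  | some L =>
    rw [mul_apply_of_some_some hT (hx.sft_mul_self i _ (hi.trans (h w L hT))), Category.comp_id]

theorem hasLength_mul {T : P.Tr} {n : ℕ} (h : T.HasLength n) (i : ℕ) :
    (T * P.sft i x).HasLength n := by
  intro w L hL
  obtain ⟨M, N, hM, hN, rfl⟩ := exists_of_mul hL
  exact (h w M hM).trans_eq (hx.sft_length i _ _ hN).symm

theorem isTotal_mul {T : P.Tr} {n : ℕ} (ht : T.IsTotal) (h : T.HasLength n) {i : ℕ}
    (hi : i + 2 ≤ n) : (T * P.sft i x).IsTotal := by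
  intro w
  obtain ⟨L, hL⟩ := ht w
  obtain ⟨M, hM⟩ := hx.sft_apply i L.1 (hi.trans (h w L hL))
  exact ⟨_, mul_apply_of_some_some hL hM⟩

/-- The cups are exchanged by the symmetry. -/
theorem cu_mul (s : Strand) : V.cu s * x = V.cu s.flip := by
  have h1 : V.cu s * x * P.sh V.ca ≤ 1 := by
    rw [mul_assoc, hx.mul_sh_ca]
    nth_rewrite 1 [← hx.mul_ca]
    rw [← mul_assoc (P.sh x), ← pull_two, ← mul_assoc]
    exact le_trans (mul_le_mul (hx.cu_pull s) le_rfl) (V.snake_left s)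
  have e : V.cu s.flip * (V.cu s * x * P.sh V.ca) =
      V.cu s * x * P.sh (P.sh (V.cu s.flip) * V.ca) := by
    rw [← mul_assoc, ← mul_assoc, mul_cu, mul_assoc (V.cu s), hx.comm, map_mul]
    simp only [mul_assoc]
  have h2 : V.cu s.flip * (V.cu s * x * P.sh V.ca) ≤ V.cu s.flip := by
    simpa using mul_le_mul (le_refl (V.cu s.flip)) h1
  have h3 : V.cu s.flip * (V.cu s * x * P.sh V.ca) ≤ V.cu s * x := by
    rw [e]
    simpa using mul_le_mul (le_refl (V.cu s * x)) (sh_mono (V.snake_left s.flip))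
  have ht : (V.cu s.flip * (V.cu s * x * P.sh V.ca)).IsTotal := by
    intro w
    rw [e]
    have : ∃ f, (V.cu s * x) w = some ⟨s.flip :: s :: w, f⟩ := by
      cases s
      · obtain ⟨f, hf⟩ := hx.apply .up .down w
        exact ⟨_, mul_apply_of_some_some rfl hf⟩
      · obtain ⟨f, hf⟩ := hx.apply .down .up w
        exact ⟨_, mul_apply_of_some_some rfl hf⟩
    obtain ⟨f, hf⟩ := this
    exact ⟨_, mul_apply_of_some_some hf (sh_cons_some _ (V.snake_apply s w))⟩
  exact (ht.eq_of_le h3).symm.trans (ht.eq_of_le h2)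

omit hx in
theorem hasLength_mul_cu {T : P.Tr} {n : ℕ} (h : T.HasLength n) (s : Strand) :
    (T * V.cu s).HasLength (n + 2) := by
  intro w L hL
  obtain ⟨M, N, hM, hN, rfl⟩ := exists_of_mul hL
  have := h w M hM
  cases s <;> cases hN <;> simpa using this

omit hx in
theorem isTotal_mul_cu {T : P.Tr} (h : T.IsTotal) (s : Strand) :
    (T * V.cu s).IsTotal := by
  intro w
  obtain ⟨L, hL⟩ := h w
  cases s
  · exact ⟨_, mul_apply_of_some_some hL rfl⟩
  · exact ⟨_, mul_apply_of_some_some hL rfl⟩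

/-- Exchanging the right ends of two nested cups amounts to exchanging their left ends. -/
theorem cu_mul_sh_cu (a b : Strand) :
    V.cu a * P.sh (V.cu b) * P.sft 2 x = V.cu b * P.sh (V.cu a) * x := by
  have hl : (V.cu b * V.cu a).HasLength 4 :=
    hasLength_mul_cu (one_mul (V.cu b) ▸ hasLength_mul_cu (n := 0) (fun _ _ _ => Nat.zero_le _) b) a
  have ht : (V.cu b * V.cu a).IsTotal :=
    isTotal_mul_cu (one_mul (V.cu b) ▸ isTotal_mul_cu (fun w => ⟨_, one_apply w⟩) b) a
  have hY : (V.cu b * V.cu a * P.sft 1 x).IsTotal := hx.isTotal_mul ht hl (by omega)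
  have hYl := hx.hasLength_mul hl 1
  have h1 : V.cu b * V.cu a * P.sft 1 x ≤ V.cu a * P.sh (V.cu b) * P.sft 2 x := by
    rw [← hx.mul_sw_mul_sw hYl (i := 2) (by omega)]
    refine mul_le_mul ?_ le_rfl
    rw [mul_cu, mul_assoc, mul_assoc]
    refine mul_le_mul le_rfl ?_
    have := sh_mono (hx.cu_push b)
    rwa [push_two, map_mul, map_mul] at this
  have h2 : V.cu b * V.cu a * P.sft 1 x ≤ V.cu b * P.sh (V.cu a) * x := by
    rw [← hx.mul_sw_mul_sw hYl (i := 0) (by omega)]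
    refine mul_le_mul ?_ le_rfl
    rw [mul_assoc, mul_assoc]
    refine mul_le_mul le_rfl ?_
    exact pull_two x ▸ hx.cu_pull a
  rw [← hY.eq_of_le h1, ← hY.eq_of_le h2]

/-- Moving the last leg of a vertex to the front rotates the vertex. -/
theorem cu_gr_pull (s : Strand) : V.cu s * V.gr * pull x 3 = V.cu s.flip * V.gr := by
  rw [mul_assoc, ← hx.mul_sh_gr, ← mul_assoc, hx.cu_mul, cu_gr]

theorem cu_gr_push (s : Strand) : V.cu s * V.gr * push x 3 = V.cu s.flip * V.gr := by
  rw [← cu_gr, mul_assoc, ← hx.mul_gr, ← mul_assoc, hx.cu_mul]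

omit hx in
theorem hasLength_spider (s : Strand) (k m n : ℕ) : (V.spider s k m n).HasLength (2 * k + 2) := by
  intro w L hL
  obtain ⟨f, hf⟩ := V.spider_apply s k m n w
  rw [hf] at hL
  cases hL
  have (s : Strand) (n : ℕ) : (s.alternating n).length = n := by
    induction n generalizing s with
    | zero => rfl
    | succ n ih => rw [Strand.alternating, List.length_cons, ih]
  simp only [List.length_append, this, List.length_cons]
  omega

omit hx in
theorem spider_one (s : Strand) : V.spider s 1 0 0 = V.cu s * V.gr := by simp [spider, stalk]

theorem cu_gr_exchange_down (hV : NestedSliding V) :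
    V.cu .down * V.gr * (P.sh x * x * P.sh x) = V.cu .down * V.gr := by
  set N := V.nest [.up, .down, .up] with hN
  have hN' : N = V.cu .down * P.sh (V.cu .up * P.sh (V.cu .down)) := by
    rw [hN, show ([.up, .down, .up] : List Strand) = ([.up] ++ [.down]) ++ [.up] from rfl,
      nest_append_singleton, nest_append_singleton]
    simp [nest, Strand.flip]
  have hZ : N * P.sft 3 V.mu = V.cu .down * V.gr := by
    have h := V.state_normalForm_le hV 1 0 0 0
    rw [add_zero, spider_one] at h
    have e : V.mu ^ 1 * V.stalk 0 0 0 = V.mu := by simp [stalk]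
    rw [e] at h
    have ht : (V.state V.mu (FrobeniusThreeStructure.oddWord 1)).IsTotal := by
      intro w
      exact ⟨_, rfl⟩
    exact ht.eq_of_le h
  have hc : N * P.sft 3 (x * P.sh x * x * V.mu) = N * P.sft 3 V.mu := by
    ext1 w
    have : ∃ f, N w = some ⟨.down :: .up :: .down :: .up :: .down :: .up :: w, f⟩ := ⟨_, rfl⟩
    obtain ⟨f, hf⟩ := this
    rw [mul_apply_of_some _ hf, mul_apply_of_some _ hf, sft_succ, sft_succ, sft_succ, sft_zero,
      sft_succ, sft_succ, sft_succ, sft_zero, sh_cons, sh_cons, sh_cons, sh_cons, sh_cons, sh_cons,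
      hx.mu_comm]
  have c1 := hx.sft_comm (i := 0) (j := 3) (by omega) x
  have c2 := hx.sft_comm (i := 1) (j := 3) (by omega) x
  have c4 := hx.sft_comm (i := 1) (j := 4) (by omega) x
  have e3 : N * P.sft 3 x = V.cu .down * P.sh (V.cu .down) * P.sft 2 (V.cu .up) * P.sft 1 x := by
    rw [hN', mul_assoc, sft_succ, ← map_mul, hx.cu_mul_sh_cu]
    simp only [map_mul, mul_assoc]; rfl
  have e4 : V.cu .down * P.sh (V.cu .down) * P.sft 2 (V.cu .up) * P.sft 4 x =
      V.cu .down * P.sh (V.cu .down) * P.sft 2 (V.cu .up) * x := by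
    rw [mul_assoc, show P.sft 4 x = P.sft 2 (P.sh (P.sh x)) from rfl, ← map_mul, ← mul_cu, map_mul,
      ← mul_assoc, hx.cu_mul_sh_cu, mul_assoc, mul_assoc (_ * _)]
    exact congrArg _ (hx.comm _).symm
  have e3' : V.cu .down * P.sh (V.cu .down) * P.sft 2 (V.cu .up) * P.sft 3 x = N * P.sh x := by
    rw [hN', mul_assoc, mul_assoc, sft_succ 2, sft_succ 1, ← map_mul, ← map_mul, ← mul_assoc]
    have := hx.cu_mul_sh_cu .down .up
    rw [show P.sft 1 (V.cu .up) = P.sh (V.cu .up) from rfl, this]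
    simp only [map_mul, mul_assoc]
  have key : N * P.sft 3 (x * P.sh x * x) = N * (P.sh x * x * P.sh x) := by
    have h4 : P.sft 3 (P.sh x) = P.sft 4 x := (sft_succ' 3 x).symm
    rw [sft_zero] at c1
    rw [map_mul, map_mul, h4, ← mul_assoc, ← mul_assoc, e3, mul_assoc _ (P.sft 1 x), ← c4,
      ← mul_assoc, e4, mul_assoc _ (P.sft 1 x), ← c2, ← mul_assoc, mul_assoc _ x (P.sft 3 x),
      ← c1, ← mul_assoc, e3', ← mul_assoc, ← mul_assoc]
    rfl
  have d1 := hx.sft_comm (i := 0) (j := 3) (by omega) V.mu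
  have d2 := hx.sft_comm (i := 1) (j := 3) (by omega) V.mu
  rw [sft_zero] at d1
  rw [show P.sft 1 x = P.sh x from rfl] at d2
  rw [← hZ]
  conv_rhs => rw [← hc, map_mul, ← mul_assoc N, key]
  rw [mul_assoc N, ← mul_assoc _ _ (P.sh x), ← mul_assoc _ (P.sh x), d2, mul_assoc _ _ x, d1,
    ← mul_assoc _ x, mul_assoc _ _ (P.sh x), d2]
  simp only [mul_assoc]

/-- The first and the third leg of a vertex can be exchanged. -/
theorem gr_exchange (hV : NestedSliding V) : V.gr * (x * P.sh x * x) = V.gr := by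
  have key : ∀ s, V.cu s * V.gr * (x * P.sh x * x) = V.cu s * V.gr := by
    have hl : ∀ s, (V.cu s * V.gr).HasLength 4 := fun s => spider_one (V := V) s ▸
      hasLength_spider s 1 0 0
    have hd : V.cu .down * V.gr * (x * P.sh x * x) = V.cu .down * V.gr := by
      rw [hx.yb, hx.cu_gr_exchange_down hV]
    intro s
    cases s with
    | down => exact hd
    | up =>
      have c := hx.sft_comm (i := 0) (j := 2) (by omega) x
      rw [sft_zero] at c
      have h1 : V.cu .down * V.gr * P.sft 2 x * x = V.cu .up * V.gr := by
        rw [mul_assoc _ _ x, c, ← mul_assoc]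
        conv_lhs => rw [← hd]
        have := hx.mul_sw_mul_sw (hx.hasLength_mul (hx.hasLength_mul (hl .down) 0) 1) (i := 0)
          (by omega)
        rw [sft_zero, show P.sft 1 x = P.sh x from rfl] at this
        rw [← mul_assoc, ← mul_assoc, this, mul_assoc, mul_assoc, ← mul_assoc x, ← push_three,
          hx.cu_gr_push]
        rfl
      have h2 : V.cu .down * V.gr * (P.sft 2 x * P.sh x * x) = V.cu .up * V.gr := by
        rw [← pull_three, hx.cu_gr_pull]
        rfl
      conv_lhs => rw [← h2]
      have e1 := hx.mul_sw_mul_sw (hx.hasLength_mul (hx.hasLength_mul (hl .down) 2) 1) (i := 0)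
        (by omega)
      have e2 := hx.mul_sw_mul_sw (hx.hasLength_mul (hl .down) 2) (i := 1) (by omega)
      rw [sft_zero, show P.sft 1 x = P.sh x from rfl] at e1
      rw [show P.sft 1 x = P.sh x from rfl] at e2
      rw [← mul_assoc, ← mul_assoc, ← mul_assoc, ← mul_assoc, e1, e2, h1]
  have c0 := hx.sft_comm (i := 0) (j := 3) (by omega) V.ca
  have c1 := hx.sft_comm (i := 1) (j := 3) (by omega) V.ca
  rw [sft_zero] at c0
  rw [show P.sft 1 x = P.sh x from rfl] at c1
  have hcomm : P.sft 3 V.ca * (x * P.sh x * x) = x * P.sh x * x * P.sft 3 V.ca := by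
    rw [← mul_assoc, ← mul_assoc, c0, mul_assoc x, c1, mul_assoc _ _ x, mul_assoc (P.sh x), c0]
    simp only [mul_assoc]
  ext1 w
  match w with
  | [] => rfl
  | s :: w =>
    have h1 : V.cu s * V.gr * P.sft 3 V.ca ≤ V.gr := by
      have := V.spider_mul_ca_le s 1 0 0
      rw [spider_one] at this
      simpa [stalk] using this
    have h2 : V.cu s * V.gr * P.sft 3 V.ca ≤ V.gr * (x * P.sh x * x) := by
      conv_lhs => rw [← key s]
      rw [mul_assoc, ← hcomm, ← mul_assoc]
      exact mul_le_mul h1 le_rfl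
    have : ∃ L, (V.cu s * V.gr * P.sft 3 V.ca) (s :: w) = some L := by
      cases s <;> exact ⟨_, rfl⟩
    obtain ⟨L, hL⟩ := this
    exact (h2 _ _ hL).trans (h1 _ _ hL).symm

omit hx in
theorem hasLength_gr : V.gr.HasLength 3 := by
  intro w L hL
  match w with
  | [] => cases hL
  | .up :: w => cases hL; simp
  | .down :: w => cases hL; simp

theorem gr_pull (hV : NestedSliding V) : V.gr * pull x 2 = V.gr * P.sh x := by
  have h := hx.mul_sw_mul_sw (hx.hasLength_mul (hx.hasLength_mul (hasLength_gr (V := V)) 1) 0)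
      (i := 1)
    (by omega)
  rw [sft_zero, show P.sft 1 x = P.sh x from rfl] at h
  conv_rhs => rw [← hx.gr_exchange hV, hx.yb]
  rw [pull_two, ← mul_assoc, ← mul_assoc, ← mul_assoc, h]

theorem gr_push (hV : NestedSliding V) : V.gr * push x 2 = V.gr * x := by
  have h := hx.mul_sw_mul_sw (hx.hasLength_mul (hx.hasLength_mul (hasLength_gr (V := V)) 0) 1)
      (i := 0)
    (by omega)
  rw [sft_zero, show P.sft 1 x = P.sh x from rfl] at h
  conv_rhs => rw [← hx.gr_exchange hV]
  rw [push_two, ← mul_assoc, ← mul_assoc, ← mul_assoc, h]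

/-- Both loops agree: exchanging the two outputs that form a loop leaves the cap unchanged, and
exchanging outputs of the comultiplication turns one loop into the other. -/
theorem rt_eq_lf (hV : NestedSliding V) : V.rt = V.lf := by
  have h := hx.mul_sw_mul_sw (hasLength_gr (V := V)) (i := 1) (by omega)
  rw [show P.sft 1 x = P.sh x from rfl] at h
  rw [← gr_mul_sh_ca]
  nth_rewrite 1 [← hx.mul_ca]
  rw [map_mul, ← mul_assoc, ← hx.gr_pull hV, pull_two, mul_assoc, mul_assoc, hx.mul_sh_ca,
    ← mul_assoc, ← mul_assoc, h, gr_mul_ca]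

end
end Braiding
end NestedVertex
end

/-! ### Moving legs of spiders -/

section
variable {C : Type u} [Category.{v} C] [MonoidalCategory C]

namespace NestedVertex
variable {P : DualObjects C} {V : NestedVertex P.A P.Ad} {x : P.Tr}
open DualObjects DualObjects.Tr

theorem pull_add (x : P.Tr) (a b : ℕ) : pull x (a + b) = P.sft a (pull x b) * pull x a := by
  induction a with
  | zero => simp [pull]
  | succ a ih =>
    rw [show a + 1 + b = a + b + 1 by omega, pull, ih, map_mul, mul_assoc]
    rfl

theorem push_add (x : P.Tr) (a b : ℕ) : push x (a + b) = push x a * P.sft a (push x b) := by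
  induction a with
  | zero => simp [push]
  | succ a ih =>
    rw [show a + 1 + b = a + b + 1 by omega, push, ih, map_mul, ← mul_assoc]
    rfl

namespace Braiding
section
variable (hx : V.Braiding x)
include hx

theorem legOp_gr (hV : NestedSliding V) : V.LegOp {x} V.gr 3 where
  sh_mul T := V.mul_gr T
  spider s k m n i hi := ⟨k + 1, m, n, by omega, spider_mul_gr hV s k m n i hi⟩
  swap_mul χ hχ := by obtain rfl := hχ; exact hx.mul_gr
  swap_mul_sh χ hχ := by obtain rfl := hχ; exact hx.mul_sh_gr
  swap_comm χ hχ := by obtain rfl := hχ; exact hx.comm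

theorem legOp_lf (hV : NestedSliding V) : V.LegOp {x} V.lf 1 where
  sh_mul T := V.mul_lf T
  spider s k m n i hi := by
    obtain ⟨m', n', h⟩ := spider_mul_lf hV s k m n i hi
    exact ⟨k, m', n', by omega, h⟩
  swap_mul χ hχ := by obtain rfl := hχ; exact hx.mul_lf
  swap_mul_sh χ hχ := by obtain rfl := hχ; exact hx.mul_sh_lf
  swap_comm χ hχ := by obtain rfl := hχ; exact hx.comm

theorem tidy_stalk (hV : NestedSliding V) {B : Finset ℕ} {T : P.Tr}
    {lx ly : List ℕ} {a : ℕ} (h : V.Tidy {x} B (lx ++ a :: ly) T) (k m n : ℕ) :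
    V.Tidy {x} B (lx ++ (List.replicate (2 * k + 1) a ++ ly))
      (T * P.sft lx.length (V.stalk k m n)) :=
  h.stalk (hx.legOp_gr hV) (hx.legOp_lf hV) (hx.rt_eq_lf hV ▸ hx.legOp_lf hV) k m n

theorem sft_mul_pull {n j : ℕ} (h : n + 1 ≤ j) (T : P.Tr) :
    P.sft j T * pull x n = pull x n * P.sft j T := by
  induction n generalizing j with
  | zero => simp [pull]
  | succ n ih =>
    obtain ⟨j, rfl⟩ := Nat.exists_eq_add_of_le' (show 1 ≤ j by omega)
    rw [pull, ← mul_assoc, sft_succ, ← map_mul, ih (by omega), map_mul, mul_assoc, mul_assoc,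
      ← sft_succ]
    exact congrArg _ (hx.sft_comm (i := 0) (by omega) T)

theorem sw_mul_pull {q m : ℕ} (h : q + 2 ≤ m) :
    P.sft q x * pull x m = pull x m * P.sft (q + 1) x := by
  obtain ⟨r, rfl⟩ := Nat.exists_eq_add_of_le h
  have h1 : x * pull x 2 = pull x 2 * P.sh x := by rw [pull_two, ← mul_assoc, hx.yb]
  rw [pull_add, pull_add x q 2, ← mul_assoc, ← hx.sft_comm le_rfl, mul_assoc, mul_assoc,
    ← mul_assoc (P.sft q x), ← map_mul, h1, map_mul, mul_assoc, ← sft_succ',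
    hx.sft_mul_pull le_rfl]
  simp only [mul_assoc]

/-- Capping two distant legs by moving either of them next to the other. -/
theorem sh_pull_mul_ca (r : ℕ) : P.sh (pull x r) * V.ca = push x r * P.sft r V.ca := by
  induction r with
  | zero => simp [pull, push]
  | succ r ih =>
    rw [pull, map_mul, mul_assoc, ← hx.mul_sh_ca, ← mul_assoc, hx.comm, mul_assoc, ← map_mul, ih,
      map_mul, push, mul_assoc]
    rfl

theorem sh_cu_pull_mul_ca_le (t : Strand) (q : ℕ) :
    P.sh (P.sft q (V.cu t) * pull x q) * V.ca ≤ push x q := by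
  induction q with
  | zero => simpa [pull, push] using V.snake_left t
  | succ q ih =>
    rw [pull, sft_succ, ← mul_assoc, ← map_mul, map_mul P.sh (P.sh _) x, mul_assoc, ← hx.mul_sh_ca,
      ← mul_assoc, hx.comm, mul_assoc, ← map_mul, push]
    exact mul_le_mul le_rfl (sh_mono ih)

theorem sw_mul_sh_stalk (hV : NestedSliding V) (k m n : ℕ) :
    x * P.sh (V.stalk k m n) = V.stalk k m n * pull x (2 * k + 1) := by
  have hpow (m : ℕ) : x * P.sh (V.lf ^ m) = V.lf ^ m * x := by
    have h : x * P.sh V.lf = V.lf * x := by simpa [pull] using hx.mul_sh_lf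
    rw [map_pow]
    exact (show SemiconjBy x (P.sh V.lf) V.lf from h).pow_right m
  have hgr (k : ℕ) : x * P.sh (V.gr ^ k) = V.gr ^ k * pull x (2 * k + 1) := by
    induction k with
    | zero => simp [pull]
    | succ k ih =>
      rw [pow_succ, map_mul, ← mul_assoc, ih, pull, mul_assoc, mul_assoc, hx.mul_sh_gr,
        ← mul_assoc (P.sh _), V.mul_gr, mul_assoc, mul_assoc,
        show 2 * (k + 1) + 1 = 3 + 2 * k by omega, pull_add]
      rfl
  rw [stalk, hx.rt_eq_lf hV, ← pow_add, map_mul, ← mul_assoc, hpow, mul_assoc, hgr, ← mul_assoc]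

theorem sw_mul_stalk (hV : NestedSliding V) (k m n : ℕ) :
    x * V.stalk k m n = P.sh (V.stalk k m n) * push x (2 * k + 1) := by
  have hpow (m : ℕ) : x * V.lf ^ m = P.sh (V.lf ^ m) * x := by
    have h : x * V.lf = P.sh V.lf * x := by simpa [push] using hx.mul_lf
    rw [map_pow]
    exact (show SemiconjBy x V.lf (P.sh V.lf) from h).pow_right m
  have hgr (k : ℕ) : x * V.gr ^ k = P.sh (V.gr ^ k) * push x (2 * k + 1) := by
    induction k with
    | zero => simp [push]
    | succ k ih =>
      rw [pow_succ, ← mul_assoc, ih, push, mul_assoc, mul_assoc, V.mul_gr, ← mul_assoc x,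
        hx.mul_gr, map_mul, mul_assoc, mul_assoc, show 2 * (k + 1) + 1 = 3 + 2 * k by omega,
        push_add]
      rfl
  rw [stalk, hx.rt_eq_lf hV, ← pow_add, map_mul, ← mul_assoc, hpow, mul_assoc, hgr, ← mul_assoc]

/-- The last leg of a spider can be moved to the front. -/
theorem spider_mul_pull (hV : NestedSliding V) (s : Strand) (k m n : ℕ) :
    V.spider s k m n * pull x (2 * k + 1) = V.spider s.flip k n m := by
  rw [spider, mul_assoc, ← hx.sw_mul_sh_stalk hV, ← mul_assoc, hx.cu_mul, spider_eq_cu_mul_sh hV]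

/-- The first leg of a spider can be moved to the end. -/
theorem spider_mul_push (hV : NestedSliding V) (s : Strand) (k m n : ℕ) :
    V.spider s k m n * push x (2 * k + 1) = V.spider s.flip k n m := by
  rw [spider_eq_cu_mul_sh hV, mul_assoc, ← hx.sw_mul_stalk hV, ← mul_assoc, hx.cu_mul, spider]

/-- A strand can be pulled across all legs of a spider. -/
theorem spider_mul_pull_le (hV : NestedSliding V) (s : Strand) (k m n : ℕ) :
    V.spider s k m n * pull x (2 * k + 2) ≤ P.sh (V.spider s k m n) := by
  rw [show 2 * k + 2 = 2 * k + 1 + 1 from rfl, pull_add, ← mul_assoc, spider, mul_assoc (V.cu s),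
    V.stalk_mul_sft, mul_assoc, mul_assoc, ← hx.sw_mul_sh_stalk hV, ← mul_assoc, ← mul_assoc,
    map_mul]
  refine mul_le_mul ?_ le_rfl
  rw [mul_assoc, show pull x 1 = x by simp [pull], ← pull_two]
  exact hx.cu_pull s

theorem sft_spider_mul_pull_le (hV : NestedSliding V) (s : Strand) (k m n q r : ℕ) :
    P.sft q (V.spider s k m n) * pull x (q + (2 * k + 2 + r)) ≤
      pull x (q + r) * P.sft (q + 1) (V.spider s k m n) := by
  rw [pull_add, pull_add x q r, ← mul_assoc, ← map_mul, pull_add x (2 * k + 2), ← mul_assoc,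
    ← mul_spider, mul_assoc _ (pull x q), ← hx.sft_mul_pull le_rfl,
    ← mul_assoc (P.sft q (pull x r)), sft_succ' q, ← map_mul, mul_assoc (pull x r)]
  refine mul_le_mul (sft_mono _ (mul_le_mul le_rfl ?_)) le_rfl
  exact hx.spider_mul_pull_le hV s k m n

theorem spider_mul_sft_pull_two (hV : NestedSliding V) (s : Strand) (k m n i : ℕ)
    (hi : i + 2 ≤ 2 * k + 1) :
    V.spider s k m n * P.sft i (pull x 2) = V.spider s k m n * P.sft (i + 1) x := by
  obtain ⟨k, rfl⟩ := Nat.exists_eq_add_of_le' (show 1 ≤ k by omega)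
  rw [← spider_mul_gr hV s k m n i (by omega), mul_assoc, ← map_mul, hx.gr_pull hV, map_mul,
    ← mul_assoc, ← sft_succ']

theorem spider_mul_sft_push_two (hV : NestedSliding V) (s : Strand) (k m n i : ℕ)
    (hi : i + 2 ≤ 2 * k + 1) :
    V.spider s k m n * P.sft i (push x 2) = V.spider s k m n * P.sft i x := by
  obtain ⟨k, rfl⟩ := Nat.exists_eq_add_of_le' (show 1 ≤ k by omega)
  rw [← spider_mul_gr hV s k m n i (by omega), mul_assoc, ← map_mul, hx.gr_push hV, map_mul,
    ← mul_assoc]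

end

/-- The operation `π` permutes the first `n` wires: it does not affect the other wires, and it
preserves tidiness when these `n` wires belong to the same component. -/
def Shuffle (V : NestedVertex P.A P.Ad) (x : P.Tr) (n : ℕ) (π : P.Tr) : Prop :=
  (∀ T, P.sft n T * π = π * P.sft n T) ∧
  ∀ (B : Finset ℕ) (lx ly : List ℕ) (a : ℕ) (T : P.Tr),
    V.Tidy {x} B (lx ++ (List.replicate n a ++ ly)) T →
    V.Tidy {x} B (lx ++ (List.replicate n a ++ ly)) (T * P.sft lx.length π)

theorem Shuffle.one (n : ℕ) : Shuffle V x n 1 := by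
  refine ⟨fun T => by simp, fun B lx ly a T h => by simpa using h⟩

theorem replicate_eq_append {α : Type*} {n i : ℕ} (hi : i + 2 ≤ n) (a : α) :
    List.replicate n a = List.replicate i a ++ a :: a :: List.replicate (n - i - 2) a := by
  conv_lhs => rw [show n = i + (n - i - 2 + 2) by omega, List.replicate_add]
  rfl

section
variable (hx : V.Braiding x)
include hx

theorem shuffle_mul {n : ℕ} {π : P.Tr} (h : Shuffle V x n π) {i : ℕ} (hi : i + 2 ≤ n) :
    Shuffle V x n (π * P.sft i x) := by
  refine ⟨fun T => ?_, fun B lx ly a T hT => ?_⟩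
  · rw [← mul_assoc, h.1, mul_assoc, hx.sft_comm hi, mul_assoc]
  · have h1 := h.2 B lx ly a T hT
    rw [replicate_eq_append hi, List.append_assoc, ← List.append_assoc] at h1 ⊢
    have h2 := Tidy.swap x (Set.mem_singleton x) _ _ _ _ _ _ h1
    rwa [mul_assoc, List.length_append, List.length_replicate, sft_add, ← map_mul] at h2

/-- Moving a leg of a spider to the front turns it into a spider with its other legs shuffled. -/
theorem exists_spider_mul_pull (hV : NestedSliding V) (s : Strand) (k m n i : ℕ)
    (hi : i ≤ 2 * k + 1) : ∃ t m' n' π, Shuffle V x (2 * k + 1) π ∧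
      V.spider s k m n * pull x i = V.spider t k m' n' * P.sh π := by
  have key (i : ℕ) (hi : i + 2 ≤ 2 * k + 1) :
      V.spider s k m n * pull x (i + 2) = V.spider s k m n * pull x i * P.sh (P.sft i x) := by
    rw [pull_add, ← mul_assoc, hx.spider_mul_sft_pull_two hV _ _ _ _ _ hi, mul_assoc,
      hx.sft_mul_pull le_rfl, ← mul_assoc]
    rfl
  have key' (i : ℕ) (hi : i + 2 ≤ 2 * k + 1) :
      V.spider s k m n * pull x i = V.spider s k m n * pull x (i + 2) * P.sh (P.sft i x) := by
    conv_lhs => rw [← hx.mul_sw_mul_sw (hasLength_spider s k m n) (i := i + 1) (by omega),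
      ← hx.spider_mul_sft_pull_two hV _ _ _ _ _ hi, mul_assoc, hx.sft_mul_pull le_rfl]
    rw [pull_add]
    simp only [mul_assoc]
    rfl
  rcases Nat.even_or_odd' i with ⟨j, rfl | rfl⟩
  · induction j with
    | zero => exact ⟨s, m, n, 1, .one _, by simp [pull]⟩
    | succ j ih =>
      obtain ⟨t, m', n', π, hπ, e⟩ := ih (by omega)
      refine ⟨t, m', n', _, hx.shuffle_mul hπ (i := 2 * j) (by omega), ?_⟩
      rw [show 2 * (j + 1) = 2 * j + 2 by ring, key _ (by omega), e, map_mul, mul_assoc]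
  · obtain ⟨r, hr⟩ := Nat.exists_eq_add_of_le (show j ≤ k by omega)
    induction r generalizing j with
    | zero =>
      obtain rfl : j = k := by omega
      exact ⟨s.flip, n, m, 1, .one _, by simpa using hx.spider_mul_pull hV s j m n⟩
    | succ r ih =>
      obtain ⟨t, m', n', π, hπ, e⟩ := ih (j + 1) (by omega) (by omega)
      refine ⟨t, m', n', _, hx.shuffle_mul hπ (i := 2 * j + 1) (by omega), ?_⟩
      rw [key' _ (by omega), show 2 * j + 1 + 2 = 2 * (j + 1) + 1 by ring, e, map_mul, mul_assoc]

/-- Moving a leg of a spider to the end turns it into a spider with its other legs shuffled. -/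
theorem exists_spider_mul_push (hV : NestedSliding V) (s : Strand) (k m n i r : ℕ)
    (hi : i + r = 2 * k + 1) : ∃ t m' n' π, Shuffle V x (2 * k + 1) π ∧
      V.spider s k m n * P.sft i (push x r) = V.spider t k m' n' * π := by
  have key (i r : ℕ) (hi : i + 2 ≤ 2 * k + 1) :
      V.spider s k m n * P.sft i (push x (r + 2)) =
        V.spider s k m n * P.sft (i + 2) (push x r) * P.sft i x := by
    rw [add_comm r, push_add, map_mul, ← mul_assoc, hx.spider_mul_sft_push_two hV _ _ _ _ _ hi,
      mul_assoc, mul_assoc, ← sft_add, ← hx.sft_comm le_rfl]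
  rcases Nat.even_or_odd' r with ⟨j, rfl | rfl⟩
  · induction j generalizing i with
    | zero => exact ⟨s, m, n, 1, .one _, by simp [push]⟩
    | succ j ih =>
      obtain ⟨t, m', n', π, hπ, e⟩ := ih (i + 2) (by omega)
      refine ⟨t, m', n', _, hx.shuffle_mul hπ (i := i) (by omega), ?_⟩
      rw [show 2 * (j + 1) = 2 * j + 2 by ring, key _ _ (by omega), e, mul_assoc]
  · obtain ⟨c, rfl⟩ : ∃ c, i = 2 * c := ⟨k - j, by omega⟩
    induction c generalizing j with
    | zero =>
      obtain rfl : j = k := by omega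
      exact ⟨s.flip, n, m, 1, .one _, by simpa using hx.spider_mul_push hV s j m n⟩
    | succ c ih =>
      obtain ⟨t, m', n', π, hπ, e⟩ := ih (j + 1) (by omega)
      refine ⟨t, m', n', _, hx.shuffle_mul hπ (i := 2 * c) (by omega), ?_⟩
      rw [← mul_assoc, ← e, show 2 * (j + 1) + 1 = 2 * j + 1 + 2 by ring, key _ _ (by omega),
        show 2 * (c + 1) = 2 * c + 2 by ring,
        mul_assoc _ (P.sft (2 * c + 2) _) (P.sft (2 * c) x), hx.sft_comm le_rfl, ← mul_assoc,
        mul_assoc _ (P.sft (2 * c + 2) _) (P.sft (2 * c) x), hx.sft_comm le_rfl, ← mul_assoc,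
        hx.mul_sw_mul_sw (hasLength_spider s k m n) (by omega)]

/-- Connecting a strand on the left with a leg of a spider. -/
theorem exists_sh_spider_pull_mul_ca_le (hV : NestedSliding V) (s : Strand) (k m n q i : ℕ)
    (hi : i ≤ 2 * k + 1) : ∃ m' n' π, Shuffle V x (2 * k + 1) π ∧
      P.sh (P.sft q (V.spider s k m n) * pull x (q + i)) * V.ca ≤
        push x q * P.sft q (V.stalk k m' n' * π) := by
  obtain ⟨t, m', n', π, hπ, e⟩ := hx.exists_spider_mul_pull hV s k m n i hi
  refine ⟨n', m', π, hπ, ?_⟩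
  rw [pull_add, ← mul_assoc, ← map_mul, e, spider_eq_cu_mul_sh hV, mul_assoc (V.cu t), ← map_mul,
    map_mul (P.sft q) (V.cu t), mul_assoc, ← sft_succ', hx.sft_mul_pull le_rfl, ← mul_assoc,
    map_mul P.sh (_ * _), mul_assoc, sft_succ, V.mul_ca, ← mul_assoc]
  exact mul_le_mul (hx.sh_cu_pull_mul_ca_le t q) le_rfl

/-- Connecting a leg of a spider with a strand on the right. -/
theorem exists_spider_sh_pull_mul_ca_le (hV : NestedSliding V) (s : Strand) (k m n i r : ℕ)
    (hi : i + r = 2 * k + 1) : ∃ m' n' π, Shuffle V x (2 * k + 1) π ∧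
      V.spider s k m n * P.sft i (P.sh (pull x r) * V.ca) ≤ V.stalk k m' n' * π := by
  obtain ⟨t, m', n', π, hπ, e⟩ := hx.exists_spider_mul_push hV s k m n i r hi
  refine ⟨m', n', π, hπ, ?_⟩
  rw [hx.sh_pull_mul_ca, map_mul, ← mul_assoc, e, ← sft_add, hi, mul_assoc, ← hπ.1, ← mul_assoc]
  exact mul_le_mul (V.spider_mul_ca_le t k m' n') le_rfl

end
end Braiding
end NestedVertex
end

/-! ### Connecting distant legs -/

section
variable {C : Type u} [Category.{v} C] [MonoidalCategory C]

theorem append_cons_cons_eq {α : Type*} {lx' lx r ly' : List α} {c d a : α}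
    (h : lx' ++ c :: d :: ly' = lx ++ a :: r) :
    (∃ l, lx = lx' ++ c :: d :: l ∧ ly' = l ++ a :: r) ∨
    (lx = lx' ++ [c] ∧ d = a ∧ ly' = r) ∨
    (lx = lx' ∧ c = a ∧ d :: ly' = r) ∨
    (∃ l, lx' = lx ++ a :: l ∧ r = l ++ c :: d :: ly') := by
  rcases List.append_eq_append_iff.1 h with ⟨l, rfl, h1⟩ | ⟨l, rfl, h1⟩
  · match l, h1 with
    | [], h1 =>
      simp only [List.nil_append, List.cons.injEq] at h1
      exact Or.inr (Or.inr (Or.inl ⟨by simp, h1.1, h1.2⟩))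
    | [e], h1 =>
      simp only [List.cons_append, List.nil_append, List.cons.injEq] at h1
      obtain ⟨rfl, rfl, rfl⟩ := h1
      exact Or.inr (Or.inl ⟨rfl, rfl, rfl⟩)
    | e :: e' :: l, h1 =>
      simp only [List.cons_append, List.cons.injEq] at h1
      obtain ⟨rfl, rfl, rfl⟩ := h1
      exact Or.inl ⟨l, rfl, rfl⟩
  · match l, h1 with
    | [], h1 =>
      simp only [List.nil_append, List.cons.injEq] at h1
      exact Or.inr (Or.inr (Or.inl ⟨by simp, h1.1.symm, h1.2.symm⟩))
    | e :: l, h1 =>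
      simp only [List.cons_append, List.cons.injEq] at h1
      obtain ⟨rfl, rfl⟩ := h1
      exact Or.inr (Or.inr (Or.inr ⟨l, rfl, rfl⟩))

namespace NestedVertex
variable {P : DualObjects C} {V : NestedVertex P.A P.Ad} {W : Set P.Tr}
open DualObjects DualObjects.Tr

theorem Joined.mono {a b : ℕ} {B : Finset ℕ} {ls : List ℕ} {T K : P.Tr}
    (h : V.Joined W a b B ls K) (hT : T ≤ K) : V.Joined W a b B ls T := by
  obtain ⟨T', h1, h2⟩ := h
  exact ⟨T', hT.trans h1, h2⟩

theorem Joined.symm {a b : ℕ} {B : Finset ℕ} {ls : List ℕ} {T : P.Tr}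
    (h : V.Joined W a b B ls T) : V.Joined W b a B ls T := by
  obtain ⟨T', h1, h2⟩ := h
  have e : merge b a ∘ merge a b = merge b a := by
    funext l
    simp only [Function.comp, merge]
    split_ifs <;> simp_all
  have hinj : Set.InjOn (merge b a) (B.image (merge a b) : Finset ℕ) := by
    by_cases hab : a = b
    · subst hab
      intro x _ y _ hxy
      rwa [merge_self, merge_self] at hxy
    · have hb : ∀ y ∈ B.image (merge a b), y ≠ b := by
        intro y hy
        obtain ⟨z, -, rfl⟩ := Finset.mem_image.1 hy
        unfold merge
        split_ifs with hz
        exacts [hab, hz]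
      intro y hy z hz hyz
      have hy := hb y hy
      have hz := hb z hz
      unfold merge at hyz
      split_ifs at hyz <;> simp_all
  have h3 := h2.map _ hinj
  rw [Finset.image_image, List.map_map, e] at h3
  exact ⟨T', h1, h3⟩

theorem Joined.swap {x : P.Tr} (hx : x ∈ W) {a b : ℕ} {B : Finset ℕ} {lx ly : List ℕ} {c d : ℕ}
    {T : P.Tr} (h : V.Joined W a b B (lx ++ c :: d :: ly) T) :
    V.Joined W a b B (lx ++ d :: c :: ly) (T * P.sft lx.length x) := by
  obtain ⟨T', h1, h2⟩ := h
  refine ⟨_, mul_le_mul h1 le_rfl, ?_⟩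
  rw [List.map_append, List.map_cons, List.map_cons] at h2 ⊢
  have h3 := Tidy.swap x hx _ _ _ _ _ _ h2
  rwa [List.length_map] at h3

theorem Joined.adjoin {a b κ : ℕ} {B : Finset ℕ} {lx ly : List ℕ} {T : P.Tr}
    (h : V.Joined W a b B (lx ++ ly) T) (ha : a ∈ B) (hb : b ∈ B) (hκ : κ ∉ B) (s : Strand)
    (k m n : ℕ) : V.Joined W a b (insert κ B) (lx ++ (List.replicate (2 * k + 2) κ ++ ly))
      (T * P.sft lx.length (V.spider s k m n)) := by
  obtain ⟨T', h1, h2⟩ := h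
  have hκa : merge a b κ = κ := merge_of_ne fun e => hκ (e ▸ hb)
  have hκ' : κ ∉ B.image (merge a b) := by
    rw [Finset.mem_image]
    rintro ⟨x, hx, e⟩
    unfold merge at e
    split at e
    · exact hκ (e ▸ ha)
    · exact hκ (e ▸ hx)
  refine ⟨_, mul_le_mul h1 le_rfl, ?_⟩
  rw [List.map_append] at h2
  have h3 := Tidy.adjoin κ _ _ _ T' s k m n h2 hκ'
  rw [List.length_map] at h3
  rw [Finset.image_insert, List.map_append, List.map_append, List.map_replicate, hκa]
  exact h3

/-- Merging a new label into an old one. -/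
theorem Joined.of_tidy_left {a κ : ℕ} {B : Finset ℕ} {ls : List ℕ} {T : P.Tr}
    (h : V.Tidy W B (ls.map (merge a κ)) T) (ha : a ∈ B) (hκ : κ ∉ B) :
    V.Joined W a κ (insert κ B) ls T := by
  refine ⟨T, le_rfl, ?_⟩
  rwa [Finset.image_insert, merge_right, image_merge_of_not_mem hκ, Finset.insert_eq_of_mem ha]

theorem Joined.of_tidy_right {b κ : ℕ} {B : Finset ℕ} {ls : List ℕ} {T : P.Tr}
    (h : V.Tidy W B (ls.map (merge b κ)) T) (hb : b ∈ B) (hκ : κ ∉ B) :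
    V.Joined W κ b (insert κ B) ls T :=
  (Joined.of_tidy_left h hb hκ).symm

namespace Braiding
variable {x : P.Tr} (hx : V.Braiding x)
include hx

/-- Wires to the right of two connected legs are not affected. -/
theorem sft_mul_joint {m j : ℕ} (h : m ≤ j) (T : P.Tr) :
    P.sft (j + 2) T * (P.sh (pull x m) * V.ca) = P.sh (pull x m) * V.ca * P.sft j T := by
  rw [sft_succ, ← mul_assoc, ← map_mul, hx.sft_mul_pull (by omega), map_mul, mul_assoc,
    sft_succ, V.mul_ca, mul_assoc]

/-- Connecting two legs of the same spider. -/
theorem joined_inside (hV : NestedSliding V) {κ : ℕ} {B : Finset ℕ}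
    {lx ly : List ℕ} {T : P.Tr} (h : V.Tidy {x} B (lx ++ ly) T) (hκ : κ ∉ B) (s : Strand)
    (k m n i r : ℕ) (hi : i + r + 2 ≤ 2 * k + 2) :
    V.Joined {x} κ κ (insert κ B) (lx ++ (List.replicate (2 * k) κ ++ ly))
      (T * P.sft lx.length (V.spider s k m n * P.sft i (P.sh (pull x r) * V.ca))) := by
  induction r using Nat.twoStepInduction with
  | zero => simpa [pull] using h.joined_inside hV hκ s k m n i (by omega)
  | one =>
    obtain ⟨k, rfl⟩ := Nat.exists_eq_add_of_le' (show 1 ≤ k by omega)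
    -- legs with an odd number of legs between them have the same type and cannot be connected
    have hle : V.gr * (P.sh (pull x 1) * V.ca) ≤ V.lf := by
      have e : pull x 1 = x := by simp [pull]
      intro w L hL
      rw [e] at hL
      exfalso
      match w with
      | [] => cases hL
      | .up :: w =>
        obtain ⟨f, hf⟩ := hx.apply .down .up w
        have h1 : (V.gr * (P.sh x * V.ca)) (.up :: w) = none :=
          mul_apply_of_some_none rfl (mul_apply_of_some_none (sh_cons_some .up hf) rfl)
        rw [h1] at hL
        cases hL
      | .down :: w =>
        obtain ⟨f, hf⟩ := hx.apply .up .down w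
        have h1 : (V.gr * (P.sh x * V.ca)) (.down :: w) = none :=
          mul_apply_of_some_none rfl (mul_apply_of_some_none (sh_cons_some .down hf) rfl)
        rw [h1] at hL
        cases hL
    obtain ⟨m', n', e⟩ := spider_mul_lf hV s k m n i (by omega)
    refine ⟨T * P.sft lx.length (V.spider s k m' n'), mul_le_mul le_rfl (sft_mono _ ?_), ?_⟩
    · rw [← spider_mul_gr hV s k m n i (by omega), mul_assoc, ← map_mul, ← e]
      exact mul_le_mul le_rfl (sft_mono _ hle)
    · rw [image_merge_self, map_merge_self]
      exact .adjoin κ B lx ly T s k m' n' h hκ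
  | more r ih _ =>
    have ih := ih (by omega)
    rw [replicate_eq_append (i := i + r) (by omega), List.append_assoc, ← List.append_assoc] at ih ⊢
    have h2 := Joined.swap (Set.mem_singleton x) ih
    refine h2.mono (le_of_eq ?_)
    rw [mul_assoc, List.length_append, List.length_replicate, sft_add, ← map_mul, pull_add,
      map_mul P.sh, mul_assoc, map_mul (P.sft i), ← sft_succ, ← sft_add,
        ← mul_assoc (V.spider _ _ _ _),
      show i + (r + 1) = i + r + 1 by omega, hx.spider_mul_sft_pull_two hV _ _ _ _ _ (by omega)]
    congr 2
    rw [show P.sft (i + r + 1 + 1) x = P.sft i (P.sft (r + 2) x) by rw [← sft_add]; rfl,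
      mul_assoc, ← map_mul, hx.sft_mul_joint le_rfl, map_mul, ← sft_add, mul_assoc]

/-- Any two legs of a tidy operation can be connected, after one of them has been moved next to the
other. -/
theorem joined_far (hV : NestedSliding V) {B : Finset ℕ} {ls : List ℕ} {T : P.Tr}
    (h : V.Tidy {x} B ls T) {lx lm ly : List ℕ} {a b : ℕ} (hls : ls = lx ++ a :: (lm ++ b :: ly)) :
    V.Joined {x} a b B (lx ++ (lm ++ ly))
      (T * P.sft lx.length (P.sh (pull x lm.length) * V.ca)) := by
  induction h generalizing lx lm a b ly with
  | nil => simp at hls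
  | closed => simp at hls
  | lost κ κ' B ls T h h' hne hl hκ =>
    subst hls
    refine joined_of_lost _ h h' hne ?_ ?_ ?_ ?_
    · intro l hl'
      refine hl l ?_
      simp only [List.mem_append, List.mem_cons] at hl' ⊢
      tauto
    · intro hl'
      refine hκ ?_
      simp only [List.mem_append, List.mem_cons] at hl' ⊢
      tauto
    · rintro rfl
      simp at hκ
    · rintro rfl
      simp at hκ
  | adjoin κ B lx' ly' T s k m n h hκ ih =>
    have hmem := h.mem_of_mem
    rcases append_replicate_append_eq hls with ⟨l, rfl, h1⟩ | ⟨rfl, i, j, hij, rfl, h1⟩ |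
      ⟨l, rfl, rfl⟩
    · have ha : a ∈ B := hmem a (by simp)
      rcases append_replicate_append_eq h1.symm with ⟨l', rfl, rfl⟩ | ⟨rfl, i, j, hij, rfl, rfl⟩ |
        ⟨l', rfl, rfl⟩
      · have hb : b ∈ B := hmem b (by simp)
        have h2 := ih (lx := lx) (a := a) (lm := lm) (b := b) (ly := l' ++ ly') (by simp)
        rw [← List.append_assoc lm, ← List.append_assoc lx] at h2
        have h3 := h2.adjoin ha hb hκ s k m n
        convert h3 using 1
        · simp
        · rw [mul_assoc, mul_assoc]
          congr 1
          refine sft_mul_sft lx.length (x := lm.length + l'.length + 2) (y := 0) (x' := 0)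
            (y' := lm.length + l'.length) (hx.sft_mul_joint (by omega) _)
            (by simp; omega) (by simp) (by simp) (by simp)
      · obtain ⟨m', n', π, hπ, hle⟩ :=
          hx.exists_sh_spider_pull_mul_ca_le hV s k m n l.length i (by omega)
        refine Joined.mono (T := _) (K := T * P.sft lx.length
          (push x l.length * P.sft l.length (V.stalk k m' n' * π))) (.of_tidy_left ?_ ha hκ) ?_
        · have h2 := Tidy.mul_push (Set.mem_singleton x) l (lx := lx) (a := a) (ly := ly')
            (by simpa using h)
          rw [← List.append_assoc] at h2
          have h3 := hπ.2 _ _ _ _ _ (hx.tidy_stalk hV h2 k m' n')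
          convert h3 using 1
          · rw [← List.append_assoc, List.append_assoc lx, List.append_assoc l,
              ← List.append_assoc (List.replicate i b), ← List.replicate_add,
              show i + j = 2 * k + 1 by omega, ← List.append_assoc lx,
                List.map_append (l₁ := lx ++ l),
              List.map_append (l₁ := List.replicate _ _), List.map_replicate, merge_right,
              map_merge_of_not_mem fun hl => hκ (hmem _ (by simp at hl ⊢; tauto)),
              map_merge_of_not_mem fun hl => hκ (hmem _ (by simp [hl]))]
          · rw [List.length_append, sft_add, sft_add, map_mul, map_mul, map_mul]
            simp only [mul_assoc]
        · rw [mul_assoc, List.length_append, List.length_cons,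
            show lx.length + (l.length + 1) = lx.length + 1 + l.length by omega, sft_add, sft_succ',
            ← map_mul, ← mul_assoc, ← map_mul, List.length_append, List.length_replicate]
          exact mul_le_mul le_rfl (sft_mono _ hle)
      · have hb : b ∈ B := hmem b (by simp)
        have h2 := ih (lx := lx) (a := a) (lm := l ++ l') (b := b) (ly := ly) (by simp)
        rw [List.append_assoc, ← List.append_assoc lx] at h2
        have h3 := h2.adjoin ha hb hκ s k m n
        refine Joined.mono (T := _) (K := _) (by simpa using h3) ?_
        rw [mul_assoc, mul_assoc, List.length_append, List.length_cons,
          show lx.length + (l.length + 1) = lx.length + 1 + l.length by omega, sft_add, sft_succ',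
          ← map_mul, ← mul_assoc, ← map_mul, List.length_append, List.length_append,
          List.length_replicate, sft_add, ← map_mul (P.sft lx.length), ← map_mul (P.sft lx.length)]
        refine mul_le_mul le_rfl (sft_mono _ ?_)
        refine (mul_le_mul (sh_mono (hx.sft_spider_mul_pull_le hV s k m n _ _)) le_rfl).trans
          (le_of_eq ?_)
        rw [map_mul, mul_assoc, sft_succ, V.mul_ca, mul_assoc]
    · rcases append_replicate_append_eq (lx' := []) h1.symm with ⟨l, h2, -⟩ |
        ⟨rfl, i', j', hij', rfl, rfl⟩ | ⟨l, rfl, rfl⟩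
      · simp at h2
      · have h2 := hx.joined_inside hV h hκ s k m n i i' (by omega)
        convert h2 using 1
        · rw [show 2 * k = i + (i' + j') by omega, List.replicate_add, List.replicate_add]
          simp only [List.append_assoc, List.nil_append]
        · rw [List.length_append, List.length_replicate, mul_assoc, sft_add, ← map_mul,
            List.nil_append, List.length_replicate]
      · have hb : b ∈ B := hmem b (by simp)
        obtain ⟨m', n', π, hπ, hle⟩ :=
          hx.exists_spider_sh_pull_mul_ca_le hV s k m n i j (by omega)
        refine Joined.mono (T := _) (K := T * P.sft lx'.length
          (pull x l.length * (V.stalk k m' n' * π))) (.of_tidy_right ?_ hb hκ) ?_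
        · have h2 := Tidy.mul_pull (Set.mem_singleton x) l (lx := lx') (a := b) (ly := ly) h
          have h3 := hπ.2 _ _ _ _ _ (hx.tidy_stalk hV h2 k m' n')
          convert h3 using 1
          · rw [List.nil_append, List.append_assoc, List.append_assoc,
              ← List.append_assoc (List.replicate i a), ← List.replicate_add,
              show i + j = 2 * k + 1 by omega, List.map_append,
              List.map_append, List.map_replicate, merge_right,
              map_merge_of_not_mem fun hl => hκ (hmem _ (by simp [hl])),
              map_merge_of_not_mem fun hl => hκ (hmem _ (by simp at hl ⊢; tauto))]
          · rw [map_mul, map_mul]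
            simp only [mul_assoc]
        · rw [mul_assoc, List.length_append, List.length_replicate, List.nil_append,
            List.length_append, List.length_replicate, sft_add, ← map_mul, pull_add,
            map_mul P.sh (P.sft j _), mul_assoc (P.sh (P.sft j _)), map_mul (P.sft i), ← sft_succ,
              ← sft_add,
            show i + (j + 1) = 2 * k + 2 by omega, ← mul_assoc (V.spider _ _ _ _), ← mul_spider,
            mul_assoc]
          exact mul_le_mul le_rfl (sft_mono _ (mul_le_mul le_rfl hle))
    · have ha : a ∈ B := hmem a (by simp)
      have hb : b ∈ B := hmem b (by simp)
      have h2 := ih (lx := lx' ++ l) (a := a) (lm := lm) (b := b) (ly := ly) (by simp)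
      rw [List.append_assoc] at h2
      have h3 := h2.adjoin ha hb hκ s k m n
      convert h3 using 1
      · simp
      · rw [mul_assoc, mul_assoc]
        congr 1
        refine sft_mul_sft lx'.length (x := 0) (y := 2 * k + 2 + l.length) (x' := l.length)
          (y' := 0) ?_ (by simp) (by simp) (by simp) (by simp)
        rw [sft_zero, mul_spider, sft_add]
  | swap χ hχ B lx' d c ly' T h ih =>
    obtain rfl := hχ
    rcases append_cons_cons_eq hls with ⟨l, rfl, rfl⟩ | ⟨rfl, rfl, rfl⟩ | ⟨hlx, rfl, h1⟩ |
      ⟨l, rfl, h1⟩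
    · have h2 := ih (lx := lx' ++ d :: c :: l) (a := a) (lm := lm) (b := b) (ly := ly) (by simp)
      have h3 := Joined.swap (Set.mem_singleton χ) (lx := lx') (c := d) (d := c)
        (ly := l ++ (lm ++ ly)) (by simpa [-map_mul] using h2)
      convert h3 using 1
      · simp
      · rw [mul_assoc, mul_assoc, List.length_append, List.length_cons, List.length_cons,
          ← hx.sft_comm (by omega)]
    · have h2 := ih (lx := lx') (a := d) (lm := c :: lm) (b := b) (ly := ly) (by simp)
      convert h2 using 1
      · simp
      · rw [mul_assoc, List.length_append, List.length_singleton, sft_succ', ← map_mul,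
          List.length_cons, pull, map_mul P.sh _ V.ca,
          map_mul P.sh _ χ, ← mul_assoc χ, ← hx.comm, mul_assoc,
          hx.mul_sh_ca, mul_assoc]
    · subst hlx
      cases lm with
      | nil =>
        simp only [List.nil_append, List.cons.injEq] at h1
        obtain ⟨rfl, rfl⟩ := h1
        have h2 := ih (lx := lx) (a := d) (lm := []) (b := c) (ly := ly') (by simp)
        refine h2.symm.mono (le_of_eq ?_)
        rw [mul_assoc, ← map_mul]
        simp only [List.length_nil, pull, map_one, one_mul]
        rw [hx.mul_ca]
      | cons e lm =>
        simp only [List.cons_append, List.cons.injEq] at h1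
        obtain ⟨rfl, rfl⟩ := h1
        have h2 := ih (lx := lx ++ [d]) (a := c) (lm := lm) (b := b) (ly := ly) (by simp)
        refine Joined.mono (T := _) (K := _) (by simpa [-map_mul] using h2) ?_
        rw [mul_assoc, ← map_mul, sft_succ', List.length_cons, pull, map_mul P.sh _ χ,
          mul_assoc _ (P.sh χ), ← mul_assoc χ, ← hx.comm, mul_assoc, ← hx.mul_sh_ca,
          ← mul_assoc χ, map_mul P.sh _ V.ca]
        refine mul_le_mul le_rfl (sft_mono _ (mul_le_mul le_rfl ?_))
        simpa using mul_le_mul hx.mul_self_le (le_refl (P.sh V.ca))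
    · rcases append_cons_cons_eq h1.symm with ⟨l', rfl, rfl⟩ | ⟨rfl, rfl, rfl⟩ | ⟨rfl, rfl, rfl⟩ |
        ⟨l', rfl, rfl⟩
      · have h2 := ih (lx := lx) (a := a) (lm := l ++ d :: c :: l') (b := b) (ly := ly) (by simp)
        have h3 := Joined.swap (Set.mem_singleton χ) (lx := lx ++ l) (c := d) (d := c)
          (ly := l' ++ ly) (by simpa [-map_mul] using h2)
        convert h3 using 1
        · simp
        · rw [mul_assoc, mul_assoc]
          congr 1
          simp only [List.length_append, List.length_cons]
          refine sft_mul_sft lx.length (x := l.length + 1) (y := 0) (x' := 0) (y' := l.length) ?_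
            (by simp) (by simp) (by simp) (by simp)
          rw [sft_zero, sft_succ, ← mul_assoc, ← map_mul, hx.sw_mul_pull (by omega),
            map_mul, mul_assoc, sft_succ, V.mul_ca, mul_assoc]
      · have h2 := ih (lx := lx) (a := a) (lm := l) (b := d) (ly := c :: ly') (by simp)
        refine Joined.mono (T := _) (K := _) (by simpa [-map_mul] using h2) ?_
        rw [mul_assoc]
        refine mul_le_mul le_rfl ?_
        simp only [List.length_append, List.length_cons, List.length_nil, zero_add]
        rw [show lx.length + (l.length + 1) = lx.length + 1 + l.length by omega, sft_add, sft_succ',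
          ← map_mul, ← mul_assoc, ← map_mul]
        refine sft_mono _ (mul_le_mul (sh_mono ?_) le_rfl)
        rw [pull_add, ← mul_assoc, ← map_mul]
        have := mul_le_mul (sft_mono l.length hx.mul_self_le) (le_refl (pull χ l.length))
        simpa [pull] using this
      · have h2 := ih (lx := lx) (a := a) (lm := lm ++ [d]) (b := c) (ly := ly') (by simp)
        convert h2 using 1
        · simp
        · rw [mul_assoc]
          congr 1
          simp only [List.length_append, List.length_cons, List.length_nil, zero_add]
          rw [show lx.length + (lm.length + 1) = lx.length + 1 + lm.length by omega, sft_add,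
            sft_succ', ← map_mul, ← mul_assoc, ← map_mul, pull_add,
            show pull χ 1 = χ by simp [pull]]
      · have h2 := ih (lx := lx) (a := a) (lm := lm) (b := b) (ly := l' ++ d :: c :: ly') (by simp)
        have h3 := Joined.swap (Set.mem_singleton χ) (lx := lx ++ (lm ++ l')) (c := d) (d := c)
          (ly := ly') (by simpa [-map_mul] using h2)
        convert h3 using 1
        · simp
        · rw [mul_assoc, mul_assoc]
          congr 1
          exact sft_mul_sft lx.length (x := lm.length + l'.length + 2) (y := 0) (x' := 0)
            (y' := lm.length + l'.length) (hx.sft_mul_joint (by omega) _)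
            (by simp; omega) (by simp) (by simp) (by simp)

end Braiding
end NestedVertex
end

/-! ### The symmetry of a commutative Frobenius 3-structure -/

section
variable {C : Type u} [Category.{v} C] [MonoidalCategory C]

section Coherence
variable [SymmetricCategory C] {X Y : C}

omit [SymmetricCategory C] in
theorem swap_cap_coherence {f : X ⊗ Y ⟶ Y ⊗ X} {c : Y ⊗ X ⟶ 𝟙_ C} {c' : X ⊗ Y ⟶ 𝟙_ C}
    (h : f ≫ c = c') (Z : C) :
    ((α_ X Y Z).inv ≫ f ▷ Z ≫ (α_ Y X Z).hom) ≫ (α_ Y X Z).inv ≫ c ▷ Z ≫ (λ_ Z).hom =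
      (α_ X Y Z).inv ≫ c' ▷ Z ≫ (λ_ Z).hom := by
  simp [← h]

theorem mul_opposite_coherence (m : X ⊗ Y ⊗ X ⟶ X) (Z : C) :
    ((((α_ X Y (X ⊗ Z)).inv ≫ (β_ X Y).hom ▷ (X ⊗ Z) ≫ (α_ Y X (X ⊗ Z)).hom) ≫
      Y ◁ ((α_ X X Z).inv ≫ (β_ X X).hom ▷ Z ≫ (α_ X X Z).hom)) ≫
      (α_ Y X (X ⊗ Z)).inv ≫ (β_ Y X).hom ▷ (X ⊗ Z) ≫ (α_ X Y (X ⊗ Z)).hom) ≫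
      X ◁ (α_ Y X Z).inv ≫ (α_ X (Y ⊗ X) Z).inv ≫ m ▷ Z =
    X ◁ (α_ Y X Z).inv ≫ (α_ X (Y ⊗ X) Z).inv ≫
      ((β_ X (Y ⊗ X)).hom ≫ (β_ Y X).hom ▷ X ≫ (α_ X Y X).hom ≫ m) ▷ Z := by
  rw [BraidedCategory.braiding_tensor_right_hom]
  monoidal

end Coherence

namespace FrobeniusThreeStructure
variable {S : FrobeniusThreeStructure C}
open DualObjects DualObjects.Tr NestedVertex

theorem exists_rep_gr (hS : S.Sliding) (s : Strand) :
    ∃ f, Rep S.vertex.gr [s] [s, s.flip, s] f := by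
  cases s with
  | up => exact ⟨_, S.rep_gr⟩
  | down =>
    have h := sh_spider_mul_ca_le (S.nestedMul_sliding hS) .up 1 0 0
    simp only [spider, stalk, pow_zero, pow_one, one_mul] at h
    exact ⟨_, Rep.mono (((((S.rep_cu .up).mul (S.rep_gr.append [.down])).sft [.down]).mul
      ((S.rep_ca .down).append [.down, .up, .down]))) h⟩

theorem exists_rep_lf (hS : S.Sliding) (s : Strand) : ∃ f, Rep S.vertex.lf [s] [s] f := by
  obtain ⟨f, hf⟩ := exists_rep_gr hS s
  rw [← gr_mul_ca]
  exact ⟨_, hf.mul ((S.rep_ca s).append [s])⟩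

variable [SymmetricCategory C]

theorem braid_mul_ca (hC : S.Commutative) : S.braid * S.vertex.ca = S.vertex.ca := by
  have h : (β_ S.Ad S.A).hom ≫ S.cap = S.capSwap := by
    rw [hC.2, SymmetricCategory.symmetry_assoc]
  ext1 w
  match w with
  | [] => rfl
  | [a] => cases a <;> rfl
  | .up :: .up :: w => rfl
  | .down :: .down :: w => rfl
  | .up :: .down :: w =>
    refine (mul_apply_of_some_some (S.braid_apply .up .down w) rfl).trans
      (some_congr (P := S.toDualObjects) (w := .up :: .down :: w) (w' := w) ?_)
    exact swap_cap_coherence hC.2.symm _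
  | .down :: .up :: w =>
    refine (mul_apply_of_some_some (S.braid_apply .down .up w) rfl).trans
      (some_congr (P := S.toDualObjects) (w := .down :: .up :: w) (w' := w) ?_)
    exact swap_cap_coherence h _

variable (S) in
theorem braid_mul_sh_ca : S.braid * S.sh S.vertex.ca = S.sh S.braid * S.vertex.ca := by
  ext1 w
  match w with
  | [] => rfl
  | [a] => rfl
  | [a, b] => cases a <;> rfl
  | a :: b :: c :: w =>
    by_cases hc : c = a.flip
    · subst hc
      have h := (S.rep_ca a).push_natural b w
      simp only [List.length_cons, List.length_nil, zero_add, Nat.reduceAdd, push_two, push,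
        mul_one, List.cons_append, List.nil_append] at h
      refine (mul_apply_of_some _ (S.braid_apply a b (a.flip :: w))).trans ?_
      rw [h]
      refine (mul_apply_of_some _ (S.braid_apply a b (a.flip :: w))).symm.trans ?_
      rw [mul_assoc, ← mul_assoc]
      refine (mul_apply_of_some _ (S.braid_mul_braid_apply a b (a.flip :: w))).trans ?_
      simp
    · cases a <;> cases c <;> first | exact absurd rfl hc | rfl

/-- The symmetry of a commutative Frobenius 3-structure has all properties required of a braiding.
-/
theorem braiding (hS : S.Sliding) (hC : S.Commutative) : S.vertex.Braiding S.braid where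
  apply a b w := ⟨_, S.braid_apply a b w⟩
  length w L hL := by
    match w with
    | [] => cases hL
    | [a] => cases hL
    | a :: b :: w => cases hL; rfl
  comm := S.sh_sh_mul_braid
  yb := S.braid_yang_baxter
  mul_self_le := S.braid_mul_braid_le
  mul_gr := braid_mul_of_rep (fun s => by
    obtain ⟨f, hf⟩ := exists_rep_gr hS s
    exact ⟨_, f, rfl, hf⟩) rfl
  mul_sh_gr := braid_mul_sh_of_rep (fun s => by
    obtain ⟨f, hf⟩ := exists_rep_gr hS s
    exact ⟨_, f, rfl, hf⟩) rfl
  mul_lf := braid_mul_of_rep (fun s => by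
    obtain ⟨f, hf⟩ := exists_rep_lf hS s
    exact ⟨_, f, rfl, hf⟩) rfl
  mul_sh_lf := braid_mul_sh_of_rep (fun s => by
    obtain ⟨f, hf⟩ := exists_rep_lf hS s
    exact ⟨_, f, rfl, hf⟩) rfl
  cu_pull s w L hL := by
    cases w with
    | nil =>
      have : (S.vertex.cu s * pull S.braid 2) [] = none := by
        cases s <;> exact mul_apply_of_some_none rfl (pull_apply_none (by simp))
      rw [this] at hL
      cases hL
    | cons a w =>
      rw [← hL]
      have h := (S.rep_cu s).pull_natural a w
      simpa [pull] using h
  cu_push s w L hL := by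
    cases w with
    | nil => cases hL
    | cons a w =>
      rw [← hL]
      have h := (S.rep_cu s).push_natural a w
      simpa [push] using h.symm
  mul_sh_ca := S.braid_mul_sh_ca
  mul_ca := braid_mul_ca hC
  mu_comm w := by
    refine (mul_apply_of_some_some (mul_apply_of_some_some (mul_apply_of_some_some
      (S.braid_apply .up .down (.up :: w)) (sh_cons_some .down (S.braid_apply .up .up w)))
      (S.braid_apply .down .up (.up :: w))) (S.mu_up w)).trans (Eq.trans ?_ (S.mu_up w).symm)
    refine some_congr (P := S.toDualObjects) (w := .up :: .down :: .up :: w) (w' := .up :: w) ?_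
    refine (mul_opposite_coherence S.mul (S.word w)).trans ?_
    exact congrArg (fun f => S.A ◁ (α_ S.Ad S.A (S.word w)).inv ≫
      (α_ S.A (S.Ad ⊗ S.A) (S.word w)).inv ≫ f ▷ S.word w) hC.1

end FrobeniusThreeStructure
end

/-! ### Connected commutative diagrams -/

section
variable {C : Type u} [Category.{v} C] [MonoidalCategory C]

theorem closure_coherence {X Y : C} (c : 𝟙_ C ⟶ X ⊗ Y) (f : X ⟶ X) (e : X ⊗ Y ⟶ 𝟙_ C) :
    (c ≫ X ◁ (ρ_ Y).inv) ≫ f ▷ (Y ⊗ 𝟙_ C) ≫ X ◁ (ρ_ Y).hom ≫ e = c ≫ f ▷ Y ≫ e := by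
  simp only [Category.assoc, whisker_exchange_assoc, ← whiskerLeft_comp_assoc, Iso.inv_hom_id,
    whiskerLeft_id, Category.id_comp]

variable [SymmetricCategory C]

namespace DualObjects
variable {P : DualObjects C}

theorem rep_sft_braid (a b : Strand) (y x : List Strand) :
    Rep (P.sft x.length P.braid) (x ++ a :: b :: y) (x ++ b :: a :: y) (P.swapAt a b y x) := by
  refine ((rep_braid_head a b y).sft x).congr ?_
  induction x with
  | nil => rfl
  | cons s x ih => exact congrArg (fun f => P.ob s ◁ f) ih

theorem equivalent_of_bendIn {f g : P.Mor} (h : Relation.ReflTransGen P.BendIn f g) :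
    P.Equivalent f g := by
  induction h with
  | refl => exact .refl _
  | tail _ h ih => exact .trans _ _ _ ih (.rel _ _ (.bendIn _ _ h))

end DualObjects

namespace FrobeniusThreeStructure
variable {S : FrobeniusThreeStructure C}
open DualObjects DualObjects.Tr NestedVertex

variable (S) in
/-- The operation `T` creates `l` wires, and the diagram creating them is equivalent to a normal
form. -/
def HasNormalForm (T : S.Tr) (l : ℕ) : Prop :=
  ∃ (w : List Strand) (f : S.word [] ⟶ S.word w) (q n : ℕ), w.length = l ∧ Rep T [] w f ∧
    S.Equivalent ⟨[], w, f⟩ (S.normalForm 0 q n 0)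

theorem HasNormalForm.mul_braid {T : S.Tr} {l : ℕ} (h : S.HasNormalForm T l) {p : ℕ}
    (hp : p + 2 ≤ l) : S.HasNormalForm (T * S.sft p S.braid) l := by
  obtain ⟨w, f, q, n, rfl, hT, hf⟩ := h
  obtain ⟨x, a, b, y, rfl, rfl⟩ : ∃ x a b y, w = x ++ a :: b :: y ∧ x.length = p := by
    refine ⟨w.take p, w[p], w[p + 1], w.drop (p + 2), ?_, by simp; omega⟩
    rw [← List.drop_eq_getElem_cons, ← List.drop_eq_getElem_cons, List.take_append_drop]
  refine ⟨_, _, q, n, ?_, hT.mul (rep_sft_braid a b y x), ?_⟩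
  · simp
  · exact .trans _ _ _ (.symm _ _ (.rel _ _ (.swapOut a b x y [] f))) hf

theorem HasNormalForm.mul_pull {T : S.Tr} {l : ℕ} (h : S.HasNormalForm T l) {p r : ℕ}
    (hp : p + r + 1 ≤ l) : S.HasNormalForm (T * S.sft p (pull S.braid r)) l := by
  induction r generalizing p with
  | zero => simpa [pull] using h
  | succ r ih =>
    rw [pull, map_mul, ← mul_assoc, ← sft_succ']
    exact (ih (by omega)).mul_braid (by omega)

theorem hasNormalForm_spider (hS : S.Sliding) (hC : S.Commutative) (s : Strand) (k m n : ℕ) :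
    S.HasNormalForm (S.vertex.spider s k m n) (2 * k + 2) := by
  have hV := S.nestedMul_sliding hS
  have hx := braiding hS hC
  have hdown (m n : ℕ) : S.HasNormalForm (S.vertex.spider .down k m n) (2 * k + 2) := by
    have e : S.vertex.spider .down k m n = S.vertex.spider .down k 0 (m + n) := by
      rw [spider, spider, stalk, stalk, hx.rt_eq_lf hV, ← pow_add, pow_zero, one_mul]
    obtain ⟨F, hF, hR⟩ := exists_bendIn_rep_state (S.rep_normalForm 0 k (m + n) 0)
    have hle := S.vertex.state_normalForm_le hV 0 k (m + n) 0
    rw [zero_add] at hle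
    refine ⟨_, F, k, m + n, ?_, hR.mono (hle.trans_eq e.symm), .symm _ _ (equivalent_of_bendIn hF)⟩
    rw [List.length_append, Strand.length_turn, oddWord, oddWord, List.length_cons,
      List.length_cons,
      length_tailWord, length_tailWord]
    omega
  cases s with
  | down => exact hdown m n
  | up =>
    have h := (hdown n m).mul_pull (p := 0) (r := 2 * k + 1) (by omega)
    rwa [sft_zero, hx.spider_mul_pull hV] at h

/-- A tidy operation with a single component that has legs is a spider followed by swaps, which are
steps of the equivalence. -/
theorem hasNormalForm_of_tidy (hS : S.Sliding) (hC : S.Commutative) {κ : ℕ} {ls : List ℕ}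
    {T : S.Tr} (h : S.vertex.Tidy {S.braid} {κ} ls T) (hls : ls ≠ []) :
    S.HasNormalForm T ls.length := by
  generalize hB : ({κ} : Finset ℕ) = B at h
  induction h with
  | nil => exact absurd rfl hls
  | adjoin κ' B lx ly T s k m n h hκ =>
    have e : B = ∅ := by
      rw [Finset.eq_empty_iff_forall_notMem]
      intro b hb
      have h1 := hB ▸ Finset.mem_insert_self κ' B
      have h2 := hB ▸ Finset.mem_insert_of_mem (b := κ') hb
      rw [Finset.mem_singleton] at h1 h2
      exact hκ (h1.trans h2.symm ▸ hb)
    subst e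
    have hnil : lx ++ ly = [] :=
      List.eq_nil_iff_forall_not_mem.2 fun l hl => by simpa using h.mem_of_mem l hl
    obtain ⟨rfl, rfl⟩ := List.append_eq_nil_iff.1 hnil
    obtain rfl := h.eq_one rfl
    simpa using hasNormalForm_spider hS hC s k m n
  | closed => exact absurd rfl hls
  | lost κ' κ'' B ls T h h' hne =>
    subst hB
    exact absurd ((Finset.mem_singleton.1 h).trans (Finset.mem_singleton.1 h').symm) hne
  | swap χ hχ B lx a b ly T h ih =>
    obtain rfl := hχ
    have := (ih (by simp) hB).mul_braid (p := lx.length) (by simp)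
    simpa using this

/-- The state of a connected commutative diagram is tidy with a single component. -/
theorem exists_tidy_state_comm (hS : S.Sliding) (hC : S.Commutative) {w w' : List Strand}
    (d : Diagram .commutative w w') (hd : d.Connected) :
    ∃ (κ : ℕ) (ls : List ℕ) (T K : S.Tr), Rep K w w' (S.evalComm d) ∧ S.vertex.state K w ≤ T ∧
      S.vertex.Tidy {S.braid} {κ} ls T ∧ ls.length = w.length + w'.length := by
  have hV := S.nestedMul_sliding hS
  have hx := braiding hS hC
  obtain ⟨κ, ls, T, hT, h, hl⟩ := exists_tidy_state (V := S.vertex) (W := {S.braid})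
    (χ := fun _ => S.braid) (hx.legOp_gr hV)
    (fun {B T lx ly a b} h => by
      simpa [pull] using hx.joined_far hV h (lx := lx) (lm := []) (ly := ly) rfl)
    (fun _ => rfl) d hd
  exact ⟨κ, ls, T, _, S.rep_act _ d, hT, h, hl⟩

theorem equivalent_normalForm_of_connected (hS : S.Sliding) (hC : S.Commutative)
    {w w' : List Strand} (d : Diagram .commutative w w') (hd : d.Connected)
        (hw : w ≠ [] ∨ w' ≠ []) :
    ∃ q n, S.Equivalent ⟨w, w', S.evalComm d⟩ (S.normalForm 0 q n 0) := by
  obtain ⟨κ, ls, T, K, hK, hT, h, hl⟩ := exists_tidy_state_comm hS hC d hd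
  obtain ⟨F, hF, hR⟩ := exists_bendIn_rep_state hK
  obtain ⟨x, G, q, n, -, hG, hE⟩ := hasNormalForm_of_tidy hS hC h (by
    rintro rfl
    rw [List.length_nil] at hl
    rcases hw with hw | hw <;> exact hw (List.length_eq_zero_iff.1 (by omega)))
  refine ⟨q, n, .trans _ _ _ (equivalent_of_bendIn hF) ?_⟩
  rwa [Rep.unique hR hG hT]

omit [SymmetricCategory C] in
variable (S) in
/-- The closure of a normal form is represented by a spider with two legs that are connected with
each other. -/
theorem rep_closure (n : ℕ) : Rep (S.vertex.cu .up * S.vertex.lf ^ n * S.vertex.ca) [] []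
    (S.closure (iter S.leftLoop n)) := by
  rw [mul_assoc]
  refine Rep.congr (P := S.toDualObjects) (w := []) (w' := []) ((S.rep_cu_up.mul
    (((S.rep_lf_pow n).append [.down]).mul S.rep_ca_up))) ?_
  refine Eq.trans ?_ (closure_coherence S.cupSwap (iter S.leftLoop n) S.cap)
  exact congrArg (fun f : S.word [.up, .down] ⟶ S.word [.up, .down] =>
    (S.cupSwap ≫ S.A ◁ (ρ_ S.Ad).inv) ≫ f ≫ S.A ◁ (ρ_ S.Ad).hom ≫ S.cap)
    (loop_coherence (iter S.leftLoop n) (S.Ad ⊗ 𝟙_ C)).symm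

theorem eq_closure_of_connected (hS : S.Sliding) (hC : S.Commutative)
    (d : Diagram .commutative [] []) (hd : d.Connected) :
    ∃ n, S.evalComm d = S.closure (iter S.leftLoop n) := by
  have hV := S.nestedMul_sliding hS
  have hx := braiding hS hC
  obtain ⟨κ, ls, T, K, hK, hT, h, hl⟩ := exists_tidy_state_comm hS hC d hd
  obtain rfl : ls = [] := List.length_eq_zero_iff.1 hl
  obtain ⟨s, m, n, rfl⟩ : ∃ s m n, T = S.vertex.spider s 0 m n * S.vertex.ca := by
    generalize hB : ({κ} : Finset ℕ) = B at h
    generalize hls : ([] : List ℕ) = ls at h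
    cases h with
    | nil => simp at hB
    | adjoin κ' B lx ly T s k m n h hκ => simp [List.replicate_succ] at hls
    | closed κ' s m n => exact ⟨s, m, n, rfl⟩
    | lost κ' κ'' B ls T h h' hne =>
      subst hB
      exact absurd ((Finset.mem_singleton.1 h).trans (Finset.mem_singleton.1 h').symm) hne
    | swap χ hχ B lx a b ly T h => simp at hls
  have hup (m n : ℕ) : S.vertex.spider .up 0 m n = S.vertex.cu .up * S.vertex.lf ^ (m + n) := by
    rw [spider, stalk, hx.rt_eq_lf hV, ← pow_add, pow_zero, mul_one]
  have hdown (m n : ℕ) : S.vertex.spider .down 0 m n * S.vertex.ca =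
      S.vertex.spider .up 0 n m * S.vertex.ca := by
    rw [← hx.mul_ca, ← mul_assoc]
    have e := hx.spider_mul_pull hV .down 0 m n
    simp only [pull, map_one, one_mul] at e
    rw [e, hx.mul_ca]
    rfl
  rw [state_nil] at hT
  obtain ⟨j, hj⟩ : ∃ j, S.vertex.spider s 0 m n * S.vertex.ca =
      S.vertex.cu .up * S.vertex.lf ^ j * S.vertex.ca := by
    cases s with
    | up => exact ⟨_, by rw [hup]⟩
    | down => exact ⟨_, by rw [hdown, hup]⟩
  have := Rep.unique hK (S.rep_closure j) (hj ▸ hT)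
  exact ⟨j, eq_of_heq (DualObjects.Mor.mk.inj this).2.2⟩

end FrobeniusThreeStructure
end

theorem mainTheorem4 {C : Type u} [Category.{v} C] [MonoidalCategory C]
    (S : FrobeniusThreeStructure C) (hS : S.Sliding) :
    (∀ (w w' : List Strand) (d : Diagram .planar w w'), d.Connected → w ≠ [] →
      ∃ p q m n : ℕ, S.BendAtMostOne ⟨w, w', S.eval d⟩ (S.normalForm p q m n)) ∧
    (∀ [SymmetricCategory C], S.Commutative →
      (∀ (w w' : List Strand) (d : Diagram .commutative w w'), d.Connected →
        (w ≠ [] ∨ w' ≠ []) →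
        ∃ p q n : ℕ, S.Equivalent ⟨w, w', S.evalComm d⟩ (S.normalForm p q n 0)) ∧
      (∀ d : Diagram .commutative [] [], d.Connected →
        ∃ n : ℕ, S.evalComm d = S.closure (FrobeniusThreeStructure.iter S.leftLoop n))) := by
  refine ⟨fun w w' d hd hw => S.bendAtMostOne_of_connected hS d hd hw, fun hC => ⟨?_, ?_⟩⟩
  · intro w w' d hd hw
    obtain ⟨q, n, h⟩ := S.equivalent_normalForm_of_connected hS hC d hd hw
    exact ⟨0, q, n, h⟩
  · intro d hd
    exact S.eq_closure_of_connected hS hC d hd
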